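/- Let $\pi=\mathbb{C}[b_{-1},b_{-2},\dots]$ be the rank-one Heisenberg vertex algebra (level $1$), graded by $\deg b_{-k}=k$. For a graded vertex algebra $V$ let $U=\bigoplus_d U_d$ be the universal enveloping algebra of the Lie algebra $(V\otimes\mathbb{C}[t,t^{-1}])/\operatorname{im}(L_{-1}\otimes 1+1\otimes\frac{d}{dt})$ with bracket $[a_{[i]},b_{[j]}]=\sum_{k\ge0}\binom ik(a_{(k)}b)_{[i+j-k]}$, where $a_{[n]}$ is the class of $a\otimes t^n$, of degree $\deg a-n-1$. Put $N_L^nU_p=\sum_{j\le -n}U_{p-j}U_j$ and $N_R^nU_p=\sum_{i\ge n}U_iU_{p-i}$, let $\widehat U=\bigoplus_d\varprojlim_n U_d/N_L^nU_d$, and let $\mathscr U=\widehat U/\overline J$, where $\overline J$ is the degreewise closure of the two-sided ideal generated by the Jacobi relations $$\sum_{i\ge0}(-1)^i\tbinom{\ell}{i}\bigl(a_{[m+\ell-i]}b_{[n+i]}-(-1)^\ell b_{[n+\ell-i]}a_{[m+i]}\bigr)=\sum_{i\ge0}\tbinom mi(a_{(\ell+i)}b)_{[m+n-i]}\qquad(\ell,m,n\in\mathbb{Z},\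 a,b\in V)$$ and the vacuum relation $\mathbf 1_{[-1]}=1$; $\mathscr U$ carries the induced grading and the induced neighbourhoods $N_L^n\mathscr U_p$, $N_R^n\mathscr U_p$, where $N_L^n\mathscr U_0=N_R^n\mathscr U_0=:N^n\mathscr U_0$. With $\mathsf A=\mathscr U_0/N^1\mathscr U_0$, the $d$-th mode transition algebra is $$\mathfrak A_d(V)=(\mathscr U_d/N_L^1\mathscr U_d)\otimes_{\mathscr U_0}\mathsf A\otimes_{\mathscr U_0}(\mathscr U_{-d}/N_R^1\mathscr U_{-d}),\qquad (u\otimes a\otimes v)\star(u'\otimes a'\otimes v')=u\otimes a\,[vu']\,a'\otimes v'.$$ Proposition. For every $d\in\mathbb N$ there is a natural isomorphism of $\mathbb C$-algebras $\mathfrak A_d(\pi)\cong\operatorname{Mat}_{p(d)}(\mathbb C[x])$, where $p(d)$ is the number of partitions of $d$. Explicitly, write $H_n=(b_{-1})_{[n]}$ and index the rows and columns of matrices by the partitions of $d$; then there is such an isomorphism which, for all partitions $r=(r_1\ge\dots\ge r_n)$ and $s=(s_1\ge\dots\ge s_m)$ of $d$ and all $k\ge0$, sends $$H_{-r_1}\cdots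 H_{-r_n}\otimes [H_0^k]\otimes H_{s_m}\cdots H_{s_1}\ \longmapsto\ \sqrt{\|r\|}\,\sqrt{\|s\|}\;x^k\,E_{r,s},$$ where $E_{r,s}$ is the elementary matrix, $\|r\|=\prod_i r_i\cdot\prod_j m_j!$ and the $m_j$ are the multiplicities of the distinct parts of $r$. In particular, $\mathfrak A_d(\pi)$ has an identity element for every $d\in\mathbb N$. -/

import Mathlib

noncomputable section

/-! ## Graded algebras with compatible left and right neighbourhoods of zero -/

/-- Graded pieces `U_p` of a (complex, associative, unital) algebra together with the neighbourhoods
of zero `NL n p = N_L^n U_p` and `NR n p = N_R^n U_p` in each piece, subject to the rules which make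
the mode transition algebras well defined. -/
structure GradedSeminorm (R : Type*) [Ring R] [Algebra ℂ R] where
  /-- the homogeneous piece of degree `p` -/
  deg : ℤ → Submodule ℂ R
  /-- the `n`-th left neighbourhood of zero in degree `p` -/
  NL : ℤ → ℤ → Submodule ℂ R
  /-- the `n`-th right neighbourhood of zero in degree `p` -/
  NR : ℤ → ℤ → Submodule ℂ R
  one_mem : (1 : R) ∈ deg 0
  mul_mem : ∀ {p q : ℤ} {x y : R}, x ∈ deg p → y ∈ deg q → x * y ∈ deg (p + q)
  NL_le : ∀ n p, NL n p ≤ deg p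
  NR_eq : ∀ n p, NR (n + p) p = NL n p
  mul_NL : ∀ {n p q : ℤ} {x y : R}, x ∈ deg p → y ∈ NL n q → x * y ∈ NL n (p + q)
  NL_mul : ∀ {n p q : ℤ} {x y : R}, x ∈ NL n p → y ∈ deg q → x * y ∈ NL (n - q) (p + q)

namespace GradedSeminorm

open scoped TensorProduct

variable {R : Type*} [Ring R] [Algebra ℂ R] (G : GradedSeminorm R)

/-- `(U / N_L^1 U)_d = U_d / N_L^1 U_d`. -/
abbrev LQuot (d : ℤ) : Type _ := G.deg d ⧸ (G.NL 1 d).submoduleOf (G.deg d)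

/-- `(U / N_R^1 U)_d = U_d / N_R^1 U_d`. -/
abbrev RQuot (d : ℤ) : Type _ := G.deg d ⧸ (G.NR 1 d).submoduleOf (G.deg d)

/-- The zeroth Zhu algebra `A = U_0 / N^1 U_0`. -/
abbrev Zhu : Type _ := G.LQuot 0

/-- The class of `x ∈ U_d` in `(U / N_L^1 U)_d`. -/
abbrev lcls {d : ℤ} (x : R) (hx : x ∈ G.deg d) : G.LQuot d := Submodule.Quotient.mk ⟨x, hx⟩

/-- The class of `x ∈ U_d` in `(U / N_R^1 U)_d`. -/
abbrev rcls {d : ℤ} (x : R) (hx : x ∈ G.deg d) : G.RQuot d := Submodule.Quotient.mk ⟨x, hx⟩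

/-- The product of the ambient algebra, as a bilinear map between homogeneous pieces. -/
def degMul (p q r : ℤ) (h : p + q = r) : G.deg p →ₗ[ℂ] G.deg q →ₗ[ℂ] G.deg r :=
  LinearMap.mk₂ ℂ (fun x y => ⟨x.1 * y.1, h ▸ G.mul_mem x.2 y.2⟩)
    (fun _ _ _ => Subtype.ext (add_mul _ _ _)) (fun _ _ _ => Subtype.ext (smul_mul_assoc _ _ _))
    (fun _ _ _ => Subtype.ext (mul_add _ _ _)) (fun _ _ _ => Subtype.ext (mul_smul_comm _ _ _))

/-- A bilinear map descends to quotients when it vanishes on the submodules. -/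
def liftBilin {M N Q : Type*} [AddCommGroup M] [AddCommGroup N] [AddCommGroup Q] [Module ℂ M]
    [Module ℂ N] [Module ℂ Q] (M' : Submodule ℂ M) (N' : Submodule ℂ N) (f : M →ₗ[ℂ] N →ₗ[ℂ] Q)
    (hM : ∀ m ∈ M', ∀ n, f m n = 0) (hN : ∀ m, ∀ n ∈ N', f m n = 0) :
    (M ⧸ M') →ₗ[ℂ] (N ⧸ N') →ₗ[ℂ] Q :=
  (N'.liftQ (M'.liftQ f (fun m hm => LinearMap.ext (hM m hm))).flip (fun n hn => by
    refine LinearMap.ext fun m => ?_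
    obtain ⟨m, rfl⟩ := Submodule.Quotient.mk_surjective _ m
    exact hN m n hn)).flip

/-- The product of the Zhu algebra: `[a] [b] = [a b]`. -/
def zhuMul : G.Zhu →ₗ[ℂ] G.Zhu →ₗ[ℂ] G.Zhu :=
  liftBilin _ _ ((G.degMul 0 0 0 (by simp)).compr₂ (Submodule.mkQ _))
    (fun m hm n => by
      have := G.NL_mul (Submodule.mem_comap.1 hm) n.2
      exact (Submodule.Quotient.mk_eq_zero _).2 (Submodule.mem_comap.2 (by simpa [degMul] using this)))
    (fun m n hn => by
      have := G.mul_NL m.2 (Submodule.mem_comap.1 hn)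
      exact (Submodule.Quotient.mk_eq_zero _).2 (Submodule.mem_comap.2 (by simpa [degMul] using this)))

/-- The pairing `[u] ⊗ [v] ↦ u ⊛ v = [u v]` from `(U / N_R^1 U)_{-d} × (U / N_L^1 U)_d` to the Zhu
algebra. -/
def ostar (d : ℤ) : G.RQuot (-d) →ₗ[ℂ] G.LQuot d →ₗ[ℂ] G.Zhu :=
  liftBilin _ _ ((G.degMul (-d) d 0 (by simp)).compr₂ (Submodule.mkQ _))
    (fun m hm n => by
      have h1 : (m : R) ∈ G.NL (1 + d) (-d) := by
        have h := Submodule.mem_comap.1 hm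
        rw [← G.NR_eq]
        simpa using h
      have := G.NL_mul h1 n.2
      exact (Submodule.Quotient.mk_eq_zero _).2 (Submodule.mem_comap.2 (by simpa [degMul] using this)))
    (fun m n hn => by
      have := G.mul_NL m.2 (Submodule.mem_comap.1 hn)
      exact (Submodule.Quotient.mk_eq_zero _).2 (Submodule.mem_comap.2 (by simpa [degMul] using this)))

/-- `(U / N_L^1 U)_d ⊗ A ⊗ (U / N_R^1 U)_{-d}`, tensor products over `ℂ`. -/
abbrev PreModeTransition (d : ℤ) : Type _ := G.LQuot d ⊗[ℂ] (G.Zhu ⊗[ℂ] G.RQuot (-d))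

/-- The relations which turn the two tensor products over `ℂ` into tensor products over `U_0`. -/
def balanced (d : ℤ) : Submodule ℂ (G.PreModeTransition d) :=
  Submodule.span ℂ
    ({z | ∃ (x u a y : R) (hx : x ∈ G.deg d) (hu : u ∈ G.deg 0) (ha : a ∈ G.deg 0)
        (hy : y ∈ G.deg (-d)),
        z = G.lcls (d := d) (x * u) (by simpa using G.mul_mem hx hu) ⊗ₜ[ℂ]
              (G.lcls a ha ⊗ₜ[ℂ] G.rcls y hy)
          - G.lcls x hx ⊗ₜ[ℂ]
              (G.lcls (d := 0) (u * a) (by simpa using G.mul_mem hu ha) ⊗ₜ[ℂ] G.rcls y hy)} ∪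
     {z | ∃ (x u a y : R) (hx : x ∈ G.deg d) (hu : u ∈ G.deg 0) (ha : a ∈ G.deg 0)
        (hy : y ∈ G.deg (-d)),
        z = G.lcls x hx ⊗ₜ[ℂ]
              (G.lcls (d := 0) (a * u) (by simpa using G.mul_mem ha hu) ⊗ₜ[ℂ] G.rcls y hy)
          - G.lcls x hx ⊗ₜ[ℂ]
              (G.lcls a ha ⊗ₜ[ℂ] G.rcls (d := -d) (u * y) (by simpa using G.mul_mem hu hy))})

/-- The `d`-th mode transition algebra
`𝔄_d = (U / N_L^1 U)_d ⊗_{U_0} A ⊗_{U_0} (U / N_R^1 U)_{-d}`. -/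
def ModeTransition (d : ℤ) : Type _ := G.PreModeTransition d ⧸ G.balanced d

instance (d : ℤ) : AddCommGroup (G.ModeTransition d) :=
  inferInstanceAs (AddCommGroup (G.PreModeTransition d ⧸ G.balanced d))

instance (d : ℤ) : Module ℂ (G.ModeTransition d) :=
  inferInstanceAs (Module ℂ (G.PreModeTransition d ⧸ G.balanced d))

/-- The element `[x] ⊗ [a] ⊗ [y]` of `𝔄_d`. -/
def tmul {d : ℤ} (x a y : R) (hx : x ∈ G.deg d) (ha : a ∈ G.deg 0) (hy : y ∈ G.deg (-d)) :
    G.ModeTransition d :=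
  (G.balanced d).mkQ (G.lcls x hx ⊗ₜ[ℂ] (G.lcls a ha ⊗ₜ[ℂ] G.rcls y hy))

/-- `y ↦ (x' ⊗ (a' ⊗ y') ↦ (y ⊛ x') a' ⊗ y')`. -/
def contract (d : ℤ) :
    G.RQuot (-d) →ₗ[ℂ] G.PreModeTransition d →ₗ[ℂ] (G.Zhu ⊗[ℂ] G.RQuot (-d)) :=
  (TensorProduct.lift.equiv (RingHom.id ℂ) (G.LQuot d) (G.Zhu ⊗[ℂ] G.RQuot (-d))
      (G.Zhu ⊗[ℂ] G.RQuot (-d))).toLinearMap ∘ₗ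
    (G.ostar d).compr₂ (LinearMap.rTensorHom (G.RQuot (-d)) ∘ₗ G.zhuMul)

/-- `(x ⊗ (a ⊗ y)) ⋆ (x' ⊗ (a' ⊗ y')) = x ⊗ (a (y ⊛ x') a' ⊗ y')`. -/
def preStar (d : ℤ) :
    G.PreModeTransition d →ₗ[ℂ] G.PreModeTransition d →ₗ[ℂ] G.PreModeTransition d :=
  TensorProduct.lift (LinearMap.mk₂ ℂ
    (fun x w => (TensorProduct.mk ℂ _ _ x) ∘ₗ
      TensorProduct.lift ((LinearMap.llcomp ℂ _ _ _).compl₁₂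
        (LinearMap.rTensorHom (G.RQuot (-d)) ∘ₗ G.zhuMul) (G.contract d)) w)
    (fun x x' w => by ext; simp)
    (fun c x w => by ext; simp [TensorProduct.smul_tmul'])
    (fun x w w' => by ext; simp [TensorProduct.tmul_add])
    (fun c x w => by ext; simp))

@[simp] theorem preStar_tmul (d : ℤ) (x x' : G.LQuot d) (a a' : G.Zhu) (y y' : G.RQuot (-d)) :
    G.preStar d (x ⊗ₜ[ℂ] (a ⊗ₜ[ℂ] y)) (x' ⊗ₜ[ℂ] (a' ⊗ₜ[ℂ] y')) =
      x ⊗ₜ[ℂ] (G.zhuMul a (G.zhuMul (G.ostar d y x') a') ⊗ₜ[ℂ] y') := by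
  simp [preStar, contract]

theorem zhuMul_assoc (a b c : G.Zhu) :
    G.zhuMul (G.zhuMul a b) c = G.zhuMul a (G.zhuMul b c) := by
  obtain ⟨a, rfl⟩ := Submodule.Quotient.mk_surjective _ a
  obtain ⟨b, rfl⟩ := Submodule.Quotient.mk_surjective _ b
  obtain ⟨c, rfl⟩ := Submodule.Quotient.mk_surjective _ c
  exact congrArg Submodule.Quotient.mk (Subtype.ext (mul_assoc _ _ _))

/-- Induction on `(U / N_L^1 U)_d ⊗ A ⊗ (U / N_R^1 U)_{-d}` from classes of ring elements. -/
theorem pre_induction {d : ℤ} {P : G.PreModeTransition d → Prop} (z : G.PreModeTransition d)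
    (zero : P 0) (add : ∀ z w, P z → P w → P (z + w))
    (tmul : ∀ (x a y : R) (hx : x ∈ G.deg d) (ha : a ∈ G.deg 0) (hy : y ∈ G.deg (-d)),
      P (G.lcls x hx ⊗ₜ[ℂ] (G.lcls a ha ⊗ₜ[ℂ] G.rcls y hy))) : P z := by
  induction z using TensorProduct.induction_on with
  | zero => exact zero
  | add z w hz hw => exact add z w hz hw
  | tmul x w =>
    induction w using TensorProduct.induction_on with
    | zero => simpa using zero
    | add z w hz hw => rw [TensorProduct.tmul_add]; exact add _ _ hz hw
    | tmul a y =>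
      obtain ⟨x, rfl⟩ := Submodule.Quotient.mk_surjective _ x
      obtain ⟨a, rfl⟩ := Submodule.Quotient.mk_surjective _ a
      obtain ⟨y, rfl⟩ := Submodule.Quotient.mk_surjective _ y
      exact tmul _ _ _ x.2 a.2 y.2

theorem preStar_assoc (d : ℤ) (z w v : G.PreModeTransition d) :
    G.preStar d (G.preStar d z w) v = G.preStar d z (G.preStar d w v) := by
  induction z using G.pre_induction with
  | zero => simp
  | add _ _ h h' => simp only [map_add, LinearMap.add_apply, h, h']
  | tmul x a y =>
    induction w using G.pre_induction with
    | zero => simp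
    | add _ _ h h' => simp only [map_add, LinearMap.add_apply, h, h']
    | tmul x' a' y' =>
      induction v using G.pre_induction with
      | zero => simp
      | add _ _ h h' => simp only [map_add, h, h']
      | tmul => simp only [preStar_tmul, zhuMul_assoc]

theorem preStar_balanced_left (d : ℤ) (z w : G.PreModeTransition d) (hz : z ∈ G.balanced d) :
    G.preStar d z w ∈ G.balanced d := by
  have key : G.balanced d ≤ (G.balanced d).comap ((G.preStar d).flip w) := by
    refine Submodule.span_le.2 ?_
    intro z hz
    rw [SetLike.mem_coe, Submodule.mem_comap, LinearMap.flip_apply]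
    induction w using G.pre_induction with
    | zero => simp
    | add _ _ h h' => rw [map_add]; exact Submodule.add_mem _ h h'
    | tmul x' a' y' hx' ha' hy' =>
      rcases hz with ⟨x, u, a, y, hx, hu, ha, hy, rfl⟩ | ⟨x, u, a, y, hx, hu, ha, hy, rfl⟩
      · rw [map_sub, LinearMap.sub_apply, preStar_tmul, preStar_tmul]
        refine Submodule.subset_span (Or.inl ⟨x, u, a * (y * x' * a'), y', hx, hu, ?_, hy', ?_⟩)
        · simpa using G.mul_mem ha (G.mul_mem (G.mul_mem hy hx') ha')
        · congr 3
          exact congrArg Submodule.Quotient.mk (Subtype.ext (mul_assoc _ _ _))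
      · rw [map_sub, LinearMap.sub_apply, preStar_tmul, preStar_tmul]
        convert Submodule.zero_mem _
        rw [sub_eq_zero]
        congr 2
        refine congrArg Submodule.Quotient.mk (Subtype.ext ?_)
        change a * u * (y * x' * a') = a * (u * y * x' * a')
        simp only [mul_assoc]
  exact key hz

theorem preStar_balanced_right (d : ℤ) (z w : G.PreModeTransition d) (hw : w ∈ G.balanced d) :
    G.preStar d z w ∈ G.balanced d := by
  have key : G.balanced d ≤ (G.balanced d).comap (G.preStar d z) := by
    refine Submodule.span_le.2 ?_
    intro w hw
    rw [SetLike.mem_coe, Submodule.mem_comap]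
    induction z using G.pre_induction with
    | zero => simp
    | add _ _ h h' => rw [map_add]; exact Submodule.add_mem _ h h'
    | tmul x' a' y' hx' ha' hy' =>
      rcases hw with ⟨x, u, a, y, hx, hu, ha, hy, rfl⟩ | ⟨x, u, a, y, hx, hu, ha, hy, rfl⟩
      · rw [map_sub, preStar_tmul, preStar_tmul]
        convert Submodule.zero_mem _
        rw [sub_eq_zero]
        congr 2
        refine congrArg Submodule.Quotient.mk (Subtype.ext ?_)
        change a' * (y' * (x * u) * a) = a' * (y' * x * (u * a))
        simp only [mul_assoc]
      · rw [map_sub, preStar_tmul, preStar_tmul]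
        refine Submodule.subset_span (Or.inr ⟨x', u, a' * (y' * x * a), y, hx', hu, ?_, hy, ?_⟩)
        · simpa using G.mul_mem ha' (G.mul_mem (G.mul_mem hy' hx) ha)
        · congr 3
          refine congrArg Submodule.Quotient.mk (Subtype.ext ?_)
          change a' * (y' * x * (a * u)) = a' * (y' * x * a) * u
          simp only [mul_assoc]
  exact key hw

/-- The product `⋆` of `𝔄_d`. -/
def star (d : ℤ) : G.ModeTransition d →ₗ[ℂ] G.ModeTransition d →ₗ[ℂ] G.ModeTransition d :=
  liftBilin _ _ ((G.preStar d).compr₂ (Submodule.mkQ _))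
    (fun z hz w => (Submodule.Quotient.mk_eq_zero _).2 (G.preStar_balanced_left d z w hz))
    (fun z w hw => (Submodule.Quotient.mk_eq_zero _).2 (G.preStar_balanced_right d z w hw))

instance (d : ℤ) : NonUnitalRing (G.ModeTransition d) :=
  { (inferInstance : AddCommGroup (G.ModeTransition d)) with
    mul := fun z w => G.star d z w
    left_distrib := fun z w v => map_add (G.star d z) w v
    right_distrib := fun z w v => LinearMap.map_add₂ (G.star d) z w v
    zero_mul := fun z => LinearMap.map_zero₂ (G.star d) z
    mul_zero := fun z => map_zero (G.star d z)
    mul_assoc := fun z w v => by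
      obtain ⟨z, rfl⟩ := Submodule.Quotient.mk_surjective _ z
      obtain ⟨w, rfl⟩ := Submodule.Quotient.mk_surjective _ w
      obtain ⟨v, rfl⟩ := Submodule.Quotient.mk_surjective _ v
      exact congrArg Submodule.Quotient.mk (G.preStar_assoc d z w v) }

instance (d : ℤ) : IsScalarTower ℂ (G.ModeTransition d) (G.ModeTransition d) :=
  ⟨fun c z w => LinearMap.map_smul₂ (G.star d) c z w⟩

instance (d : ℤ) : SMulCommClass ℂ (G.ModeTransition d) (G.ModeTransition d) :=
  ⟨fun c z w => (map_smul (G.star d z) c w).symm⟩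

/-- The defining formula `(x ⊗ a ⊗ y) ⋆ (x' ⊗ a' ⊗ y') = x ⊗ a (y ⊛ x') a' ⊗ y'`. -/
theorem tmul_mul_tmul {d : ℤ} {x a y x' a' y' : R} (hx : x ∈ G.deg d) (ha : a ∈ G.deg 0)
    (hy : y ∈ G.deg (-d)) (hx' : x' ∈ G.deg d) (ha' : a' ∈ G.deg 0) (hy' : y' ∈ G.deg (-d)) :
    G.tmul x a y hx ha hy * G.tmul x' a' y' hx' ha' hy' =
      G.tmul x (a * (y * x' * a')) y' hx
        (by simpa using G.mul_mem ha (G.mul_mem (G.mul_mem hy hx') ha')) hy' :=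
  congrArg (G.balanced d).mkQ (G.preStar_tmul d _ _ _ _ _ _)

end GradedSeminorm

/-! ## The universal enveloping algebra of a graded vertex algebra -/

/-- The data of a `ℤ`-graded vertex algebra on `V` which enter the construction of its enveloping
algebra: the grading, the vacuum, the translation operator and the products `a_(n) b`, together with
their degrees. (The remaining laws of a vertex algebra are not needed for writing down the
construction, and so are not recorded here.) -/
structure GradedVertexData (V : Type*) [AddCommGroup V] [Module ℂ V] where
  grade : ℤ → Submodule ℂ V
  isInternal : DirectSum.IsInternal grade
  grade_neg : ∀ p < 0, grade p = ⊥
  vacuum : V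
  vacuum_mem : vacuum ∈ grade 0
  /-- the translation operator `T = L_{-1}` -/
  T : V →ₗ[ℂ] V
  T_mem : ∀ {p : ℤ} {a : V}, a ∈ grade p → T a ∈ grade (p + 1)
  /-- `nth n a b = a_(n) b`, where `Y(a, z) = ∑ a_(n) z^(-n-1)` -/
  nth : ℤ → V →ₗ[ℂ] V →ₗ[ℂ] V
  nth_mem : ∀ {p q : ℤ} (n : ℤ) {a b : V}, a ∈ grade p → b ∈ grade q →
    nth n a b ∈ grade (p + q - n - 1)

namespace GradedVertexData

variable {V : Type*} [AddCommGroup V] [Module ℂ V] (D : GradedVertexData V)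

/-- `∇ = T ⊗ 1 + 1 ⊗ d/dt` on `V ⊗ ℂ[t, t⁻¹]`, where `Finsupp.single n a` stands for `a ⊗ t^n`. -/
def nabla : (ℤ →₀ V) →ₗ[ℂ] (ℤ →₀ V) :=
  Finsupp.lsum ℂ fun n : ℤ =>
    (Finsupp.lsingle n : V →ₗ[ℂ] (ℤ →₀ V)) ∘ₗ D.T + (n : ℂ) • Finsupp.lsingle (n - 1)

/-- `L(V) = (V ⊗ ℂ[t, t⁻¹]) / im ∇`, the vector space of the finite ancillary Lie algebra. -/
abbrev Ancillary : Type _ := (ℤ →₀ V) ⧸ LinearMap.range D.nabla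

/-- `a_[n]`, the class of `a ⊗ t^n`. -/
def ancMode (a : V) (n : ℤ) : D.Ancillary := Submodule.Quotient.mk (Finsupp.single n a)

/-- The relations `ℓ ℓ' = ℓ' ℓ + [ℓ, ℓ']` of the universal enveloping algebra of `L(V)`, for the
bracket `[a_[i], b_[j]] = ∑_k (i choose k) (a_(k) b)_[i+j-k]`. (The sum is finite for degree
reasons.) -/
inductive EnvRel : TensorAlgebra ℂ D.Ancillary → TensorAlgebra ℂ D.Ancillary → Prop
  | bracket (a b : V) (i j : ℤ) :
      EnvRel (TensorAlgebra.ι ℂ (D.ancMode a i) * TensorAlgebra.ι ℂ (D.ancMode b j))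
        (TensorAlgebra.ι ℂ (D.ancMode b j) * TensorAlgebra.ι ℂ (D.ancMode a i) +
          TensorAlgebra.ι ℂ (∑ᶠ k : ℕ,
            ((Ring.choose i k : ℤ) : ℂ) • D.ancMode (D.nth k a b) (i + j - k)))

/-- `U`, the universal enveloping algebra of `L(V)`. -/
def Env : Type _ := RingQuot D.EnvRel

instance : Ring D.Env := inferInstanceAs (Ring (RingQuot D.EnvRel))

instance : Algebra ℂ D.Env := inferInstanceAs (Algebra ℂ (RingQuot D.EnvRel))

/-- The element of `U` given by an element of `L(V)`. -/
def envOf : D.Ancillary →ₗ[ℂ] D.Env :=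
  (RingQuot.mkAlgHom ℂ D.EnvRel).toLinearMap ∘ₗ TensorAlgebra.ι ℂ

/-- The element `a_[n]` of `U`. -/
def envMode (a : V) (n : ℤ) : D.Env := D.envOf (D.ancMode a n)

/-- Products of homogeneous modes, with their degrees: `a_[n]` has degree `deg a - n - 1`. -/
inductive IsMonomial : ℤ → D.Env → Prop
  | one : IsMonomial 0 1
  | cons {p d : ℤ} {a : V} {u : D.Env} (ha : a ∈ D.grade p) (n : ℤ) (hu : IsMonomial d u) :
      IsMonomial (p - n - 1 + d) (D.envMode a n * u)

/-- `U_d`, the span of the products of homogeneous modes of total degree `d`. -/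
def envDeg (d : ℤ) : Submodule ℂ D.Env := Submodule.span ℂ {u | D.IsMonomial d u}

/-- `N_L^n U = U U_{≤ -n}`. -/
def envNbhd (n : ℤ) : Ideal D.Env := Ideal.span {u | ∃ j ≤ -n, u ∈ D.envDeg j}

/-- `N_L^n U_p = ∑_{j ≤ -n} U_{p-j} U_j`. -/
def envNL (n p : ℤ) : Submodule ℂ D.Env := ⨆ j : {j : ℤ // j ≤ -n}, D.envDeg (p - j) * D.envDeg j

/-- `N_R^n U_p = ∑_{i ≥ n} U_i U_{p-i}`. -/
def envNR (n p : ℤ) : Submodule ℂ D.Env := ⨆ i : {i : ℤ // n ≤ i}, D.envDeg i * D.envDeg (p - i)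

theorem IsMonomial.mul {p q : ℤ} {x y : D.Env} (hx : D.IsMonomial p x) (hy : D.IsMonomial q y) :
    D.IsMonomial (p + q) (x * y) := by
  induction hx with
  | one => simpa using hy
  | cons ha n hu ih => rw [mul_assoc, add_assoc]; exact IsMonomial.cons ha n ih

theorem envDeg_mul_le (p q : ℤ) : D.envDeg p * D.envDeg q ≤ D.envDeg (p + q) := by
  rw [envDeg, envDeg, Submodule.span_mul_span, Submodule.span_le]
  rintro _ ⟨x, hx, y, hy, rfl⟩
  exact Submodule.subset_span (IsMonomial.mul D hx hy)

theorem one_mem_envDeg : (1 : D.Env) ∈ D.envDeg 0 := Submodule.subset_span IsMonomial.one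

theorem envNL_le (n p : ℤ) : D.envNL n p ≤ D.envDeg p :=
  iSup_le fun j => (D.envDeg_mul_le _ _).trans (by rw [sub_add_cancel])

theorem envNR_eq (n p : ℤ) : D.envNR (n + p) p = D.envNL n p := by
  refine le_antisymm (iSup_le fun i => ?_) (iSup_le fun j => ?_)
  · refine le_trans ?_ (le_iSup _ (⟨p - i, by have := i.2; omega⟩ : {j : ℤ // j ≤ -n}))
    simp
  · refine le_trans ?_ (le_iSup _ (⟨p - j, by have := j.2; omega⟩ : {i : ℤ // n + p ≤ i}))
    simp

theorem envDeg_mul_envNL_le (n p q : ℤ) : D.envDeg p * D.envNL n q ≤ D.envNL n (p + q) := by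
  rw [envNL, Submodule.mul_iSup]
  refine iSup_le fun j => ?_
  refine le_trans ?_ (le_iSup _ j)
  rw [← mul_assoc, add_sub_assoc]
  exact mul_le_mul_left (D.envDeg_mul_le _ _) _

theorem envNL_mul_envDeg_le (n p q : ℤ) :
    D.envNL n p * D.envDeg q ≤ D.envNL (n - q) (p + q) := by
  rw [envNL, Submodule.iSup_mul]
  refine iSup_le fun j => ?_
  refine le_trans ?_ (le_iSup _ (⟨j + q, by have := j.2; omega⟩ : {j : ℤ // j ≤ -(n - q)}))
  rw [mul_assoc]
  simp only [add_sub_add_right_eq_sub]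
  exact mul_le_mul_right (D.envDeg_mul_le _ _) _

theorem iSup_envDeg : ⨆ d, D.envDeg d = ⊤ := by
  have h1 : ∀ (a : V) (n : ℤ), D.envMode a n ∈ ⨆ d, D.envDeg d := by
    intro a n
    have ha : a ∈ ⨆ p, D.grade p := by
      rw [D.isInternal.submodule_iSup_eq_top]; trivial
    have hle : ⨆ p, D.grade p ≤ (⨆ d, D.envDeg d).comap
        (D.envOf ∘ₗ Submodule.mkQ _ ∘ₗ (Finsupp.lsingle n : V →ₗ[ℂ] (ℤ →₀ V))) := by
      refine iSup_le fun p b hb => ?_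
      refine Submodule.mem_iSup_of_mem (p - n - 1 + 0) (Submodule.subset_span ?_)
      have := IsMonomial.cons hb n (IsMonomial.one (D := D))
      rwa [mul_one] at this
    exact hle ha
  have h2 : ∀ x : D.Ancillary, D.envOf x ∈ ⨆ d, D.envDeg d := by
    intro x
    obtain ⟨f, rfl⟩ := Submodule.Quotient.mk_surjective _ x
    induction f using Finsupp.induction_linear with
    | zero => simp
    | add f g hf hg => rw [Submodule.Quotient.mk_add, map_add]; exact Submodule.add_mem _ hf hg
    | single n a => exact h1 a n
  have hmul : ∀ x ∈ ⨆ d, D.envDeg d, ∀ y ∈ ⨆ d, D.envDeg d, x * y ∈ ⨆ d, D.envDeg d := by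
    intro x hx y hy
    have h := Submodule.mul_mem_mul hx hy
    rw [Submodule.iSup_mul] at h
    refine (iSup_le fun p => ?_ : _ ≤ ⨆ d, D.envDeg d) h
    rw [Submodule.mul_iSup]
    exact iSup_le fun q => (D.envDeg_mul_le p q).trans (le_iSup _ _)
  rw [eq_top_iff]
  rintro u -
  obtain ⟨t, rfl⟩ := RingQuot.mkAlgHom_surjective ℂ D.EnvRel u
  induction t using TensorAlgebra.induction with
  | algebraMap r =>
    rw [AlgHom.commutes, Algebra.algebraMap_eq_smul_one]
    exact Submodule.smul_mem _ _ (Submodule.mem_iSup_of_mem 0 D.one_mem_envDeg)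
  | ι x => exact h2 x
  | mul a b ha hb => rw [map_mul]; exact hmul _ ha _ hb
  | add a b ha hb => rw [map_add]; exact Submodule.add_mem _ ha hb

theorem envNbhd_anti {m n : ℤ} (h : n ≤ m) : D.envNbhd m ≤ D.envNbhd n :=
  Ideal.span_mono fun _ ⟨j, hj, hu⟩ => ⟨j, by omega, hu⟩

theorem envNbhd_mul_right (x : D.Env) (n : ℤ) :
    ∃ m, ∀ u ∈ D.envNbhd m, u * x ∈ D.envNbhd n := by
  have hx : x ∈ ⨆ d, D.envDeg d := by rw [D.iSup_envDeg]; trivial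
  induction hx using Submodule.iSup_induction' with
  | mem d x hx =>
    refine ⟨n + d, fun u hu => ?_⟩
    induction hu using Submodule.span_induction with
    | mem u hu =>
      obtain ⟨j, hj, hu⟩ := hu
      exact Ideal.subset_span ⟨j + d, by omega, D.envDeg_mul_le _ _ (Submodule.mul_mem_mul hu hx)⟩
    | zero => simp
    | add u v _ _ hu hv => rw [add_mul]; exact Ideal.add_mem _ hu hv
    | smul r u _ hu => rw [smul_eq_mul, mul_assoc]; exact Ideal.mul_mem_left _ _ hu
  | zero => exact ⟨0, fun u _ => by simp⟩
  | add x y _ _ hx hy =>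
    obtain ⟨m, hm⟩ := hx
    obtain ⟨k, hk⟩ := hy
    refine ⟨max m k, fun u hu => ?_⟩
    rw [mul_add]
    exact Ideal.add_mem _ (hm u (D.envNbhd_anti (le_max_left _ _) hu))
      (hk u (D.envNbhd_anti (le_max_right _ _) hu))

theorem envBasis : RingSubgroupsBasis fun n : ℤ => (D.envNbhd n).toAddSubgroup where
  inter i j := ⟨max i j, le_inf (D.envNbhd_anti (le_max_left _ _))
    (D.envNbhd_anti (le_max_right _ _))⟩
  mul i := ⟨i, by
    rintro _ ⟨x, -, y, hy, rfl⟩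
    exact Ideal.mul_mem_left _ _ hy⟩
  leftMul x i := ⟨i, fun y hy => Ideal.mul_mem_left _ _ hy⟩
  rightMul x i := D.envNbhd_mul_right x i

/-- The topology of `U` in which the `N_L^n U` are a basis of neighbourhoods of `0`. -/
instance : TopologicalSpace D.Env := D.envBasis.topology

instance : IsTopologicalRing D.Env :=
  D.envBasis.toRingFilterBasis.isTopologicalRing

instance : UniformSpace D.Env := IsTopologicalAddGroup.rightUniformSpace D.Env

instance : IsUniformAddGroup D.Env := isUniformAddGroup_of_addCommGroup

instance : UniformContinuousConstSMul ℂ D.Env :=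
  ⟨fun c => uniformContinuous_of_continuousAt_zero (DistribSMul.toAddMonoidHom D.Env c) (by
    have : (fun x : D.Env => c • x) = fun x => algebraMap ℂ D.Env c * x :=
      funext fun x => Algebra.smul_def c x
    change ContinuousAt (fun x : D.Env => c • x) 0
    rw [this]
    exact (continuous_const.mul continuous_id).continuousAt)⟩

/-- The completion `lim U / N_L^n U`. It contains the completions of all the `U_d` for the induced
topologies, as the closures of the `U_d`. -/
abbrev Compl : Type _ := UniformSpace.Completion D.Env

/-- The canonical map to the completion. -/
def toCompl : D.Env →ₐ[ℂ] D.Compl :=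
  { UniformSpace.Completion.coeRingHom with commutes' := fun _ => rfl }

/-- The closure in the completion of (the image of) a subspace of `U`. -/
def closureIn (S : Submodule ℂ D.Env) : Submodule ℂ D.Compl :=
  (S.map D.toCompl.toLinearMap).topologicalClosure

theorem closureIn_mono {S T : Submodule ℂ D.Env} (h : S ≤ T) : D.closureIn S ≤ D.closureIn T :=
  Submodule.topologicalClosure_mono (Submodule.map_mono h)

theorem closureIn_mul {S T W : Submodule ℂ D.Env} (h : S * T ≤ W) {x y : D.Compl}
    (hx : x ∈ D.closureIn S) (hy : y ∈ D.closureIn T) : x * y ∈ D.closureIn W := by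
  refine map_mem_closure₂ continuous_mul hx hy ?_
  rintro _ ⟨a, ha, rfl⟩ _ ⟨b, hb, rfl⟩
  exact ⟨a * b, h (Submodule.mul_mem_mul ha hb), map_mul D.toCompl a b⟩

/-- The completion of `U_d`. -/
def complDeg (d : ℤ) : Submodule ℂ D.Compl := D.closureIn (D.envDeg d)

theorem one_mem_complDeg : (1 : D.Compl) ∈ D.complDeg 0 :=
  Submodule.le_topologicalClosure _ ⟨1, D.one_mem_envDeg, map_one D.toCompl⟩

/-- The graded completion `⨁_d (completion of U_d)` of `U`. -/
def GrCompl : Subalgebra ℂ D.Compl :=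
  (⨆ d, D.complDeg d).toSubalgebra (Submodule.mem_iSup_of_mem 0 D.one_mem_complDeg) (by
    intro x y hx hy
    have h := Submodule.mul_mem_mul hx hy
    rw [Submodule.iSup_mul] at h
    refine (iSup_le fun p => ?_ : _ ≤ ⨆ d, D.complDeg d) h
    rw [Submodule.mul_iSup]
    refine iSup_le fun q => le_trans (Submodule.mul_le.2 fun x hx y hy => ?_)
      (le_iSup D.complDeg (p + q))
    exact D.closureIn_mul (D.envDeg_mul_le p q) hx hy)

/-- The mode `a_[n]` in the completion. -/
def complMode (a : V) (n : ℤ) : D.Compl := D.toCompl (D.envMode a n)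

/-- The part of a subspace of the completion inside the graded completion. -/
def inGrCompl (S : Submodule ℂ D.Compl) : Submodule ℂ D.GrCompl :=
  S.comap D.GrCompl.val.toLinearMap

/-- The two-sided ideal `J` of the graded completion generated by the Jacobi relations
`∑_i (-1)^i (ℓ choose i) (a_[m+ℓ-i] b_[n+i] - (-1)^ℓ b_[n+ℓ-i] a_[m+i])
  = ∑_i (m choose i) (a_(ℓ+i) b)_[m+n-i]`,
whose left-hand side is a convergent series, and by the vacuum relation `vacuum_[-1] = 1`. -/
def jacobiIdeal : TwoSidedIdeal D.GrCompl :=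
  TwoSidedIdeal.span
    ({x | ∃ (a b : V) (l m n : ℤ),
        HasSum (fun i : ℕ => ((-1 : ℂ) ^ i * ((Ring.choose l i : ℤ) : ℂ)) •
            (D.complMode a (m + l - i) * D.complMode b (n + i)
              - (-1 : ℂ) ^ l • (D.complMode b (n + l - i) * D.complMode a (m + i))))
          ((x : D.Compl) + ∑ᶠ i : ℕ,
            ((Ring.choose m i : ℤ) : ℂ) • D.complMode (D.nth (l + i) a b) (m + n - i))} ∪
     {x | (x : D.Compl) = D.complMode D.vacuum (-1) - 1})

/-- The degreewise closure of `J`: its degree `d` part is the closure of the degree `d` part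
of `J`. -/
def jacobiClosure : TwoSidedIdeal D.GrCompl :=
  TwoSidedIdeal.span
    {x | ∃ d : ℤ, x ∈ closure {y : D.GrCompl | y ∈ D.jacobiIdeal ∧ (y : D.Compl) ∈ D.complDeg d}}

/-- The (finite) universal enveloping algebra `𝒰(V)`. -/
def VEnv : Type _ := D.jacobiClosure.ringCon.Quotient

instance : Ring D.VEnv := inferInstanceAs (Ring D.jacobiClosure.ringCon.Quotient)

instance : Algebra ℂ D.VEnv := inferInstanceAs (Algebra ℂ D.jacobiClosure.ringCon.Quotient)

/-- The quotient map from the graded completion to `𝒰(V)`. -/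
def toVEnv : D.GrCompl →ₐ[ℂ] D.VEnv :=
  { D.jacobiClosure.ringCon.mk' with commutes' := fun _ => rfl }

/-- The image in `𝒰(V)` of the completion of a subspace of `U`. -/
def vImage (S : Submodule ℂ D.Env) : Submodule ℂ D.VEnv :=
  (D.inGrCompl (D.closureIn S)).map D.toVEnv.toLinearMap

theorem vImage_mono {S T : Submodule ℂ D.Env} (h : S ≤ T) : D.vImage S ≤ D.vImage T :=
  Submodule.map_mono (Submodule.comap_mono (D.closureIn_mono h))

theorem vImage_mul {S T W : Submodule ℂ D.Env} (h : S * T ≤ W) {x y : D.VEnv}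
    (hx : x ∈ D.vImage S) (hy : y ∈ D.vImage T) : x * y ∈ D.vImage W := by
  obtain ⟨a, ha, rfl⟩ := hx
  obtain ⟨b, hb, rfl⟩ := hy
  exact ⟨a * b, D.closureIn_mul h ha hb, map_mul D.toVEnv a b⟩

/-- The grading of `𝒰(V)` and its neighbourhoods of zero, induced from those of `U`. -/
def grading : GradedSeminorm D.VEnv where
  deg p := D.vImage (D.envDeg p)
  NL n p := D.vImage (D.envNL n p)
  NR n p := D.vImage (D.envNR n p)
  one_mem := ⟨1, D.one_mem_complDeg, map_one D.toVEnv⟩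
  mul_mem := D.vImage_mul (D.envDeg_mul_le _ _)
  NL_le n p := D.vImage_mono (D.envNL_le n p)
  NR_eq n p := by rw [D.envNR_eq]
  mul_NL := D.vImage_mul (D.envDeg_mul_envNL_le _ _ _)
  NL_mul := D.vImage_mul (D.envNL_mul_envDeg_le _ _ _)

theorem complMode_mem {p : ℤ} {a : V} (ha : a ∈ D.grade p) (n : ℤ) :
    D.complMode a n ∈ D.complDeg (p - n - 1) := by
  refine Submodule.le_topologicalClosure _ ⟨D.envMode a n, Submodule.subset_span ?_, rfl⟩
  have := IsMonomial.cons ha n (IsMonomial.one (D := D))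
  rwa [mul_one, add_zero] at this

theorem complMode_mem_grCompl (a : V) (n : ℤ) : D.complMode a n ∈ D.GrCompl := by
  have h : D.envMode a n ∈ ⨆ d, D.envDeg d := by rw [D.iSup_envDeg]; trivial
  have hle : ⨆ d, D.envDeg d ≤ (⨆ d, D.complDeg d).comap D.toCompl.toLinearMap :=
    iSup_le fun d x hx => Submodule.mem_iSup_of_mem d
      (Submodule.le_topologicalClosure _ ⟨x, hx, rfl⟩)
  exact hle h

/-- The mode `a_[n]` in `𝒰(V)`. -/
def mode (a : V) (n : ℤ) : D.VEnv := D.toVEnv ⟨D.complMode a n, D.complMode_mem_grCompl a n⟩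

theorem mode_mem {p : ℤ} {a : V} (ha : a ∈ D.grade p) (n : ℤ) :
    D.mode a n ∈ D.grading.deg (p - n - 1) := ⟨_, D.complMode_mem ha n, rfl⟩

end GradedVertexData

/-! ## The rank-one Heisenberg vertex algebra -/

namespace Heisenberg

open MvPolynomial

/-- The Fock space `π = ℂ[b_{-1}, b_{-2}, …]`; the variable `X i` stands for `b_{-(i+1)}`, and the
constant `1` for the vacuum. -/
abbrev Fock : Type := MvPolynomial ℕ ℂ

/-- `X i = b_{-(i+1)}` has weight `i + 1`. -/
def wt (i : ℕ) : ℤ := i + 1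

/-- The Heisenberg operators `b_n` on the Fock space: multiplication by the variable `b_n` for
`n < 0`, zero for `n = 0` and `n ∂/∂b_{-n}` for `n > 0`, so that `[b_m, b_n] = m δ_{m,-n}`. -/
def osc : ℤ → Module.End ℂ Fock
  | Int.negSucc i => LinearMap.mulLeft ℂ (X i)
  | Int.ofNat 0 => 0
  | Int.ofNat (i + 1) => ((i : ℂ) + 1) • (pderiv i).toLinearMap

/-- The modes `a_(m)` of the field
`Y(a, z) = (1 / (j₁! ⋯ jₖ!)) :∂^{j₁} b(z) ⋯ ∂^{jₖ} b(z):`, `b(z) = ∑ b_n z^(-n-1)`, of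
`a = b_{-j₁-1} ⋯ b_{-jₖ-1} |0⟩`, where `Y(a, z) = ∑ a_(m) z^(-m-1)`. The normally ordered product is
taken from the right, through
`(b_{-j-1} a)_(m) = ∑_{i ≥ 0} (j+i choose i) (b_{-j-1-i} a_(m+i) + (-1)^j a_(m-j-1-i) b_i)`.
On a monomial of weight `w` all terms with `i > w + wt a + |m|` are zero for degree reasons. -/
def fieldMode : List ℕ → ℤ → Module.End ℂ Fock
  | [], m => if m = -1 then LinearMap.id else 0
  | j :: l, m => (basisMonomials ℕ ℂ).constr ℂ fun s =>
      ∑ i ∈ Finset.range (Finsupp.weight (· + 1) s + (l.map (· + 1)).sum + m.natAbs + 1),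
        ((j + i).choose i : ℂ) •
          (osc (-j - 1 - i) (fieldMode l (m + i) (monomial s 1))
            + (-1 : ℂ) ^ j • fieldMode l (m - j - 1 - i) (osc i (monomial s 1)))

/-- The products `a_(n) c` of the Heisenberg vertex algebra, linear in `a`. -/
def nth (n : ℤ) : Fock →ₗ[ℂ] Fock →ₗ[ℂ] Fock :=
  (basisMonomials ℕ ℂ).constr ℂ fun s => fieldMode ((Finsupp.toMultiset s).sort) n

/-- The translation operator: the derivation with `b_{-k} ↦ k b_{-k-1}`. -/
def transl : Fock →ₗ[ℂ] Fock := (mkDerivation ℂ fun i : ℕ => ((i : ℂ) + 1) • X (i + 1)).toLinearMap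

/-- The grading of the Fock space by weight. -/
def grade (p : ℤ) : Submodule ℂ Fock := weightedHomogeneousSubmodule ℂ wt p

theorem monomial_mem_grade (s : ℕ →₀ ℕ) : (monomial s 1 : Fock) ∈ grade (Finsupp.weight wt s) :=
  isWeightedHomogeneous_monomial _ _ _ rfl

theorem map_mem_of_monomial {f : Fock →ₗ[ℂ] Fock} {p : ℤ} {W : Submodule ℂ Fock}
    (h : ∀ s : ℕ →₀ ℕ, Finsupp.weight wt s = p → f (monomial s 1) ∈ W) {v : Fock}
    (hv : v ∈ grade p) : f v ∈ W := by
  rw [v.as_sum, map_sum]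
  refine Submodule.sum_mem _ fun s hs => ?_
  have : (monomial s (coeff s v) : Fock) = coeff s v • monomial s 1 := by
    rw [smul_monomial, smul_eq_mul, mul_one]
  rw [this, map_smul]
  exact Submodule.smul_mem _ _ (h s (hv (mem_support_iff.1 hs)))

theorem osc_mem (n : ℤ) {p : ℤ} {v : Fock} (hv : v ∈ grade p) : osc n v ∈ grade (p - n) := by
  match n with
  | Int.negSucc i =>
    have h : (X i * v : Fock) ∈ grade (wt i + p) :=
      IsWeightedHomogeneous.mul (isWeightedHomogeneous_X ℂ wt i) hv
    have e : p - Int.negSucc i = wt i + p := by rw [wt, Int.negSucc_eq]; ring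
    rw [e]; exact h
  | Int.ofNat 0 => exact Submodule.zero_mem _
  | Int.ofNat (i + 1) =>
    refine map_mem_of_monomial (fun s hs => ?_) hv
    change ((i : ℂ) + 1) • pderiv i (monomial s 1) ∈ _
    refine Submodule.smul_mem _ _ ?_
    rw [pderiv_monomial]
    by_cases h0 : s i = 0
    · simp [h0]
    · refine isWeightedHomogeneous_monomial _ _ _ ?_
      have hle : Finsupp.single i 1 ≤ s := Finsupp.single_le_iff.2 (Nat.one_le_iff_ne_zero.2 h0)
      have := congrArg (Finsupp.weight wt) (tsub_add_cancel_of_le hle)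
      rw [map_add, hs, Finsupp.weight_single, one_smul] at this
      rw [eq_sub_iff_add_eq, ← this]
      simp [wt]

theorem fieldMode_mem (l : List ℕ) : ∀ (m : ℤ) {p : ℤ} {v : Fock}, v ∈ grade p →
    fieldMode l m v ∈ grade ((l.map wt).sum + p - m - 1) := by
  induction l with
  | nil =>
    intro m p v hv
    by_cases hm : m = -1
    · simpa [fieldMode, hm] using hv
    · simp [fieldMode, hm]
  | cons j l ih =>
    intro m p v hv
    refine map_mem_of_monomial (fun s hs => ?_) hv
    have e : (monomial s (1 : ℂ)) = basisMonomials ℕ ℂ s := by simp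
    rw [fieldMode, e, Module.Basis.constr_basis]
    refine Submodule.sum_mem _ fun i _ => Submodule.smul_mem _ _ (Submodule.add_mem _ ?_ ?_)
    · have := osc_mem (-j - 1 - i) (ih (m + i) (monomial_mem_grade s))
      rw [hs] at this
      convert this using 2
      simp [wt]; ring
    · refine Submodule.smul_mem _ _ ?_
      have := ih (m - j - 1 - i) (osc_mem i (monomial_mem_grade s))
      rw [hs] at this
      convert this using 2
      simp [wt]; ring

theorem weight_eq_sum (s : ℕ →₀ ℕ) :
    Finsupp.weight wt s = ((Finsupp.toMultiset s).map wt).sum := by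
  induction s using Finsupp.induction_linear with
  | zero => simp
  | add f g hf hg => rw [map_add, map_add, Multiset.map_add, Multiset.sum_add, hf, hg]
  | single i k =>
    rw [Finsupp.weight_single, Finsupp.toMultiset_single, Multiset.map_nsmul, Multiset.sum_nsmul,
      Multiset.map_singleton, Multiset.sum_singleton]

theorem nth_mem {p q : ℤ} (n : ℤ) {a c : Fock} (ha : a ∈ grade p) (hc : c ∈ grade q) :
    nth n a c ∈ grade (p + q - n - 1) := by
  have key : (nth n).flip c a ∈ grade (p + q - n - 1) := by
    refine map_mem_of_monomial (fun s hs => ?_) ha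
    have e : (monomial s (1 : ℂ)) = basisMonomials ℕ ℂ s := by simp
    rw [LinearMap.flip_apply, nth, e, Module.Basis.constr_basis]
    convert fieldMode_mem ((Finsupp.toMultiset s).sort) n hc using 4
    rw [← hs, ← Multiset.sum_coe, ← Multiset.map_coe, Multiset.sort_eq, weight_eq_sum]
  exact key

theorem transl_mem {p : ℤ} {a : Fock} (ha : a ∈ grade p) : transl a ∈ grade (p + 1) := by
  refine map_mem_of_monomial (fun s hs => ?_) ha
  change mkDerivation ℂ (fun i : ℕ => ((i : ℂ) + 1) • (X (i + 1) : Fock)) (monomial s 1) ∈ _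
  rw [mkDerivation_monomial]
  refine Submodule.smul_mem _ _ (Submodule.sum_mem _ fun i hi => ?_)
  have h0 : s i ≠ 0 := Finsupp.mem_support_iff.1 hi
  have hle : Finsupp.single i 1 ≤ s := Finsupp.single_le_iff.2 (Nat.one_le_iff_ne_zero.2 h0)
  have h1 := congrArg (Finsupp.weight wt) (tsub_add_cancel_of_le hle)
  rw [map_add, hs, Finsupp.weight_single, one_smul] at h1
  beta_reduce
  rw [smul_eq_mul, mul_smul_comm]
  refine Submodule.smul_mem _ _ ?_
  have h2 : (monomial (s - Finsupp.single i 1) (s i : ℂ) * X (i + 1) : Fock) ∈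
      grade (Finsupp.weight wt (s - Finsupp.single i 1) + wt (i + 1)) :=
    IsWeightedHomogeneous.mul (isWeightedHomogeneous_monomial _ _ _ rfl)
      (isWeightedHomogeneous_X ℂ wt (i + 1))
  convert h2 using 2
  rw [← h1]
  simp [wt]; ring

theorem grade_neg (p : ℤ) (hp : p < 0) : grade p = ⊥ := by
  rw [eq_bot_iff]
  intro v hv
  rw [Submodule.mem_bot]
  ext s
  rw [coeff_zero]
  by_contra h
  have h1 : Finsupp.weight wt s = p := hv h
  have h2 : 0 ≤ Finsupp.weight wt s := by
    rw [Finsupp.weight_apply]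
    exact Finset.sum_nonneg fun i _ => by simp only [wt, nsmul_eq_mul]; positivity
  omega

/-- The rank-one Heisenberg vertex algebra `π`. -/
def vertexData : GradedVertexData Fock where
  grade := grade
  isInternal :=
    letI := weightedGradedAlgebra ℂ wt
    DirectSum.Decomposition.isInternal (weightedHomogeneousSubmodule ℂ wt)
  grade_neg := grade_neg
  vacuum := 1
  vacuum_mem := isWeightedHomogeneous_one ℂ wt
  T := transl
  T_mem := transl_mem
  nth := nth
  nth_mem := nth_mem

/-- The generating state `b = b_{-1} |0⟩`. -/
def b : Fock := X 0

/-- `H t^n = (b_{-1})_[n]` in `𝒰(π)`. -/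
def H (n : ℤ) : vertexData.VEnv := vertexData.mode b n

theorem H_mem (n : ℤ) : H n ∈ vertexData.grading.deg (-n) := by
  have hb : b ∈ vertexData.grade (wt 0) := isWeightedHomogeneous_X ℂ wt 0
  have h := vertexData.mode_mem hb n
  rwa [show wt 0 - n - 1 = -n by simp [wt]] at h

theorem list_prod_mem (l : List ℤ) : (l.map H).prod ∈ vertexData.grading.deg (-l.sum) := by
  induction l with
  | nil => simpa using vertexData.grading.one_mem
  | cons n l ih =>
    rw [List.map_cons, List.prod_cons, List.sum_cons, neg_add]
    exact vertexData.grading.mul_mem (H_mem n) ih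

/-- `H t^{-r₁} ⋯ H t^{-rₙ}` for the partition `r₁ ≥ ⋯ ≥ rₙ`. -/
def creation {d : ℕ} (r : Nat.Partition d) : vertexData.VEnv :=
  (((r.parts.sort (· ≥ ·)).map fun k : ℕ => -(k : ℤ)).map H).prod

/-- `H t^{sₘ} ⋯ H t^{s₁}` for the partition `s₁ ≥ ⋯ ≥ sₘ`. -/
def annihilation {d : ℕ} (s : Nat.Partition d) : vertexData.VEnv :=
  (((s.parts.sort (· ≤ ·)).map fun k : ℕ => (k : ℤ)).map H).prod

theorem creation_mem {d : ℕ} (r : Nat.Partition d) :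
    creation r ∈ vertexData.grading.deg (d : ℤ) := by
  have h := list_prod_mem ((r.parts.sort (· ≥ ·)).map fun k : ℕ => -(k : ℤ))
  have e : -((r.parts.sort (· ≥ ·)).map fun k : ℕ => -(k : ℤ)).sum = (d : ℤ) := by
    rw [← Multiset.sum_coe, ← Multiset.map_coe, Multiset.sort_eq, Multiset.sum_map_neg, neg_neg]
    have := congrArg (Nat.cast (R := ℤ)) r.parts_sum
    rwa [Nat.cast_multiset_sum] at this
  rwa [e] at h

theorem annihilation_mem {d : ℕ} (s : Nat.Partition d) :
    annihilation s ∈ vertexData.grading.deg (-(d : ℤ)) := by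
  have h := list_prod_mem ((s.parts.sort (· ≤ ·)).map fun k : ℕ => (k : ℤ))
  have e : ((s.parts.sort (· ≤ ·)).map fun k : ℕ => (k : ℤ)).sum = (d : ℤ) := by
    rw [← Multiset.sum_coe, ← Multiset.map_coe, Multiset.sort_eq]
    have := congrArg (Nat.cast (R := ℤ)) s.parts_sum
    rwa [Nat.cast_multiset_sum] at this
  rwa [e] at h

theorem H_zero_pow_mem (k : ℕ) : H 0 ^ k ∈ vertexData.grading.deg 0 := by
  induction k with
  | zero => simpa using vertexData.grading.one_mem
  | succ k ih =>
    rw [pow_succ]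
    simpa using vertexData.grading.mul_mem ih (H_mem 0)

/-- The `d`-th mode transition algebra `𝔄_d(π)`. -/
abbrev ModeTransitionAlgebra (d : ℕ) : Type := vertexData.grading.ModeTransition (d : ℤ)

/-- `H t^{-r₁} ⋯ H t^{-rₙ} ⊗ H^k ⊗ H t^{sₘ} ⋯ H t^{s₁}` in `𝔄_d(π)`, where `H = H t^0`. -/
def generator {d : ℕ} (r s : Nat.Partition d) (k : ℕ) : ModeTransitionAlgebra d :=
  vertexData.grading.tmul (creation r) (H 0 ^ k) (annihilation s)
    (creation_mem r) (H_zero_pow_mem k) (annihilation_mem s)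

/-- `‖r‖ = ∏ rᵢ · ∏ mⱼ!`, where the `mⱼ` are the multiplicities of the distinct parts of `r`. -/
def normPartition {d : ℕ} (r : Nat.Partition d) : ℕ :=
  r.parts.prod * ∏ i ∈ r.parts.toFinset, (r.parts.count i).factorial

end Heisenberg

end

/-! The algebra `𝔄_d(π)` is shown to have the generators `u_r ⊗ H_0^k ⊗ v_s` as a basis, and the
product is then read off from the Fock spaces of all highest weights `x ∈ ℂ`.

Spanning (`span_generator`). In the enveloping algebra `𝒰(π)` every element of degree `d` is, modulo
any `N_L^n`, a polynomial in the Heisenberg modes `H_n` (`deg_le_sup`). Three facts give this. An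
element of the completion of `U_d` is approximated by elements of `U_d` itself, because the pieces
`U_d` are independent (`closureIn_envDeg_le`, `iSupIndep_envDeg`). The Jacobi relation with `ℓ =
-j-1`, `m = 0` writes a mode of `b_{-j-1} a` as a convergent series in the modes of `b` and `a`
(`mode_X_mul`), so induction on the number of oscillators applies. Finally the commutation rule
`H_mul_H` brings polynomials into normal order (`modeSpan_le_normalSpan`). Modulo `N_L^1` the
monomials with an annihilation operator vanish, modulo `N_R^1` in degree `-d` those with a creation
operator, and powers of `H_0` pass through the tensor signs.

Independence and multiplicativity. For each `x` the Fock space, with `b_0` acting as `x`, is a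
module over `𝒰(π)` (`vRep`). This is the longest part of the argument: the Jacobi identity must hold
for the fields of all states on every smooth Heisenberg module (`jacobi`). Fields are built by
iterated normally ordered products with `∂^j b / j!`. The products `(z-w)^l A(z)C(w)` and `(w-z)^l
C(w)A(z)`, and the expansion in `z-w`, satisfy matching recursions when `A` is replaced by such a
normally ordered product (`opProd_normalOrd`, `opProdRev_normalOrd`, `opIter_normalOrd`). Induction
on the first state therefore reduces everything to the vacuum, where the identity is one about
binomial coefficients (`opProd_idField`). The action is continuous for the discrete topology on the
Fock space, so it extends to the completion and kills the closed Jacobi ideal.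

The weight zero space is the line of the vacuum and `𝒰_0` acts on it by a character. Hence `u ⊗ a ⊗
y` acts on vectors of weight `d` as a rank-one operator: `y` sends the vector to the vacuum line,
`a` scales, `u` creates (`transitionRep`). This action respects `⋆` (`transitionRep_mul`). In the
monomial basis a generator becomes `x^k ‖s‖` times a matrix unit, and normalizing the monomials
turns the factor into `√‖r‖ √‖s‖ x^k` (`transitionMatrix_generator`). The entries are polynomial in
`x`, and a complex polynomial is determined by its values. This yields linear independence
(`eq_zero_of_transitionMatrix`) and the multiplicativity of the map to matrices over `ℂ[x]`
(`matrixMap_mul`). -/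

noncomputable section

set_option linter.unusedSectionVars false

/-! ## Eventually vanishing sequences and their sums -/

section EventuallyZero

variable {M N : Type*} [AddCommGroup M] [Module ℂ M] [AddCommGroup N] [Module ℂ N]

/-- A sequence which vanishes from some index on. -/
def EventuallyZero (f : ℕ → M) : Prop := ∃ n, ∀ i, n ≤ i → f i = 0

/-- A double sequence supported in a square. -/
def EventuallyZero₂ (f : ℕ → ℕ → M) : Prop := ∃ n, ∀ i r, n ≤ i ∨ n ≤ r → f i r = 0

theorem finsum_eq_sum_range {f : ℕ → M} {n : ℕ} (h : ∀ i, n ≤ i → f i = 0) :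
    ∑ᶠ i, f i = ∑ i ∈ Finset.range n, f i :=
  finsum_eq_sum_of_support_subset f fun i hi => by
    by_contra hn
    exact hi (h i (by simpa using hn))

namespace EventuallyZero

theorem finite_support {f : ℕ → M} (h : EventuallyZero f) : (Function.support f).Finite := by
  obtain ⟨n, hn⟩ := h
  refine (Set.finite_Iio n).subset fun i hi => ?_
  by_contra hc
  exact hi (hn i (by simpa using hc))

theorem mono {f : ℕ → M} {g : ℕ → N} (h : EventuallyZero f) (hg : ∀ i, f i = 0 → g i = 0) :
    EventuallyZero g := by
  obtain ⟨n, hn⟩ := h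
  exact ⟨n, fun i hi => hg i (hn i hi)⟩

theorem add {f g : ℕ → M} (hf : EventuallyZero f) (hg : EventuallyZero g) :
    EventuallyZero fun i => f i + g i := by
  obtain ⟨n, hn⟩ := hf
  obtain ⟨m, hm⟩ := hg
  exact ⟨max n m, fun i hi => by
    beta_reduce
    rw [hn i (le_trans (le_max_left _ _) hi), hm i (le_trans (le_max_right _ _) hi), add_zero]⟩

theorem smul {f : ℕ → M} (hf : EventuallyZero f) (c : ℕ → ℂ) :
    EventuallyZero fun i => c i • f i := hf.mono fun i h => by rw [h, smul_zero]

theorem map {f : ℕ → M} (hf : EventuallyZero f) (g : M →ₗ[ℂ] N) :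
    EventuallyZero fun i => g (f i) := hf.mono fun i h => by rw [h, map_zero]

theorem finsum_add {f g : ℕ → M} (hf : EventuallyZero f) (hg : EventuallyZero g) :
    ∑ᶠ i, (f i + g i) = ∑ᶠ i, f i + ∑ᶠ i, g i :=
  finsum_add_distrib hf.finite_support hg.finite_support

theorem finsum_sub {f g : ℕ → M} (hf : EventuallyZero f) (hg : EventuallyZero g) :
    ∑ᶠ i, (f i - g i) = ∑ᶠ i, f i - ∑ᶠ i, g i :=
  finsum_sub_distrib hf.finite_support hg.finite_support

theorem map_finsum {f : ℕ → M} (hf : EventuallyZero f) (g : M →ₗ[ℂ] N) :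
    g (∑ᶠ i, f i) = ∑ᶠ i, g (f i) := g.toAddMonoidHom.map_finsum hf.finite_support

theorem smul_finsum {f : ℕ → M} (hf : EventuallyZero f) (c : ℂ) :
    c • ∑ᶠ i, f i = ∑ᶠ i, c • f i := hf.map_finsum (LinearMap.lsmul ℂ M c)

end EventuallyZero

theorem finsum_eventuallyZero {f : ℕ → ℕ → M} (hf : EventuallyZero₂ f) :
    EventuallyZero fun i => ∑ᶠ r, f i r := by
  obtain ⟨n, hn⟩ := hf
  exact ⟨n, fun i hi => by simp [hn i _ (Or.inl hi)]⟩

namespace EventuallyZero₂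

/-- Only finitely many rows are nonzero, so the bounds for the single rows have a common maximum.
Together with `swap` this is the usual way to justify an interchange of sums below. -/
theorem of_rows {f : ℕ → ℕ → M} (h : ∃ n, ∀ i, n ≤ i → ∀ r, f i r = 0)
    (h' : ∀ i, EventuallyZero (f i)) : EventuallyZero₂ f := by
  obtain ⟨n, hn⟩ := h
  choose m hm using h'
  refine ⟨max n ((Finset.range n).sup m), fun i r hir => ?_⟩
  by_cases hi : n ≤ i
  · exact hn i hi r
  · rcases hir with h | h
    · exact absurd (le_trans (le_max_left _ _) h) hi
    · refine hm i r (le_trans ?_ (le_trans (le_max_right _ _) h))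
      exact Finset.le_sup (f := m) (Finset.mem_range.2 (not_le.1 hi))

theorem swap {f : ℕ → ℕ → M} (hf : EventuallyZero₂ f) : EventuallyZero₂ fun i r => f r i := by
  obtain ⟨n, hn⟩ := hf
  exact ⟨n, fun i r h => hn r i h.symm⟩

theorem mono {f : ℕ → ℕ → M} {g : ℕ → ℕ → N} (h : EventuallyZero₂ f)
    (hg : ∀ i r, f i r = 0 → g i r = 0) : EventuallyZero₂ g := by
  obtain ⟨n, hn⟩ := h
  exact ⟨n, fun i r hi => hg i r (hn i r hi)⟩

theorem smul {f : ℕ → ℕ → M} (hf : EventuallyZero₂ f) (c : ℕ → ℕ → ℂ) :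
    EventuallyZero₂ fun i r => c i r • f i r := hf.mono fun i r h => by rw [h, smul_zero]

theorem row {f : ℕ → ℕ → M} (hf : EventuallyZero₂ f) (i : ℕ) : EventuallyZero (f i) := by
  obtain ⟨n, hn⟩ := hf
  exact ⟨n, fun r h => hn i r (Or.inr h)⟩

theorem shift_left {f : ℕ → ℕ → M} (hf : EventuallyZero₂ f) (p : ℕ) :
    EventuallyZero₂ fun i r => f (p + i) r := by
  obtain ⟨n, hn⟩ := hf
  exact ⟨n, fun i r h => hn _ r (h.imp (fun h => by omega) id)⟩

theorem finsum_comm {f : ℕ → ℕ → M} (hf : EventuallyZero₂ f) :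
    ∑ᶠ i, ∑ᶠ r, f i r = ∑ᶠ r, ∑ᶠ i, f i r := by
  obtain ⟨n, hn⟩ := hf
  have h1 : ∀ i, ∑ᶠ r, f i r = ∑ r ∈ Finset.range n, f i r := fun i =>
    finsum_eq_sum_range fun r hr => hn i r (Or.inr hr)
  have h2 : ∀ r, ∑ᶠ i, f i r = ∑ i ∈ Finset.range n, f i r := fun r =>
    finsum_eq_sum_range fun i hi => hn i r (Or.inl hi)
  simp only [h1, h2]
  rw [finsum_eq_sum_range (n := n), finsum_eq_sum_range (n := n), Finset.sum_comm]
  · exact fun r hr => Finset.sum_eq_zero fun i _ => hn i r (Or.inr hr)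
  · exact fun i hi => Finset.sum_eq_zero fun r _ => hn i r (Or.inl hi)

/-- Summation along antidiagonals. -/
theorem finsum_antidiagonal {f : ℕ → ℕ → M} (hf : EventuallyZero₂ f) :
    ∑ᶠ i, ∑ᶠ r, f i r = ∑ᶠ q, ∑ x ∈ Finset.HasAntidiagonal.antidiagonal q, f x.1 x.2 := by
  obtain ⟨n, hn⟩ := hf
  have h1 : ∀ i, ∑ᶠ r, f i r = ∑ r ∈ Finset.range n, f i r := fun i =>
    finsum_eq_sum_range fun r hr => hn i r (Or.inr hr)
  simp only [h1]
  rw [finsum_eq_sum_range (n := n)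
      (fun i hi => Finset.sum_eq_zero fun r _ => hn i r (Or.inl hi)),
    finsum_eq_sum_range (n := 2 * n), ← Finset.sum_product', Finset.sum_sigma']
  · refine Finset.sum_bij_ne_zero (fun x _ _ => ⟨x.1 + x.2, x⟩) ?_ ?_ ?_ ?_
    · rintro ⟨i, r⟩ h _
      simp at h ⊢; omega
    · rintro ⟨i, r⟩ _ _ ⟨i', r'⟩ _ _ h
      simp at h ⊢; omega
    · rintro ⟨q, i, r⟩ h h0
      have hir : i < n ∧ r < n := by
        by_contra hc
        exact h0 (hn i r (by omega))
      simp at h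
      refine ⟨(i, r), by simpa using hir, h0, ?_⟩
      simp [h.2]
    · intros; rfl
  -- In a pair with sum at least `2n` one entry is at least `n`.
  · intro q hq
    refine Finset.sum_eq_zero fun x hx => hn _ _ ?_
    have := Finset.HasAntidiagonal.mem_antidiagonal.1 hx
    omega

end EventuallyZero₂

end EventuallyZero

/-! ## Binomial identities -/

/-- The complex number `(l choose i)`. -/
def zchoose (l : ℤ) (i : ℕ) : ℂ := ((Ring.choose l i : ℤ) : ℂ)

theorem zchoose_natCast (n i : ℕ) : zchoose n i = (n.choose i : ℂ) := by
  simp [zchoose, Ring.choose_natCast]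

/-- Upper negation. The exponent is passed as an equation because it appears in many syntactic
forms. -/
theorem zchoose_neg (j : ℕ) (l : ℤ) (hl : l = -j - 1) (i : ℕ) :
    zchoose l i = (-1) ^ i * ((j + i).choose i : ℂ) := by
  subst hl
  have h := Ring.choose_neg (R := ℤ) (j + 1) i
  rw [show -((j : ℤ) + 1) = -j - 1 by ring, show (j : ℤ) + 1 + i - 1 = ((j + i : ℕ) : ℤ) by
    push_cast; ring, Ring.choose_natCast] at h
  rw [zchoose, h, Units.smul_def, Int.negOnePow_def]
  simp

/-- Vandermonde's identity. -/
theorem sum_zchoose (l p : ℤ) (q : ℕ) :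
    ∑ x ∈ Finset.HasAntidiagonal.antidiagonal q, zchoose l x.1 * zchoose p x.2 = zchoose (l + p) q := by
  simp only [zchoose]
  rw [Ring.add_choose_eq q (Commute.all l p)]
  push_cast; rfl


/-! ## Smooth modules over the Heisenberg algebra and their fields -/

/-- Operators `β n` with `[β m, β n] = m δ_{m,-n}` such that every vector is killed by `β n` for
large `n`. -/
structure IsSmoothHeisenberg {W : Type*} [AddCommGroup W] [Module ℂ W]
    (β : ℤ → Module.End ℂ W) : Prop where
  comm : ∀ (m n : ℤ) (w : W),
    β m (β n w) = β n (β m w) + if m + n = 0 then (m : ℂ) • w else 0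
  smooth : ∀ w, EventuallyZero fun i : ℕ => β i w

section Fields

variable {W : Type*} [AddCommGroup W] [Module ℂ W]

variable (W) in
/-- The space of fields `∑ A_m z^(-m-1)` on `W`. -/
def FieldSpace : Submodule ℂ (ℤ → Module.End ℂ W) where
  carrier := {A | ∀ w, ∃ n : ℤ, ∀ m, n ≤ m → A m w = 0}
  add_mem' := by
    intro A B hA hB w
    obtain ⟨n, hn⟩ := hA w
    obtain ⟨m, hm⟩ := hB w
    refine ⟨max n m, fun k hk => ?_⟩
    rw [Pi.add_apply, LinearMap.add_apply, hn k (le_trans (le_max_left _ _) hk),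
      hm k (le_trans (le_max_right _ _) hk), add_zero]
  zero_mem' := fun w => ⟨0, fun m _ => rfl⟩
  smul_mem' := by
    intro c A hA w
    obtain ⟨n, hn⟩ := hA w
    refine ⟨n, fun k hk => ?_⟩
    rw [Pi.smul_apply, LinearMap.smul_apply, hn k hk, smul_zero]

theorem eventuallyZero_field (A : FieldSpace W) (m : ℤ) (w : W) :
    EventuallyZero fun i : ℕ => A.1 (m + i) w := by
  obtain ⟨n, hn⟩ := A.2 w
  exact ⟨(n - m).toNat, fun i hi => hn _ (by omega)⟩

/-- The sum of a pointwise finite family of linear maps. -/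
def linearFinsum (f : ℕ → Module.End ℂ W) (h : ∀ w, EventuallyZero fun i => f i w) :
    Module.End ℂ W where
  toFun w := ∑ᶠ i, f i w
  map_add' v w := by simp only [map_add, (h v).finsum_add (h w)]
  map_smul' c w := by simp only [map_smul, RingHom.id_apply, (h w).smul_finsum]

variable {β : ℤ → Module.End ℂ W}

theorem eventuallyZero_creation (A : FieldSpace W) (j : ℕ) (m : ℤ) (w : W) :
    EventuallyZero fun i : ℕ => ((j + i).choose i : ℂ) • β (-j - 1 - i) (A.1 (m + i) w) :=
  (eventuallyZero_field A m w).mono fun i h => by rw [h, map_zero, smul_zero]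

variable (β) in
/-- The part of the normally ordered product `:∂^j b(z) A(z): / j!` with the creation
operators of `b(z) = ∑ β_n z^(-n-1)`. -/
def creationPart (j : ℕ) : Module.End ℂ (FieldSpace W) where
  toFun A := ⟨fun m => linearFinsum
      (fun i => ((j + i).choose i : ℂ) • (β (-j - 1 - i) ∘ₗ A.1 (m + i)))
      (eventuallyZero_creation A j m), fun w => by
    obtain ⟨n, hn⟩ := A.2 w
    refine ⟨n, fun m hm => ?_⟩
    refine (finsum_congr fun i => ?_).trans finsum_zero
    simp [hn (m + i) (by omega)]⟩
  map_add' A B := by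
    ext m w
    simp only [linearFinsum, LinearMap.coe_mk, AddHom.coe_mk, LinearMap.smul_apply,
      LinearMap.comp_apply, Submodule.coe_add, Pi.add_apply, LinearMap.add_apply, map_add, smul_add]
    exact (eventuallyZero_creation A j m w).finsum_add (eventuallyZero_creation B j m w)
  map_smul' c A := by
    ext m w
    simp only [linearFinsum, LinearMap.coe_mk, AddHom.coe_mk, LinearMap.smul_apply,
      LinearMap.comp_apply, Submodule.coe_smul, Pi.smul_apply, RingHom.id_apply, map_smul]
    rw [(eventuallyZero_creation A j m w).smul_finsum]
    exact finsum_congr fun i => smul_comm _ _ _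

theorem creationPart_apply (j : ℕ) (A : FieldSpace W) (m : ℤ) (w : W) :
    (creationPart β j A).1 m w =
      ∑ᶠ i : ℕ, ((j + i).choose i : ℂ) • β (-j - 1 - i) (A.1 (m + i) w) := rfl

theorem IsSmoothHeisenberg.exists_bound (hβ : IsSmoothHeisenberg β) (w : W) :
    ∃ n : ℕ, ∀ i : ℕ, n ≤ i → β i w = 0 := hβ.smooth w

theorem eventuallyZero_annihilation (hβ : IsSmoothHeisenberg β) (A : ℤ → Module.End ℂ W) (j : ℕ)
    (m : ℤ) (w : W) :
    EventuallyZero fun i : ℕ => ((j + i).choose i : ℂ) • A (m - j - 1 - i) (β i w) :=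
  (hβ.smooth w).mono fun i h => by rw [h, map_zero, smul_zero]

/-- The part of the normally ordered product `:∂^j b(z) A(z): / j!` with the annihilation
operators of `b(z) = ∑ β_n z^(-n-1)`. -/
def annihilationPart (hβ : IsSmoothHeisenberg β) (j : ℕ) : Module.End ℂ (FieldSpace W) where
  toFun A := ⟨fun m => (-1 : ℂ) ^ j • linearFinsum
      (fun i => ((j + i).choose i : ℂ) • (A.1 (m - j - 1 - i) ∘ₗ β i))
      (eventuallyZero_annihilation hβ A.1 j m), fun w => by
    obtain ⟨N, hN⟩   := hβ.exists_bound w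
    choose n hn using fun i : ℕ => A.2 (β i w)
    obtain ⟨K, hK⟩ := ((Finset.range N).image n).bddAbove
    -- Only `i < N` contribute, and for these `m - j - 1 - i` exceeds `K`, which bounds the
    -- vanishing thresholds of `A` on all the vectors `β i w` with `i < N`.
    refine ⟨K + j + 1 + N, fun m hm => ?_⟩
    rw [LinearMap.smul_apply]
    convert smul_zero _
    refine (finsum_congr fun i => ?_).trans finsum_zero
    rw [LinearMap.smul_apply, LinearMap.comp_apply]
    convert smul_zero _
    by_cases hi : N ≤ i
    · rw [hN i hi, map_zero]
    · refine hn i _ ?_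
      have : n i ≤ K := hK (by
        rw [Finset.mem_coe]
        exact Finset.mem_image_of_mem n (Finset.mem_range.2 (not_le.1 hi)))
      omega⟩
  map_add' A B := by
    ext m w
    simp only [linearFinsum, LinearMap.coe_mk, AddHom.coe_mk, LinearMap.smul_apply,
      LinearMap.comp_apply, Submodule.coe_add, Pi.add_apply, LinearMap.add_apply, smul_add]
    rw [(eventuallyZero_annihilation hβ A.1 j m w).finsum_add
      (eventuallyZero_annihilation hβ B.1 j m w), smul_add]
  map_smul' c A := by
    ext m w
    simp only [linearFinsum, LinearMap.coe_mk, AddHom.coe_mk, LinearMap.smul_apply,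
      LinearMap.comp_apply, Submodule.coe_smul, Pi.smul_apply, RingHom.id_apply]
    rw [smul_comm c, (eventuallyZero_annihilation hβ A.1 j m w).smul_finsum c]
    exact congrArg _ (finsum_congr fun i => smul_comm _ _ _)

theorem annihilationPart_apply (hβ : IsSmoothHeisenberg β) (j : ℕ) (A : FieldSpace W) (m : ℤ)
    (w : W) :
    (annihilationPart hβ j A).1 m w =
      (-1 : ℂ) ^ j • ∑ᶠ i : ℕ, ((j + i).choose i : ℂ) • A.1 (m - j - 1 - i) (β i w) := rfl

theorem IsSmoothHeisenberg.commute_of_add_ne_zero (hβ : IsSmoothHeisenberg β) {m n : ℤ}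
    (h : m + n ≠ 0) (w : W) : β m (β n w) = β n (β m w) := by
  rw [hβ.comm, if_neg h, add_zero]

/-- All operators involved have negative index, so no two indices add up to zero and the central
term never occurs. -/
theorem creationPart_comm (hβ : IsSmoothHeisenberg β) (j k : ℕ) :
    creationPart β j * creationPart β k = creationPart β k * creationPart β j := by
  have key : ∀ (j k : ℕ) (A : FieldSpace W) (m : ℤ) (w : W),
      (creationPart β j (creationPart β k A)).1 m w = ∑ᶠ i : ℕ, ∑ᶠ r : ℕ,
        ((j + i).choose i * (k + r).choose r : ℂ) •
          β (-j - 1 - i) (β (-k - 1 - r) (A.1 (m + i + r) w)) := fun j k A m w => by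
    rw [creationPart_apply]
    refine finsum_congr fun i => ?_
    rw [creationPart_apply, (eventuallyZero_creation A k (m + i) w).map_finsum,
      ((eventuallyZero_creation A k (m + i) w).map _).smul_finsum]
    refine finsum_congr fun r => ?_
    rw [map_smul, smul_smul]
  ext A m w
  rw [Module.End.mul_apply, Module.End.mul_apply, key, key, EventuallyZero₂.finsum_comm]
  · refine finsum_congr fun r => finsum_congr fun i => ?_
    rw [hβ.commute_of_add_ne_zero (by omega), mul_comm, add_right_comm]
  · obtain ⟨n, hn⟩ := A.2 w
    refine ⟨(n - m).toNat, fun i r h => ?_⟩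
    beta_reduce
    rw [hn (m + i + r) (by omega), map_zero, map_zero, smul_zero]

/-- The indices `i`, `r` are nonnegative, so the central term could only occur for `i = r = 0`,
where its coefficient is zero. -/
theorem annihilationPart_comm (hβ : IsSmoothHeisenberg β) (j k : ℕ) :
    annihilationPart hβ j * annihilationPart hβ k =
      annihilationPart hβ k * annihilationPart hβ j := by
  have key : ∀ (j k : ℕ) (A : FieldSpace W) (m : ℤ) (w : W),
      (annihilationPart hβ j (annihilationPart hβ k A)).1 m w =
        ((-1) ^ j * (-1) ^ k : ℂ) • ∑ᶠ i : ℕ, ∑ᶠ r : ℕ,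
        ((j + i).choose i * (k + r).choose r : ℂ) •
          A.1 (m - j - 1 - i - k - 1 - r) (β r (β i w)) := fun j k A m w => by
    rw [annihilationPart_apply, mul_smul]
    rw [EventuallyZero.smul_finsum (f := fun i => ∑ᶠ r : ℕ, ((j + i).choose i * (k + r).choose r : ℂ)
        • A.1 (m - j - 1 - i - k - 1 - r) (β r (β i w)))]
    · refine congrArg _ (finsum_congr fun i => ?_)
      rw [annihilationPart_apply, smul_comm,
        (eventuallyZero_annihilation hβ A.1 k _ (β i w)).smul_finsum]
      refine congrArg _ (finsum_congr fun r => ?_)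
      rw [smul_smul]
    · refine (hβ.smooth w).mono fun i h => ?_
      simp [h]
  ext A m w
  rw [Module.End.mul_apply, Module.End.mul_apply, key, key, EventuallyZero₂.finsum_comm,
    mul_comm ((-1 : ℂ) ^ j)]
  · refine congrArg _ (finsum_congr fun r => finsum_congr fun i => ?_)
    rw [hβ.comm r i, mul_comm ((k + r).choose r : ℂ), show m - j - 1 - i - k - 1 - r =
      m - k - 1 - r - j - 1 - i by ring]
    by_cases h : (r : ℤ) + i = 0
    · simp [show r = 0 by omega]
    · rw [if_neg h, add_zero]
  · refine (EventuallyZero₂.of_rows (f := fun i r : ℕ => β r (β i w)) ?_ ?_).mono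
      fun i r h => by rw [h, map_zero, smul_zero]
    · obtain ⟨n, hn⟩ := hβ.exists_bound w
      exact ⟨n, fun i hi r => by rw [hn i hi, map_zero]⟩
    · exact fun i => hβ.smooth _

/-- One half composes `A` with operators on the left, the other on the right. They commute formally,
and only the interchange of the two sums needs finiteness. -/
theorem creationPart_annihilationPart_comm (hβ : IsSmoothHeisenberg β) (j k : ℕ) :
    creationPart β j * annihilationPart hβ k = annihilationPart hβ k * creationPart β j := by
  ext A m w
  rw [Module.End.mul_apply, Module.End.mul_apply, creationPart_apply, annihilationPart_apply]
  have h2 : EventuallyZero₂ fun i r : ℕ => A.1 (m + i - k - 1 - r) (β r w) := by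
    refine (EventuallyZero₂.of_rows (f := fun r i : ℕ => A.1 (m + i - k - 1 - r) (β r w))
      ?_ fun r => ?_).swap
    · obtain ⟨n, hn⟩ := hβ.exists_bound w
      exact ⟨n, fun i hi r => by rw [hn i hi, map_zero]⟩
    · convert eventuallyZero_field A (m - k - 1 - r) (β r w) using 4
      ring
  have e1 : ∀ i : ℕ, ((j + i).choose i : ℂ) • β (-j - 1 - i) ((annihilationPart hβ k A).1 (m + i) w)
      = (-1 : ℂ) ^ k • ∑ᶠ r : ℕ, ((j + i).choose i * (k + r).choose r : ℂ) •
        β (-j - 1 - i) (A.1 (m + i - k - 1 - r) (β r w)) := fun i => by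
    rw [annihilationPart_apply, map_smul, smul_comm,
      (eventuallyZero_annihilation hβ A.1 k (m + i) w).map_finsum,
      ((eventuallyZero_annihilation hβ A.1 k (m + i) w).map _).smul_finsum]
    simp only [map_smul, smul_smul]
  have e2 : ∀ r : ℕ, ((k + r).choose r : ℂ) • (creationPart β j A).1 (m - k - 1 - r) (β r w)
      = ∑ᶠ i : ℕ, ((j + i).choose i * (k + r).choose r : ℂ) •
        β (-j - 1 - i) (A.1 (m + i - k - 1 - r) (β r w)) := fun r => by
    rw [creationPart_apply, (eventuallyZero_creation A j _ (β r w)).smul_finsum]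
    refine finsum_congr fun i => ?_
    rw [smul_smul, mul_comm, show m - k - 1 - r + i = m + i - k - 1 - r by ring]
  have h3 := h2.mono (g := fun i r : ℕ => ((j + i).choose i * (k + r).choose r : ℂ) •
    β (-j - 1 - i) (A.1 (m + i - k - 1 - r) (β r w))) fun i r h => by rw [h, map_zero, smul_zero]
  simp only [e1, e2]
  rw [← (finsum_eventuallyZero h3).smul_finsum, h3.finsum_comm]

/-- The normally ordered product `A(z) ↦ :∂^j b(z) A(z): / j!`. -/
def normalOrd (hβ : IsSmoothHeisenberg β) (j : ℕ) : Module.End ℂ (FieldSpace W) :=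
  creationPart β j + annihilationPart hβ j

theorem normalOrd_apply (hβ : IsSmoothHeisenberg β) (j : ℕ) (A : FieldSpace W) (m : ℤ) (w : W) :
    (normalOrd hβ j A).1 m w =
      ∑ᶠ i : ℕ, ((j + i).choose i : ℂ) • β (-j - 1 - i) (A.1 (m + i) w) +
      (-1 : ℂ) ^ j • ∑ᶠ i : ℕ, ((j + i).choose i : ℂ) • A.1 (m - j - 1 - i) (β i w) := rfl

/-- Iterated normally ordered products do not depend on the order of the factors, so the commutative
polynomial ring acts on the space of fields. This makes `vertexOp` well defined. -/
theorem normalOrd_comm (hβ : IsSmoothHeisenberg β) (j k : ℕ) :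
    normalOrd hβ j * normalOrd hβ k = normalOrd hβ k * normalOrd hβ j := by
  rw [normalOrd, normalOrd, add_mul, add_mul, mul_add, mul_add, mul_add, mul_add,
    creationPart_comm hβ j, annihilationPart_comm hβ j, creationPart_annihilationPart_comm hβ j,
    creationPart_annihilationPart_comm hβ k]
  abel

variable (W) in
/-- The identity field. -/
def idField : FieldSpace W :=
  ⟨fun m => if m = -1 then LinearMap.id else 0, fun w => ⟨0, fun m hm => by
    beta_reduce
    rw [if_neg (by omega), LinearMap.zero_apply]⟩⟩

-- `MvPolynomial.aeval` requires a commutative target. The evaluation is therefore made in the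
-- subalgebra generated by the `N j`, which is commutative, and then included.
open scoped IsMulCommutative in
theorem exists_algHom_of_commute {A : Type*} [Ring A] [Algebra ℂ A] (N : ℕ → A)
    (h : ∀ j k, N j * N k = N k * N j) :
    ∃ f : MvPolynomial ℕ ℂ →ₐ[ℂ] A, ∀ j, f (MvPolynomial.X j) = N j := by
  have hc : IsMulCommutative (Algebra.adjoin ℂ (Set.range N)) :=
    Algebra.isMulCommutative_adjoin ℂ (by
      rintro _ ⟨j, rfl⟩ _ ⟨k, rfl⟩
      exact h j k)
  let S := Algebra.adjoin ℂ (Set.range N)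
  let g : MvPolynomial ℕ ℂ →ₐ[ℂ] S :=
    MvPolynomial.aeval (R := ℂ) (S₁ := S) fun j => (⟨N j, Algebra.subset_adjoin ⟨j, rfl⟩⟩ : S)
  refine ⟨S.val.comp g, fun j => ?_⟩
  rw [AlgHom.comp_apply, MvPolynomial.aeval_X]
  rfl

/-- The algebra map sending `b_{-j-1}` to the normally ordered product with `∂^j b / j!`. -/
def normalOrdHom (hβ : IsSmoothHeisenberg β) :
    MvPolynomial ℕ ℂ →ₐ[ℂ] Module.End ℂ (FieldSpace W) :=
  (exists_algHom_of_commute (A := Module.End ℂ (FieldSpace W)) (normalOrd hβ)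
    (normalOrd_comm hβ)).choose

theorem normalOrdHom_X (hβ : IsSmoothHeisenberg β) (j : ℕ) :
    normalOrdHom hβ (MvPolynomial.X j) = normalOrd hβ j :=
  (exists_algHom_of_commute (A := Module.End ℂ (FieldSpace W)) (normalOrd hβ)
    (normalOrd_comm hβ)).choose_spec j

/-- The state-field correspondence `a ↦ Y_W(a, z)`, with values in the fields on a smooth module
over the Heisenberg algebra. -/
def vertexOp (hβ : IsSmoothHeisenberg β) : MvPolynomial ℕ ℂ →ₗ[ℂ] FieldSpace W :=
  (LinearMap.applyₗ (idField W)) ∘ₗ (normalOrdHom hβ).toLinearMap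

theorem vertexOp_one (hβ : IsSmoothHeisenberg β) : vertexOp hβ 1 = idField W := by
  simp [vertexOp]

theorem vertexOp_X_mul (hβ : IsSmoothHeisenberg β) (j : ℕ) (a : MvPolynomial ℕ ℂ) :
    vertexOp hβ (MvPolynomial.X j * a) = normalOrd hβ j (vertexOp hβ a) := by
  simp [vertexOp, normalOrdHom_X]

end Fields

/-! ## The Fock spaces -/

namespace Heisenberg

open MvPolynomial

/-- The Heisenberg operators on the Fock space of highest weight `x`: `b_0` acts as `x`. -/
def oscAt (x : ℂ) (n : ℤ) : Module.End ℂ Fock := if n = 0 then x • LinearMap.id else osc n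

theorem oscAt_of_ne (x : ℂ) {n : ℤ} (h : n ≠ 0) : oscAt x n = osc n := if_neg h

theorem oscAt_zero_index (x : ℂ) : oscAt x 0 = x • LinearMap.id := if_pos rfl

theorem osc_zero : osc 0 = 0 := rfl

theorem osc_negSucc (i : ℕ) (v : Fock) : osc (Int.negSucc i) v = X i * v := rfl

theorem osc_neg (i : ℕ) (n : ℤ) (h : n = -i - 1) (v : Fock) : osc n v = X i * v := by
  rw [show n = Int.negSucc i by omega, osc_negSucc]

theorem osc_succ (i : ℕ) (v : Fock) : osc ((i + 1 : ℕ) : ℤ) v = ((i : ℂ) + 1) • pderiv i v := rfl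

theorem oscAt_zero : oscAt 0 = osc := by
  ext1 n
  rw [oscAt]
  split_ifs with h
  · rw [h, osc_zero, zero_smul]
  · rfl

theorem pderiv_comm (i j : ℕ) (p : Fock) : pderiv i (pderiv j p) = pderiv j (pderiv i p) := by
  have h : ⁅(pderiv i : Derivation ℂ Fock Fock), pderiv j⁆ = 0 :=
    MvPolynomial.derivation_ext fun k => by
      rw [Derivation.commutator_apply, pderiv_X, pderiv_X]
      simp [Pi.single_apply, apply_ite]
  have h2 := DFunLike.congr_fun h p
  rwa [Derivation.commutator_apply, Derivation.zero_apply, sub_eq_zero] at h2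

/-- Multiplications commute with each other and so do partial derivatives. The mixed case `key` is
the Leibniz rule for `∂_i (X_j w)`. -/
theorem osc_comm (m n : ℤ) (w : Fock) :
    osc m (osc n w) = osc n (osc m w) + if m + n = 0 then (m : ℂ) • w else 0 := by
  have key : ∀ i j : ℕ, osc ((i + 1 : ℕ) : ℤ) (osc (Int.negSucc j) w) =
      osc (Int.negSucc j) (osc ((i + 1 : ℕ) : ℤ) w) + if i = j then ((i : ℂ) + 1) • w else 0 := by
    intro i j
    rw [osc_succ, osc_succ, osc_negSucc, osc_negSucc, pderiv_mul, pderiv_X, Pi.single_apply]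
    split_ifs with h1 h2 h2
    · rw [one_mul, smul_add, mul_smul_comm, add_comm]
    · exact absurd h1.symm h2
    · exact absurd h2.symm h1
    · rw [zero_mul, zero_add, add_zero, mul_smul_comm]
  rcases m with (_ | i) | i <;> rcases n with (_ | j) | j
  · simp
  · rw [if_neg (by simp; omega)]
    change osc 0 _ = osc _ (osc 0 _) + 0
    simp [osc_zero]
  · rw [if_neg (by simp)]
    change osc 0 _ = osc _ (osc 0 _) + 0
    simp [osc_zero]
  · rw [if_neg (by simp; omega)]
    change osc _ (osc 0 _) = osc 0 _ + 0
    simp [osc_zero]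
  · rw [if_neg (by simp; omega), add_zero]
    change osc ((i + 1 : ℕ) : ℤ) (osc ((j + 1 : ℕ) : ℤ) w) = osc ((j + 1 : ℕ) : ℤ) (osc ((i + 1 : ℕ) : ℤ) w)
    simp only [osc_succ, map_smul, pderiv_comm i j]
    rw [smul_comm]
  · change osc ((i + 1 : ℕ) : ℤ) (osc (Int.negSucc j) w) = _
    rw [key]
    congr 1
    by_cases h : i = j
    · subst h
      rw [if_pos rfl, if_pos (by simp [Int.negSucc_eq])]
      simp
    · rw [if_neg h, if_neg (by simp [Int.negSucc_eq]; omega)]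
  · rw [if_neg (by simp)]
    change osc _ (osc 0 _) = osc 0 _ + 0
    simp [osc_zero]
  · have h1 := key j i
    change osc (Int.negSucc i) (osc ((j + 1 : ℕ) : ℤ) w) = osc ((j + 1 : ℕ) : ℤ) (osc (Int.negSucc i) w) + _
    rw [h1, add_assoc]
    convert (add_zero _).symm
    by_cases h : j = i
    · subst h
      rw [if_pos rfl, if_pos (by simp [Int.negSucc_eq])]
      rw [Int.negSucc_eq, ← add_smul]
      push_cast
      rw [show (j : ℂ) + 1 + -((j : ℂ) + 1) = 0 by ring, zero_smul]
    · rw [if_neg h, if_neg (by simp [Int.negSucc_eq]; omega), add_zero]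
  · rw [if_neg (by simp [Int.negSucc_eq]; omega), add_zero]
    simp only [osc_negSucc]
    ring

theorem exists_pderiv_eq_zero (w : Fock) : ∃ n : ℕ, ∀ i, n ≤ i → pderiv i w = 0 := by
  refine ⟨w.vars.sup id + 1, fun i hi => pderiv_eq_zero_of_notMem_vars fun h => ?_⟩
  have := Finset.le_sup (f := id) h
  simp at this
  omega

theorem isSmooth_oscAt (x : ℂ) : IsSmoothHeisenberg (oscAt x) where
  comm m n w := by
    by_cases hm : m = 0
    · subst hm
      by_cases hn : n = 0
      · subst hn
        simp
      · rw [oscAt_zero_index, if_neg (by simpa using hn)]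
        simp
    · by_cases hn : n = 0
      · subst hn
        rw [oscAt_zero_index, if_neg (by simpa using hm)]
        simp
      · rw [oscAt_of_ne x hm, oscAt_of_ne x hn, osc_comm]
  smooth w := by
    obtain ⟨n, hn⟩ := exists_pderiv_eq_zero w
    refine ⟨n + 1, fun i hi => ?_⟩
    obtain ⟨k, rfl⟩ : ∃ k, i = k + 1 := ⟨i - 1, by omega⟩
    beta_reduce
    rw [oscAt_of_ne x (by omega), osc_succ, hn k (by omega), smul_zero]

theorem isSmooth_osc : IsSmoothHeisenberg osc := oscAt_zero ▸ isSmooth_oscAt 0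

theorem osc_nat_one (p : ℕ) : osc p (1 : Fock) = 0 := by
  rcases p with _ | i
  · rfl
  · rw [osc_succ, pderiv_one, smul_zero]

theorem osc_nat_X_mul (p j : ℕ) (c : Fock) :
    osc p (X j * c) = X j * osc p c + if p = j + 1 then ((j : ℂ) + 1) • c else 0 := by
  rw [← osc_negSucc, ← osc_negSucc, osc_comm]
  congr 1
  by_cases h : p = j + 1
  · subst h
    rw [if_pos rfl, if_pos (by simp [Int.negSucc_eq])]
    simp
  · rw [if_neg h, if_neg (by simp [Int.negSucc_eq]; omega)]

end Heisenberg

/-! ## The commutator formula -/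

section Commutator

variable {W : Type*} [AddCommGroup W] [Module ℂ W] {β : ℤ → Module.End ℂ W}

/-- Multiplication of a field by a power of `z`. -/
def shiftField (s : ℤ) : Module.End ℂ (FieldSpace W) where
  toFun A := ⟨fun m => A.1 (m + s), fun w => by
    obtain ⟨n, hn⟩ := A.2 w
    exact ⟨n - s, fun m hm => hn _ (by omega)⟩⟩
  map_add' _ _ := rfl
  map_smul' _ _ := rfl

theorem shiftField_apply (s : ℤ) (A : FieldSpace W) (m : ℤ) :
    (shiftField s A).1 m = A.1 (m + s) := rfl

/-- The commutator of a field with `β k`. -/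
def adField (β : ℤ → Module.End ℂ W) (k : ℤ) : Module.End ℂ (FieldSpace W) where
  toFun A := ⟨fun m => β k ∘ₗ A.1 m - A.1 m ∘ₗ β k, fun w => by
    obtain ⟨n, hn⟩ := A.2 w
    obtain ⟨n', hn'⟩ := A.2 (β k w)
    refine ⟨max n n', fun m hm => ?_⟩
    rw [LinearMap.sub_apply, LinearMap.comp_apply, LinearMap.comp_apply, hn m (by omega),
      hn' m (by omega), map_zero, sub_zero]⟩
  map_add' A B := by
    ext m w
    simp only [Submodule.coe_add, Pi.add_apply, LinearMap.sub_apply, LinearMap.comp_apply,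
      LinearMap.add_apply, map_add]
    abel
  map_smul' c A := by
    ext m w
    simp only [Submodule.coe_smul, Pi.smul_apply, LinearMap.sub_apply, LinearMap.comp_apply,
      LinearMap.smul_apply, map_smul, RingHom.id_apply, smul_sub]

theorem adField_apply (k : ℤ) (A : FieldSpace W) (m : ℤ) (w : W) :
    (adField β k A).1 m w = β k (A.1 m w) - A.1 m (β k w) := rfl

theorem normalOrd_shiftField (hβ : IsSmoothHeisenberg β) (j : ℕ) (s : ℤ) (A : FieldSpace W) :
    normalOrd hβ j (shiftField s A) = shiftField s (normalOrd hβ j A) := by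
  ext m w
  simp only [normalOrd_apply, shiftField_apply]
  congr 2
  · ext i
    rw [add_right_comm]
  · congr 1
    ext i
    rw [show m + s - j - 1 - i = m - j - 1 - i + s by ring]

/-- The sum of the central terms created when `β k` passes `∂^j b / j!`. At most one summand
survives: for `k > 0` it is in the creation half at `i = k - j - 1`, for `k ≤ 0` in the annihilation
half at `i = -k`. Both cases give `k (k-1 choose j) = (j+1) (k choose j+1)`. -/
theorem adField_normalOrd_aux (A : ℤ → W) (j : ℕ) (m k : ℤ) :
    ∑ᶠ i : ℕ, ((j + i).choose i : ℂ) • (if k + (-j - 1 - i) = 0 then (k : ℂ) • A (m + i) else 0) +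
      (-1 : ℂ) ^ j • ∑ᶠ i : ℕ, ((j + i).choose i : ℂ) •
        (if k + i = 0 then (k : ℂ) • A (m - j - 1 - i) else 0) =
      (zchoose k (j + 1) * (j + 1)) • A (m + (k - (j + 1 : ℕ))) := by
  by_cases hk : 0 < k
  · have h0 : ∀ i : ℕ, ((j + i).choose i : ℂ) •
        (if k + i = 0 then (k : ℂ) • A (m - j - 1 - i) else 0) = 0 := fun i => by
      rw [if_neg (by omega), smul_zero]
    rw [finsum_congr h0, finsum_zero, smul_zero, add_zero]
    obtain ⟨n, rfl⟩ : ∃ n : ℕ, k = ((n + 1 : ℕ) : ℤ) := ⟨(k - 1).toNat, by omega⟩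
    rw [zchoose_natCast, ← Nat.cast_add_one, ← Nat.cast_mul, ← Nat.add_one_mul_choose_eq]
    by_cases hn : j ≤ n
    · obtain ⟨i, rfl⟩ := Nat.exists_eq_add_of_le hn
      rw [finsum_eq_single _ i, if_pos (by push_cast; ring), smul_smul]
      · congr 2
        · rw [Nat.choose_symm_add]
          push_cast
          ring
        · push_cast; ring
      · intro x hx
        rw [if_neg (by omega), smul_zero]
    · rw [Nat.choose_eq_zero_of_lt (not_le.1 hn), mul_zero, Nat.cast_zero, zero_smul]
      refine (finsum_congr fun i => ?_).trans finsum_zero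
      rw [if_neg (by omega), smul_zero]
  · have h0 : ∀ i : ℕ, ((j + i).choose i : ℂ) •
        (if k + (-j - 1 - i) = 0 then (k : ℂ) • A (m + i) else 0) = 0 := fun i => by
      rw [if_neg (by omega), smul_zero]
    rw [finsum_congr h0, finsum_zero, zero_add]
    obtain ⟨n, rfl⟩ : ∃ n : ℕ, k = -(n : ℤ) := ⟨(-k).toNat, by omega⟩
    rw [finsum_eq_single _ n, if_pos (by ring), smul_smul, smul_smul,
      show m - j - 1 - n = m + (-(n : ℤ) - (j + 1 : ℕ)) by push_cast; ring]
    · congr 1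
      · rcases n with _ | n
        · simp [zchoose, Ring.choose_zero_succ]
        · rw [zchoose_neg n _ (by push_cast; ring)]
          have h1 := Nat.add_one_mul_choose_eq (j + n) j
          have h2 := Nat.add_one_mul_choose_eq (j + n) n
          have h3 : (j + n).choose n = (j + n).choose j := (Nat.choose_symm_add).symm
          have h4 : ((j + (n + 1)).choose (n + 1) : ℂ) * (n + 1) =
              (n + (j + 1)).choose (j + 1) * (j + 1) := by
            rw [show n + (j + 1) = j + n + 1 by ring, show j + (n + 1) = j + n + 1 by ring]
            exact_mod_cast (by rw [← h1, ← h2, h3])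
          push_cast
          rw [pow_succ]
          linear_combination (-(-1) ^ j) * h4
    · intro x hx
      rw [if_neg (by omega), smul_zero]

/-- Commuting with `β k` is a derivation of the normally ordered product. On the factor `b` it
produces central terms only, which `adField_normalOrd_aux` collects. -/
theorem adField_normalOrd (hβ : IsSmoothHeisenberg β) (j : ℕ) (k : ℤ) (A : FieldSpace W) :
    adField β k (normalOrd hβ j A) = normalOrd hβ j (adField β k A) +
      (zchoose k (j + 1) * (j + 1)) • shiftField (k - (j + 1 : ℕ)) A := by
  ext m w
  have h1 := eventuallyZero_creation (β := β) A j m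
  have h2 := eventuallyZero_annihilation hβ A.1 j m
  rw [adField_apply, Submodule.coe_add, Pi.add_apply, LinearMap.add_apply, Submodule.coe_smul,
    Pi.smul_apply, LinearMap.smul_apply, shiftField_apply,
    ← adField_normalOrd_aux (fun s => A.1 s w), normalOrd_apply, normalOrd_apply, normalOrd_apply,
    map_add, map_smul, (h1 w).map_finsum, (h2 w).map_finsum]
  have e1 : ∑ᶠ i : ℕ, β k (((j + i).choose i : ℂ) • β (-j - 1 - i) (A.1 (m + i) w)) =
      ∑ᶠ i : ℕ, ((j + i).choose i : ℂ) • β (-j - 1 - i) ((adField β k A).1 (m + i) w) +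
      ∑ᶠ i : ℕ, ((j + i).choose i : ℂ) • β (-j - 1 - i) (A.1 (m + i) (β k w)) +
      ∑ᶠ i : ℕ, ((j + i).choose i : ℂ) •
        (if k + (-j - 1 - i) = 0 then (k : ℂ) • A.1 (m + i) w else 0) := by
    rw [← (eventuallyZero_creation _ j m w).finsum_add (h1 (β k w)),
      ← ((eventuallyZero_creation _ j m w).add (h1 (β k w))).finsum_add]
    · refine finsum_congr fun i => ?_
      rw [map_smul, ← smul_add, ← smul_add, ← map_add, adField_apply, sub_add_cancel, hβ.comm]
    · refine (eventuallyZero_field A m w).mono fun i h => ?_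
      simp [h]
  have e2 : ∑ᶠ i : ℕ, β k (((j + i).choose i : ℂ) • A.1 (m - j - 1 - i) (β i w)) =
      ∑ᶠ i : ℕ, ((j + i).choose i : ℂ) • (adField β k A).1 (m - j - 1 - i) (β i w) +
      ∑ᶠ i : ℕ, ((j + i).choose i : ℂ) • A.1 (m - j - 1 - i) (β i (β k w)) +
      ∑ᶠ i : ℕ, ((j + i).choose i : ℂ) •
        (if k + i = 0 then (k : ℂ) • A.1 (m - j - 1 - i) w else 0) := by
    rw [← (eventuallyZero_annihilation hβ _ j m w).finsum_add (h2 (β k w)),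
      ← ((eventuallyZero_annihilation hβ _ j m w).add (h2 (β k w))).finsum_add]
    · refine finsum_congr fun i => ?_
      rw [map_smul, ← smul_add, ← smul_add, adField_apply, hβ.comm k i]
      split_ifs
      · rw [map_add, map_smul]
        congr 1
        abel
      · rw [add_zero, add_zero, sub_add_cancel]
    · refine ⟨k.natAbs + 1, fun i hi => ?_⟩
      beta_reduce
      rw [if_neg (by omega), smul_zero]
  rw [e1, e2, smul_add, smul_add]
  abel

open Heisenberg MvPolynomial

theorem eventuallyZero_osc {M : Type*} [AddCommGroup M] [Module ℂ M] (c : Fock)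
    (f : ℕ → Fock →ₗ[ℂ] M) : EventuallyZero fun p : ℕ => f p (osc p c) :=
  (isSmooth_osc.smooth c).mono fun p h => by rw [h, map_zero]

/-- The commutator formula `[b_k, Y(c)_t] = ∑ (k choose p) Y(b_p c)_{k+t-p}`. -/
theorem adField_vertexOp (hβ : IsSmoothHeisenberg β) (k : ℤ) (c : Fock) :
    adField β k (vertexOp hβ c) =
      ∑ᶠ p : ℕ, zchoose k p • shiftField (k - p) (vertexOp hβ (osc p c)) := by
  have hz : ∀ c : Fock, EventuallyZero fun p : ℕ =>
      zchoose k p • shiftField (k - p) (vertexOp hβ (osc p c)) := fun c =>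
    eventuallyZero_osc c fun p => zchoose k p • (shiftField (k - p) ∘ₗ vertexOp hβ)
  induction c using MvPolynomial.induction_on with
  | C a =>
    have h : (C a : Fock) = a • 1 := by rw [smul_eq_C_mul, mul_one]
    rw [h]
    simp only [map_smul, osc_nat_one, map_zero, smul_zero, finsum_zero]
    rw [vertexOp_one]
    convert smul_zero a
    ext m w
    rw [adField_apply, idField]
    dsimp only
    split_ifs <;> simp
  | add p q hp hq =>
    rw [map_add, map_add, hp, hq, ← (hz p).finsum_add (hz q)]
    refine finsum_congr fun i => ?_
    rw [map_add, map_add, map_add, smul_add]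
  | mul_X c j ih =>
    rw [mul_comm, vertexOp_X_mul, adField_normalOrd, ih, (hz c).map_finsum]
    -- Commuting `b_p` past `b_{-j-1}` gives an extra term only for `p = j + 1`. It matches the
    -- central term of `adField_normalOrd`.
    have e : ∀ p : ℕ, zchoose k p • shiftField (k - p) (vertexOp hβ (osc p (X j * c))) =
        normalOrd hβ j (zchoose k p • shiftField (k - p) (vertexOp hβ (osc p c))) +
        if p = j + 1 then (zchoose k (j + 1) * (j + 1)) •
          shiftField (k - (j + 1 : ℕ)) (vertexOp hβ c) else 0 := fun p => by
      rw [osc_nat_X_mul, map_add, map_add, smul_add, vertexOp_X_mul, map_smul,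
        normalOrd_shiftField]
      congr 1
      split_ifs with h
      · subst h
        rw [map_smul, map_smul, smul_smul]
      · simp
    rw [finsum_congr e, ((hz c).map _).finsum_add]
    · congr 1
      rw [finsum_eq_single _ (j + 1), if_pos rfl]
      intro x hx
      rw [if_neg hx]
    · exact ⟨j + 2, fun i hi => if_neg (by omega)⟩

end Commutator

/-! ## Binomial sums -/

section BinomSum

variable {M N : Type*} [AddCommGroup M] [Module ℂ M] [AddCommGroup N] [Module ℂ N]

/-- `∑ (l choose i) f_i`. -/
def binomSum (l : ℤ) (f : ℕ → M) : M := ∑ᶠ i : ℕ, zchoose l i • f i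

/-- `∑ (-1)^i (l choose i) f_i`. -/
def altSum (l : ℤ) (f : ℕ → M) : M := ∑ᶠ i : ℕ, ((-1 : ℂ) ^ i * zchoose l i) • f i

theorem altSum_eq_binomSum (l : ℤ) (f : ℕ → M) :
    altSum l f = binomSum l fun i => (-1 : ℂ) ^ i • f i :=
  finsum_congr fun i => by rw [smul_smul, mul_comm]

theorem binomSum_add (l : ℤ) {f g : ℕ → M} (hf : EventuallyZero f) (hg : EventuallyZero g) :
    binomSum l (fun i => f i + g i) = binomSum l f + binomSum l g := by
  rw [binomSum, binomSum, binomSum, ← (hf.smul _).finsum_add (hg.smul _)]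
  exact finsum_congr fun i => smul_add _ _ _

theorem binomSum_map (l : ℤ) {f : ℕ → M} (hf : EventuallyZero f) (g : M →ₗ[ℂ] N) :
    g (binomSum l f) = binomSum l fun i => g (f i) := by
  rw [binomSum, binomSum, (hf.smul _).map_finsum]
  exact finsum_congr fun i => map_smul _ _ _

theorem binomSum_smul (l : ℤ) {f : ℕ → M} (hf : EventuallyZero f) (c : ℂ) :
    binomSum l (fun i => c • f i) = c • binomSum l f :=
  (binomSum_map l hf (LinearMap.lsmul ℂ M c)).symm

theorem binomSum_finsum (l : ℤ) {f : ℕ → ℕ → M} (hf : EventuallyZero₂ f) :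
    binomSum l (fun i => ∑ᶠ r, f i r) = ∑ᶠ r, binomSum l fun i => f i r := by
  simp only [binomSum]
  rw [← (hf.smul fun i _ => zchoose l i).finsum_comm]
  exact finsum_congr fun i => (hf.row i).smul_finsum _

/-- Vandermonde's identity along antidiagonals, that is `(1+t)^l (1+t)^p = (1+t)^(l+p)`. The signed
version `altSum_altSum` says that powers of `z - w` multiply. -/
theorem binomSum_binomSum (l p : ℤ) {f : ℕ → M} (hf : EventuallyZero f) :
    binomSum l (fun i => binomSum p fun r => f (i + r)) = binomSum (l + p) f := by
  have hf2 : EventuallyZero₂ fun i r => f (i + r) := by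
    obtain ⟨n, hn⟩ := hf
    exact ⟨n, fun i r h => hn _ (by omega)⟩
  have e : ∀ i, zchoose l i • binomSum p (fun r => f (i + r)) =
      ∑ᶠ r, (zchoose l i * zchoose p r) • f (i + r) := fun i => by
    rw [binomSum, ((hf2.row i).smul _).smul_finsum]
    exact finsum_congr fun r => smul_smul _ _ _
  rw [binomSum, finsum_congr e, (hf2.smul _).finsum_antidiagonal, binomSum]
  refine finsum_congr fun q => ?_
  rw [← sum_zchoose, Finset.sum_smul]
  refine Finset.sum_congr rfl fun x hx => ?_
  rw [Finset.HasAntidiagonal.mem_antidiagonal.1 hx]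

theorem altSum_add (l : ℤ) {f g : ℕ → M} (hf : EventuallyZero f) (hg : EventuallyZero g) :
    altSum l (fun i => f i + g i) = altSum l f + altSum l g := by
  simp only [altSum_eq_binomSum, smul_add]
  exact binomSum_add l (hf.smul _) (hg.smul _)

theorem altSum_map (l : ℤ) {f : ℕ → M} (hf : EventuallyZero f) (g : M →ₗ[ℂ] N) :
    g (altSum l f) = altSum l fun i => g (f i) := by
  simp only [altSum_eq_binomSum, binomSum_map l (hf.smul _), map_smul]

theorem altSum_smul (l : ℤ) {f : ℕ → M} (hf : EventuallyZero f) (c : ℂ) :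
    altSum l (fun i => c • f i) = c • altSum l f :=
  (altSum_map l hf (LinearMap.lsmul ℂ M c)).symm

theorem altSum_finsum (l : ℤ) {f : ℕ → ℕ → M} (hf : EventuallyZero₂ f) :
    altSum l (fun i => ∑ᶠ r, f i r) = ∑ᶠ r, altSum l fun i => f i r := by
  simp only [altSum_eq_binomSum]
  rw [← binomSum_finsum l (hf.smul _)]
  congr 1
  ext i
  exact (hf.row i).smul_finsum _

theorem altSum_altSum (l p : ℤ) {f : ℕ → M} (hf : EventuallyZero f) :
    altSum l (fun i => altSum p fun r => f (i + r)) = altSum (l + p) f := by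
  simp only [altSum_eq_binomSum]
  rw [← binomSum_binomSum l p (hf.smul _)]
  congr 1
  ext i
  rw [← binomSum_smul]
  · congr 1
    ext r
    rw [smul_smul, pow_add]
  · obtain ⟨n, hn⟩ := hf
    exact ⟨n, fun r h => by beta_reduce; rw [hn _ (by omega), smul_zero]⟩

theorem altSum_eventuallyZero (l : ℕ → ℤ) {f : ℕ → ℕ → M} (hf : EventuallyZero₂ f) :
    EventuallyZero fun i => altSum (l i) (f i) := by
  obtain ⟨n, hn⟩ := hf
  refine ⟨n, fun i hi => ?_⟩
  simp [altSum, hn i _ (Or.inl hi)]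

theorem finsum_shift {f : ℕ → M} (k : ℕ) (h : ∀ r, r < k → f r = 0) :
    ∑ᶠ r, f r = ∑ᶠ r, f (k + r) := by
  have hinj : Function.Injective fun r : ℕ => k + r := fun a b h => Nat.add_left_cancel h
  rw [← finsum_mem_range (f := f) hinj]
  refine finsum_congr fun r => ?_
  by_cases hr : r ∈ Set.range fun r : ℕ => k + r
  · simp [hr]
  · have h0 : f r = 0 := h r (by
      by_contra hk
      exact hr ⟨r - k, by beta_reduce; omega⟩)
    rw [h0]
    exact finsum_zero.symm

end BinomSum

/-! ## Products of fields -/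

section Products

variable {W : Type*} [AddCommGroup W] [Module ℂ W] {β : ℤ → Module.End ℂ W}

/-- The coefficients of `(z - w)^l A(z) C(w)`, expanded for `|z| > |w|`. -/
def opProd (A C : FieldSpace W) (l m n : ℤ) (w : W) : W :=
  altSum l fun i => A.1 (m + l - i) (C.1 (n + i) w)

/-- The coefficients of `(w - z)^l C(w) A(z)`, expanded for `|w| > |z|`. -/
def opProdRev (A C : FieldSpace W) (l m n : ℤ) (w : W) : W :=
  altSum l fun i => C.1 (n + l - i) (A.1 (m + i) w)

/-- Both sides are the trinomial coefficient `(j+k+r)! / (j! k! r!)`. -/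
theorem choose_mul_choose_add (j k r : ℕ) :
    (j + (k + r)).choose (k + r) * (k + r).choose k = (j + k).choose k * (j + k + r).choose r := by
  have h1 := Nat.add_choose_mul_factorial_mul_factorial j (k + r)
  have h2 := Nat.add_choose_mul_factorial_mul_factorial k r
  have h3 := Nat.add_choose_mul_factorial_mul_factorial j k
  have h4 := Nat.add_choose_mul_factorial_mul_factorial (j + k) r
  refine Nat.eq_of_mul_eq_mul_right (Nat.mul_pos j.factorial_pos
    (Nat.mul_pos k.factorial_pos r.factorial_pos)) ?_
  rw [← Nat.choose_symm_add] at h2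
  rw [add_assoc j k r] at h4 ⊢
  zify at *
  linear_combination ((j + (k + r)).choose (k + r) * j.factorial : ℤ) * h2 + h1 -
    ((j + (k + r)).choose r * r.factorial : ℤ) * h3 - h4

theorem choose_mul_choose_comm (j k r : ℕ) :
    (j + r).choose r * (j + r + k).choose k = (j + k).choose k * (j + k + r).choose r := by
  rw [← choose_mul_choose_add, ← choose_mul_choose_add, add_comm r k, Nat.choose_symm_add]

/-- The coefficient `A_t w` as a linear function of the field `A`. -/
def evalField (t : ℤ) (w : W) : FieldSpace W →ₗ[ℂ] W where
  toFun A := A.1 t w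
  map_add' _ _ := rfl
  map_smul' _ _ := rfl

variable {C : FieldSpace W} {Z : ℕ → FieldSpace W}

theorem commutator_apply (hZ : EventuallyZero Z) {k : ℤ}
    (hC : adField β k C = ∑ᶠ p : ℕ, zchoose k p • shiftField (k - p) (Z p)) (t : ℤ) (w : W) :
    β k (C.1 t w) = C.1 t (β k w) + binomSum k fun p => (Z p).1 (t + (k - p)) w := by
  have h := congrArg (evalField t w) hC
  rw [EventuallyZero.map_finsum (hZ.mono fun i h => by rw [h, map_zero, smul_zero])] at h
  rw [← sub_eq_iff_eq_add', ← adField_apply]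
  exact h

theorem exists_bound_field (A : FieldSpace W) (m : ℤ) (w : W) :
    ∃ n : ℕ, ∀ i : ℕ, n ≤ i → A.1 (m + i) w = 0 := eventuallyZero_field A m w

theorem eventuallyZero_left (A C : FieldSpace W) (m n : ℤ) (w : W) :
    EventuallyZero fun i : ℕ => A.1 (m - i) (C.1 (n + i) w) :=
  (eventuallyZero_field C n w).mono fun i h => by rw [h, map_zero]

/-- `Z p` plays the role of the field of `b_p c`, where `C` is the field of `c`. The annihilation
operators standing between `A` and `C` are moved to the right past `C`. For each `k` the commutators
assemble into `(z-w)^(-j-k-1) A(z) Z_k(w)`, expanded for `|z| > |w|`. -/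
theorem normalOrd_mul_apply (hβ : IsSmoothHeisenberg β) (hZ : EventuallyZero Z)
    (hC : ∀ k : ℤ, adField β k C = ∑ᶠ p : ℕ, zchoose k p • shiftField (k - p) (Z p))
    (A : FieldSpace W) (j : ℕ) (s t : ℤ) (w : W) :
    (normalOrd hβ j A).1 s (C.1 t w) =
      ∑ᶠ r : ℕ, ((j + r).choose r : ℂ) • β (-j - 1 - r) (A.1 (s + r) (C.1 t w)) +
      (-1 : ℂ) ^ j • (∑ᶠ r : ℕ, ((j + r).choose r : ℂ) • A.1 (s - j - 1 - r) (C.1 t (β r w)) +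
        ∑ᶠ k : ℕ, ((j + k).choose k : ℂ) • altSum (-j - k - 1) fun r : ℕ =>
          A.1 (s - j - 1 - k - r) ((Z k).1 (t + r) w)) := by
  have hZ' : ∃ n, ∀ k, n ≤ k → Z k = 0 := hZ
  rw [normalOrd_apply]
  congr 2
  have h0 := eventuallyZero_annihilation hβ A.1 j s
  have hs : EventuallyZero₂ fun r k : ℕ => A.1 (s - j - 1 - (k + r)) ((Z k).1 (t + r) w) := by
    refine (EventuallyZero₂.of_rows (f := fun k r : ℕ =>
      A.1 (s - j - 1 - (k + r)) ((Z k).1 (t + r) w)) ?_ fun k => ?_).swap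
    · obtain ⟨n, hn⟩ := hZ'
      exact ⟨n, fun i hi r => by rw [hn i hi]; exact map_zero _⟩
    · exact (eventuallyZero_field (Z k) t w).mono fun i h => by rw [h, map_zero]
  have h1 : EventuallyZero fun r : ℕ =>
      ((j + r).choose r : ℂ) • A.1 (s - j - 1 - r) (C.1 t (β r w)) :=
    (hβ.smooth w).mono fun i h => by rw [h, map_zero, map_zero, smul_zero]
  have hZr : ∀ r : ℕ, EventuallyZero fun p : ℕ => (Z p).1 (t + (r - p)) w := fun r =>
    hZ.mono fun p h => by rw [h]; rfl
  have h3 : EventuallyZero₂ fun r k : ℕ => ((j + r).choose r * r.choose k : ℂ) •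
      A.1 (s - j - 1 - r) ((Z k).1 (t + (r - k)) w) := by
    refine (EventuallyZero₂.of_rows (f := fun k r : ℕ => ((j + r).choose r * r.choose k : ℂ) •
      A.1 (s - j - 1 - r) ((Z k).1 (t + (r - k)) w)) ?_ fun k => ?_).swap
    · obtain ⟨n, hn⟩ := hZ'
      refine ⟨n, fun i hi r => ?_⟩
      rw [hn i hi]
      exact (congrArg _ (map_zero _)).trans (smul_zero _)
    · refine (eventuallyZero_field (Z k) (t - k) w).mono fun i h => ?_
      rw [show t + ((i : ℤ) - k) = t - k + i by ring, h, map_zero, smul_zero]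
  have e : ∀ r : ℕ, ((j + r).choose r : ℂ) • A.1 (s - j - 1 - r) (β r (C.1 t w)) =
      ((j + r).choose r : ℂ) • A.1 (s - j - 1 - r) (C.1 t (β r w)) +
      ∑ᶠ k : ℕ, ((j + r).choose r * r.choose k : ℂ) •
        A.1 (s - j - 1 - r) ((Z k).1 (t + (r - k)) w) := fun r => by
    rw [commutator_apply hZ (hC r), map_add, smul_add]
    congr 1
    rw [binomSum_map _ (hZr r), binomSum, (((hZr r).map _).smul _).smul_finsum]
    refine finsum_congr fun k => ?_
    rw [smul_smul, zchoose_natCast]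
  rw [finsum_congr e, h1.finsum_add (finsum_eventuallyZero h3), h3.finsum_comm]
  congr 1
  refine finsum_congr fun k => ?_
  -- The coefficient `(r choose k)` vanishes for `r < k`, so the sum over `r` may start at `k`.
  rw [finsum_shift k fun r hr => by simp [Nat.choose_eq_zero_of_lt hr], altSum,
    (((hs.swap.row k).mono fun r h => ?_).smul _).smul_finsum]
  · refine finsum_congr fun r => ?_
    rw [smul_smul, zchoose_neg (j + k) _ (by push_cast; ring), ← mul_assoc ((-1 : ℂ) ^ r),
      ← mul_pow, neg_one_mul, neg_neg, one_pow, one_mul]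
    congr 1
    · exact_mod_cast choose_mul_choose_add j k r
    · push_cast
      rw [show t + ((k : ℤ) + r - k) = t + r by ring, ← sub_sub]
  · rw [sub_sub, h]

/-- The mirror image: here the creation operators between `C` and `A` are moved to the left past
`C`. The commutators give the same power of `z - w`, now expanded for `|w| > |z|`. Writing it as a
power of `w - z` causes the sign `(-1)^(j+k+1)`. -/
theorem mul_normalOrd_apply (hβ : IsSmoothHeisenberg β) (hZ : EventuallyZero Z)
    (hC : ∀ k : ℤ, adField β k C = ∑ᶠ p : ℕ, zchoose k p • shiftField (k - p) (Z p))
    (A : FieldSpace W) (j : ℕ) (s t : ℤ) (w : W) :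
    C.1 t ((normalOrd hβ j A).1 s w) =
      ∑ᶠ r : ℕ, ((j + r).choose r : ℂ) • β (-j - 1 - r) (C.1 t (A.1 (s + r) w)) +
      (-1 : ℂ) ^ j • (∑ᶠ r : ℕ, ((j + r).choose r : ℂ) • C.1 t (A.1 (s - j - 1 - r) (β r w)) +
        ∑ᶠ k : ℕ, ((j + k).choose k : ℂ) • (-1 : ℂ) ^ (j + k + 1) • altSum (-j - k - 1)
          fun r : ℕ => (Z k).1 (t - j - 1 - k - r) (A.1 (s + r) w)) := by
  have hZ' : ∃ n, ∀ k, n ≤ k → Z k = 0 := hZ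
  have h1 := eventuallyZero_creation (β := β) A j s w
  have h2 := eventuallyZero_annihilation hβ A.1 j s w
  have hA := eventuallyZero_field A s w
  have hZr : ∀ (r : ℕ) (u : W), EventuallyZero fun p : ℕ =>
      (Z p).1 (t + (-j - 1 - r - p)) u := fun r u => hZ.mono fun p h => by rw [h]; rfl
  have h3 : EventuallyZero₂ fun r k : ℕ => ((j + r).choose r * (j + r + k).choose k : ℂ) •
      (-(-1 : ℂ) ^ k) • (Z k).1 (t - j - 1 - k - r) (A.1 (s + r) w) := by
    refine EventuallyZero₂.of_rows ?_ fun r => hZ.mono fun k h => ?_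
    · obtain ⟨n, hn⟩ := exists_bound_field A s w
      refine ⟨n, fun i hi r => ?_⟩
      rw [hn i hi, map_zero, smul_zero, smul_zero]
    · rw [h]
      exact (congrArg _ (smul_zero _)).trans (smul_zero _)
  have h4 : EventuallyZero fun r : ℕ =>
      ((j + r).choose r : ℂ) • β (-j - 1 - r) (C.1 t (A.1 (s + r) w)) :=
    hA.mono fun i h => by rw [h, map_zero, map_zero, smul_zero]
  have e : ∀ r : ℕ, C.1 t (((j + r).choose r : ℂ) • β (-j - 1 - r) (A.1 (s + r) w)) =
      ((j + r).choose r : ℂ) • β (-j - 1 - r) (C.1 t (A.1 (s + r) w)) +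
      ∑ᶠ k : ℕ, ((j + r).choose r * (j + r + k).choose k : ℂ) •
      (-(-1 : ℂ) ^ k) • (Z k).1 (t - j - 1 - k - r) (A.1 (s + r) w) := fun r => by
    rw [commutator_apply hZ (hC (-j - 1 - r)), smul_add, map_smul, add_assoc, left_eq_add,
      binomSum, ((hZr r _).smul _).smul_finsum, ← EventuallyZero.finsum_add]
    · refine (finsum_congr fun k => ?_).trans finsum_zero
      rw [zchoose_neg (j + r) _ (by push_cast; ring), smul_smul, smul_smul,
        show t + (-j - 1 - r - k : ℤ) = t - j - 1 - k - r by ring, ← add_smul]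
      convert zero_smul ℂ _
      ring
    · exact ((hZr r _).smul _).smul _
    · exact h3.row r
  have e2 : ∀ r : ℕ, C.1 t (((j + r).choose r : ℂ) • A.1 (s - j - 1 - r) (β r w)) =
      ((j + r).choose r : ℂ) • C.1 t (A.1 (s - j - 1 - r) (β r w)) := fun r => map_smul _ _ _
  rw [normalOrd_apply, map_add, map_smul, h1.map_finsum, h2.map_finsum, finsum_congr e,
    finsum_congr e2, h4.finsum_add (finsum_eventuallyZero h3), h3.finsum_comm, add_assoc,
    smul_add, add_comm (∑ᶠ k, ∑ᶠ r, _)]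
  congr 2
  rw [EventuallyZero.smul_finsum]
  · refine finsum_congr fun k => ?_
    have hk : EventuallyZero fun r : ℕ => (Z k).1 (t - j - 1 - k - r) (A.1 (s + r) w) :=
      hA.mono fun i h => by rw [h, map_zero]
    rw [altSum, (hk.smul _).smul_finsum, ((hk.smul _).smul _).smul_finsum,
      (((hk.smul _).smul _).smul _).smul_finsum]
    refine finsum_congr fun r => ?_
    simp only [smul_smul]
    rw [zchoose_neg (j + k) _ (by push_cast; ring)]
    congr 1
    have hc := congrArg (Nat.cast (R := ℂ)) (choose_mul_choose_comm j k r)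
    push_cast at hc
    have hj : ((-1 : ℂ) ^ j) * (-1) ^ j = 1 := by rw [← mul_pow]; simp
    have hr : ((-1 : ℂ) ^ r) * (-1) ^ r = 1 := by rw [← mul_pow]; simp
    rw [hc, pow_succ, pow_add]
    linear_combination (-(-1) ^ k * ((j + k).choose k * (j + k + r).choose r : ℂ)) * (-hj - (-1) ^ j * (-1) ^ j * hr)
  · refine hZ.mono fun k h => ?_
    rw [h]
    simp [altSum]

/-- Recursion for the coefficients of `(z - w)^l :∂^j b(z) A(z): C(w) / j!`. -/
theorem opProd_normalOrd (hβ : IsSmoothHeisenberg β) (hZ : EventuallyZero Z)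
    (hC : ∀ k : ℤ, adField β k C = ∑ᶠ p : ℕ, zchoose k p • shiftField (k - p) (Z p))
    (A : FieldSpace W) (j : ℕ) (l m n : ℤ) (w : W) :
    opProd (normalOrd hβ j A) C l m n w =
      ∑ᶠ i : ℕ, ((j + i).choose i : ℂ) • β (-j - 1 - i) (opProd A C l (m + i) n w) +
      (-1 : ℂ) ^ j • (∑ᶠ i : ℕ, ((j + i).choose i : ℂ) • opProd A C l (m - j - 1 - i) n (β i w) +
        ∑ᶠ k : ℕ, ((j + k).choose k : ℂ) • opProd A (Z k) (l - j - k - 1) m n w) := by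
  have hZ' : ∃ n, ∀ k, n ≤ k → Z k = 0 := hZ
  have f1 : EventuallyZero₂ fun i r : ℕ => ((j + r).choose r : ℂ) •
      β (-j - 1 - r) (A.1 (m + l - i + r) (C.1 (n + i) w)) := by
    refine EventuallyZero₂.of_rows ?_ fun i => eventuallyZero_creation A j _ _
    obtain ⟨N, hN⟩ := exists_bound_field C n w
    refine ⟨N, fun i hi r => ?_⟩
    rw [hN i hi, map_zero, map_zero, smul_zero]
  have f2 : EventuallyZero₂ fun i r : ℕ => ((j + r).choose r : ℂ) •
      A.1 (m + l - i - j - 1 - r) (C.1 (n + i) (β r w)) := by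
    refine (EventuallyZero₂.of_rows (f := fun r i : ℕ => ((j + r).choose r : ℂ) •
      A.1 (m + l - i - j - 1 - r) (C.1 (n + i) (β r w))) ?_ fun i => ?_).swap
    · obtain ⟨N, hN⟩ := hβ.exists_bound w
      refine ⟨N, fun i hi r => ?_⟩
      rw [hN i hi, map_zero, map_zero, smul_zero]
    · exact (eventuallyZero_field C n _).mono fun i h => by rw [h, map_zero, smul_zero]
  have f3 : EventuallyZero₂ fun i k : ℕ => ((j + k).choose k : ℂ) • altSum (-j - k - 1)
      fun r : ℕ => A.1 (m + l - i - j - 1 - k - r) ((Z k).1 (n + i + r) w) := by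
    refine (EventuallyZero₂.of_rows (f := fun k i : ℕ => ((j + k).choose k : ℂ) •
      altSum (-j - k - 1) fun r : ℕ => A.1 (m + l - i - j - 1 - k - r) ((Z k).1 (n + i + r) w))
      ?_ fun k => ?_).swap
    · obtain ⟨N, hN⟩ := hZ'
      refine ⟨N, fun i hi r => ?_⟩
      rw [hN i hi]
      simp [altSum]
    · obtain ⟨N, hN⟩ := exists_bound_field (Z k) n w
      refine ⟨N, fun i hi => ?_⟩
      have h0 : ∀ r : ℕ, (Z k).1 (n + i + r) w = 0 := fun r => by
        rw [add_assoc, ← Nat.cast_add]; exact hN _ (by omega)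
      simp [altSum, h0]
  rw [opProd, funext fun i : ℕ => normalOrd_mul_apply hβ hZ hC A j (m + l - i) (n + i) w,
    altSum_add _ (finsum_eventuallyZero f1), altSum_smul, altSum_add _ (finsum_eventuallyZero f2)
      (finsum_eventuallyZero f3), altSum_finsum _ f1, altSum_finsum _ f2, altSum_finsum _ f3]
  · congr 1
    · refine finsum_congr fun r => ?_
      have hr : EventuallyZero fun i : ℕ => A.1 (m + r + l - i) (C.1 (n + i) w) :=
        eventuallyZero_left A C _ n w
      rw [opProd, altSum_map _ hr, ← altSum_smul _ (hr.map _)]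
      congr 1
      ext i
      rw [show m + l - i + r = m + r + l - i by ring]
    · congr 2
      · refine finsum_congr fun r => ?_
        rw [opProd, ← altSum_smul _ (eventuallyZero_left A C _ n (β r w))]
        congr 1
        ext i
        rw [show m + l - i - j - 1 - r = m - j - 1 - r + l - i by ring]
      · refine finsum_congr fun k => ?_
        have hk : EventuallyZero fun q : ℕ =>
            A.1 (m + (l - j - k - 1) - q) ((Z k).1 (n + q) w) := eventuallyZero_left A _ _ n w
        -- The factor `(z-w)^(-j-k-1)` from the commutators is absorbed into `(z-w)^l`.
        have hk' := altSum_altSum l (-j - k - 1) hk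
        rw [show l + (-j - k - 1) = l - j - k - 1 by ring] at hk'
        rw [opProd, ← hk', ← altSum_smul]
        · congr 1
          ext i
          congr 2
          ext r
          push_cast
          rw [show m + l - i - j - 1 - k - r = m + (l - j - k - 1) - (i + r) by ring, add_assoc]
        · obtain ⟨N, hN⟩ := hk
          refine ⟨N, fun i hi => ?_⟩
          have h0 := fun r : ℕ => hN (i + r) (by omega)
          simp only [altSum, h0, smul_zero, finsum_zero]
  · exact (finsum_eventuallyZero f2).add (finsum_eventuallyZero f3)
  · exact ((finsum_eventuallyZero f2).add (finsum_eventuallyZero f3)).mono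
      fun i h => by rw [h, smul_zero]

theorem eventuallyZero_right (A C : FieldSpace W) (m n : ℤ) (w : W) :
    EventuallyZero fun i : ℕ => C.1 (n - i) (A.1 (m + i) w) := eventuallyZero_left C A n m w

/-- Recursion for the coefficients of `(w - z)^l C(w) :∂^j b(z) A(z): / j!`. -/
theorem opProdRev_normalOrd (hβ : IsSmoothHeisenberg β) (hZ : EventuallyZero Z)
    (hC : ∀ k : ℤ, adField β k C = ∑ᶠ p : ℕ, zchoose k p • shiftField (k - p) (Z p))
    (A : FieldSpace W) (j : ℕ) (l m n : ℤ) (w : W) :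
    opProdRev (normalOrd hβ j A) C l m n w =
      ∑ᶠ i : ℕ, ((j + i).choose i : ℂ) • β (-j - 1 - i) (opProdRev A C l (m + i) n w) +
      (-1 : ℂ) ^ j • (∑ᶠ i : ℕ, ((j + i).choose i : ℂ) •
          opProdRev A C l (m - j - 1 - i) n (β i w) +
        ∑ᶠ k : ℕ, ((j + k).choose k : ℂ) • (-1 : ℂ) ^ (j + k + 1) •
          opProdRev A (Z k) (l - j - k - 1) m n w) := by
  have hZ' : ∃ n, ∀ k, n ≤ k → Z k = 0 := hZ
  have f1 : EventuallyZero₂ fun i r : ℕ => ((j + r).choose r : ℂ) •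
      β (-j - 1 - r) (C.1 (n + l - i) (A.1 (m + i + r) w)) := by
    obtain ⟨N, hN⟩ := exists_bound_field A m w
    refine ⟨N, fun i r h => ?_⟩
    have := hN (i + r) (by omega)
    rw [Nat.cast_add, ← add_assoc] at this
    beta_reduce
    rw [this, map_zero, map_zero, smul_zero]
  have f2 : EventuallyZero₂ fun i r : ℕ => ((j + r).choose r : ℂ) •
      C.1 (n + l - i) (A.1 (m + i - j - 1 - r) (β r w)) := by
    refine (EventuallyZero₂.of_rows (f := fun r i : ℕ => ((j + r).choose r : ℂ) •
      C.1 (n + l - i) (A.1 (m + i - j - 1 - r) (β r w))) ?_ fun r => ?_).swap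
    · obtain ⟨N, hN⟩ := hβ.exists_bound w
      refine ⟨N, fun i hi r => ?_⟩
      rw [hN i hi, map_zero, map_zero, smul_zero]
    · refine (eventuallyZero_field A (m - j - 1 - r) (β r w)).mono fun i h => ?_
      rw [show m + i - j - 1 - r = m - j - 1 - r + i by ring, h, map_zero, smul_zero]
  have f3 : EventuallyZero₂ fun i k : ℕ => ((j + k).choose k : ℂ) • (-1 : ℂ) ^ (j + k + 1) •
      altSum (-j - k - 1) fun r : ℕ => (Z k).1 (n + l - i - j - 1 - k - r) (A.1 (m + i + r) w) := by
    refine EventuallyZero₂.of_rows ?_ fun i => ?_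
    · obtain ⟨N, hN⟩ := exists_bound_field A m w
      refine ⟨N, fun i hi k => ?_⟩
      have h0 : ∀ r : ℕ, A.1 (m + i + r) w = 0 := fun r => by
        rw [add_assoc, ← Nat.cast_add]; exact hN _ (by omega)
      simp [altSum, h0]
    · obtain ⟨N, hN⟩ := hZ'
      refine ⟨N, fun k hk => ?_⟩
      beta_reduce
      rw [hN k hk]
      simp [altSum]
  rw [opProdRev, funext fun i : ℕ => mul_normalOrd_apply hβ hZ hC A j (m + i) (n + l - i) w,
    altSum_add _ (finsum_eventuallyZero f1), altSum_smul, altSum_add _ (finsum_eventuallyZero f2)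
      (finsum_eventuallyZero f3), altSum_finsum _ f1, altSum_finsum _ f2, altSum_finsum _ f3]
  · congr 1
    · refine finsum_congr fun r => ?_
      have hr : EventuallyZero fun i : ℕ => C.1 (n + l - i) (A.1 (m + r + i) w) :=
        eventuallyZero_right A C _ _ w
      rw [opProdRev, altSum_map _ hr, ← altSum_smul _ (hr.map _)]
      congr 1
      ext i
      rw [add_right_comm]
    · congr 2
      · refine finsum_congr fun r => ?_
        rw [opProdRev, ← altSum_smul _ (eventuallyZero_right A C _ _ (β r w))]
        congr 1
        ext i
        rw [show m + i - j - 1 - r = m - j - 1 - r + i by ring]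
      · refine finsum_congr fun k => ?_
        have hk : EventuallyZero fun q : ℕ =>
            (Z k).1 (n + (l - j - k - 1) - q) (A.1 (m + q) w) := eventuallyZero_right A _ _ _ w
        have hk' := altSum_altSum l (-j - k - 1) hk
        rw [show l + (-j - k - 1) = l - j - k - 1 by ring] at hk'
        have hk2 : EventuallyZero fun i : ℕ => altSum (-j - k - 1) fun r : ℕ =>
            (Z k).1 (n + (l - j - k - 1) - (i + r : ℕ)) (A.1 (m + (i + r : ℕ)) w) := by
          obtain ⟨N, hN⟩ := hk
          refine ⟨N, fun i hi => ?_⟩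
          have h0 := fun r : ℕ => hN (i + r) (by omega)
          simp only [altSum, h0, smul_zero, finsum_zero]
        rw [opProdRev, ← hk', ← altSum_smul _ hk2, ← altSum_smul _ (hk2.smul _)]
        congr 1
        ext i
        congr 3
        ext r
        push_cast
        rw [show n + l - i - j - 1 - k - r = n + (l - j - k - 1) - (i + r) by ring, add_assoc]
  · exact (finsum_eventuallyZero f2).add (finsum_eventuallyZero f3)
  · exact ((finsum_eventuallyZero f2).add (finsum_eventuallyZero f3)).mono
      fun i h => by rw [h, smul_zero]

end Products

/-! ### Expansions in `z - w` -/

section Iterate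

variable {W : Type*} [AddCommGroup W] [Module ℂ W] {β : ℤ → Module.End ℂ W}

/-- The coefficients of `∑ S_l(w) (z - w)^(-l-1)`, expanded in `z - w`. -/
def opIter (S : ℤ → FieldSpace W) (l m n : ℤ) (w : W) : W :=
  binomSum m fun p => (S (l + p)).1 (m + n - p) w

/-- For fixed `q = i + r` the coefficients `(m choose p) (q choose i)` combine by Vandermonde to
`(m+q choose p+i)`. In `opIter_normalOrd` this raises `m` by the index of the creation operator. -/
theorem binomSum_finsum_finsum (m : ℤ) {M : Type*} [AddCommGroup M] [Module ℂ M]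
    {G : ℕ → ℕ → M} (hG : EventuallyZero₂ G) :
    binomSum m (fun p => ∑ᶠ i : ℕ, ∑ᶠ r : ℕ, ((i + r).choose i : ℂ) • G (p + i) (i + r)) =
      ∑ᶠ q : ℕ, binomSum (m + q) fun p => G p q := by
  have h1 : ∀ p, EventuallyZero₂ fun i q : ℕ => (q.choose i : ℂ) • G (p + i) q := fun p =>
    (hG.shift_left p).smul fun i q => (q.choose i : ℂ)
  have e : ∀ p, ∑ᶠ i : ℕ, ∑ᶠ r : ℕ, ((i + r).choose i : ℂ) • G (p + i) (i + r) =
      ∑ᶠ q : ℕ, binomSum q fun i => G (p + i) q := fun p => by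
    rw [show (∑ᶠ q : ℕ, binomSum q fun i => G (p + i) q) =
      ∑ᶠ q : ℕ, ∑ᶠ i : ℕ, (q.choose i : ℂ) • G (p + i) q from
        finsum_congr fun q => finsum_congr fun i => by rw [zchoose_natCast], ← (h1 p).finsum_comm]
    refine finsum_congr fun i => (finsum_shift (f := fun q => (q.choose i : ℂ) • G (p + i) q) i
      fun q hq => ?_).symm
    rw [Nat.choose_eq_zero_of_lt hq, Nat.cast_zero, zero_smul]
  have h2 : EventuallyZero₂ fun p q : ℕ => binomSum q fun i => G (p + i) q := by
    obtain ⟨n, hn⟩ := hG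
    refine ⟨n, fun p q h => ?_⟩
    have h0 : ∀ i, G (p + i) q = 0 := fun i => hn _ _ (h.imp (fun h => by omega) id)
    simp [binomSum, h0]
  rw [funext e, binomSum_finsum m h2]
  exact finsum_congr fun q => binomSum_binomSum m q (hG.swap.row q)

/-- Recursion for `opIter`. -/
theorem opIter_normalOrd (hβ : IsSmoothHeisenberg β) (j : ℕ) {S S₁ : ℤ → FieldSpace W}
    {S₂ : ℕ → ℤ → FieldSpace W} (h₁ : ∀ l, EventuallyZero fun p : ℕ => S₁ (l + p))
    (h₂ : ∀ i l, EventuallyZero fun p : ℕ => S₂ i (l + p)) (h₂' : EventuallyZero S₂)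
    (hS : ∀ l, S l = ∑ᶠ i : ℕ, ((j + i).choose i : ℂ) • normalOrd hβ (j + i) (S₁ (l + i)) +
      (-1 : ℂ) ^ j • ∑ᶠ i : ℕ, ((j + i).choose i : ℂ) • S₂ i (l - j - 1 - i))
    (l m n : ℤ) (w : W) :
    opIter S l m n w =
      ∑ᶠ i : ℕ, ((j + i).choose i : ℂ) • β (-j - 1 - i) (opIter S₁ l (m + i) n w) +
      (-1 : ℂ) ^ j • (∑ᶠ i : ℕ, ((j + i).choose i : ℂ) • opIter S₁ l (m - j - 1 - i) n (β i w) +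
        ∑ᶠ k : ℕ, ((j + k).choose k : ℂ) • opIter (S₂ k) (l - j - k - 1) m n w) := by
  have b₁ : ∃ N : ℕ, ∀ p : ℕ, N ≤ p → S₁ (l + p) = 0 := h₁ l
  have b₂ : ∃ N : ℕ, ∀ i, N ≤ i → S₂ i = 0 := h₂'
  have hG : EventuallyZero₂ fun p q : ℕ =>
      ((j + q).choose q : ℂ) • β (-j - 1 - q) ((S₁ (l + p)).1 (m + n - p + q) w) := by
    refine EventuallyZero₂.of_rows ?_ fun p => eventuallyZero_creation _ j _ w
    obtain ⟨N, hN⟩ := b₁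
    refine ⟨N, fun p hp q => ?_⟩
    rw [hN p hp]
    exact (congrArg _ (map_zero _)).trans (smul_zero _)
  have hH : EventuallyZero₂ fun p r : ℕ =>
      ((j + r).choose r : ℂ) • (S₁ (l + p)).1 (m + n - p - j - 1 - r) (β r w) := by
    obtain ⟨N, hN⟩ := b₁
    obtain ⟨N', hN'⟩ := hβ.exists_bound w
    refine ⟨max N N', fun p r h => ?_⟩
    rcases h with h | h
    · beta_reduce
      rw [hN p (by omega)]
      exact smul_zero _
    · beta_reduce
      rw [hN' r (by omega), map_zero, smul_zero]
  have hK : EventuallyZero₂ fun p i : ℕ =>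
      ((j + i).choose i : ℂ) • (S₂ i (l + p - j - 1 - i)).1 (m + n - p) w := by
    refine (EventuallyZero₂.of_rows (f := fun i p : ℕ =>
      ((j + i).choose i : ℂ) • (S₂ i (l + p - j - 1 - i)).1 (m + n - p) w) ?_ fun i => ?_).swap
    · obtain ⟨N, hN⟩ := b₂
      refine ⟨N, fun i hi p => ?_⟩
      rw [hN i hi]
      exact smul_zero _
    · refine (h₂ i (l - j - 1 - i)).mono fun p h => ?_
      rw [show l + p - j - 1 - i = l - j - 1 - i + p by ring, h]
      exact smul_zero _
  have h3 : ∀ p : ℕ, EventuallyZero₂ fun i r : ℕ => ((i + r).choose i : ℂ) •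
      (((j + (i + r)).choose (i + r) : ℂ) •
        β (-j - 1 - (i + r : ℕ)) ((S₁ (l + (p + i : ℕ))).1 (m + n - (p + i : ℕ) + (i + r : ℕ)) w)) :=
    fun p => by
      obtain ⟨N, hN⟩ := hG
      refine ⟨N, fun i r h => ?_⟩
      have := hN (p + i) (i + r) (by omega)
      beta_reduce at this ⊢
      rw [this, smul_zero]
  have h4 : ∀ p : ℕ, EventuallyZero₂ fun i r : ℕ => zchoose (-j - r - 1) i •
      (((j + r).choose r : ℂ) •
        (S₁ (l + (p + i : ℕ))).1 (m + n - (p + i : ℕ) - j - 1 - r) (β r w)) := fun p =>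
    (hH.shift_left p).smul fun i r => zchoose (-j - r - 1) i
  -- The operators `normalOrd hβ (j + i)` correspond to the Taylor coefficients of `∂^j b(z) / j!`
  -- at `w`. Their creation halves will be grouped by `q = i + r`, their annihilation halves by `r`.
  -- The sum over `i` then carries a binomial with top `i + r` or `-j - r - 1`, which Vandermonde
  -- merges with the outer `(m choose p)`.
  have e : ∀ p : ℕ, (S (l + p)).1 (m + n - p) w =
      ∑ᶠ i : ℕ, ∑ᶠ r : ℕ, ((i + r).choose i : ℂ) • (((j + (i + r)).choose (i + r) : ℂ) •
        β (-j - 1 - (i + r : ℕ)) ((S₁ (l + (p + i : ℕ))).1 (m + n - (p + i : ℕ) + (i + r : ℕ)) w)) +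
      (-1 : ℂ) ^ j • (∑ᶠ r : ℕ, binomSum (-j - r - 1) (fun i : ℕ => (((j + r).choose r : ℂ) •
        (S₁ (l + (p + i : ℕ))).1 (m + n - (p + i : ℕ) - j - 1 - r) (β r w))) +
      ∑ᶠ i : ℕ, ((j + i).choose i : ℂ) • (S₂ i (l + p - j - 1 - i)).1 (m + n - p) w) := fun p => by
    have q1 : EventuallyZero fun i : ℕ =>
        ((j + i).choose i : ℂ) • normalOrd hβ (j + i) (S₁ (l + p + i)) :=
      (h₁ (l + p)).mono fun i h => by rw [h, map_zero, smul_zero]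
    have q2 : EventuallyZero fun i : ℕ => ((j + i).choose i : ℂ) • S₂ i (l + p - j - 1 - i) :=
      h₂'.mono fun i h => by rw [h]; exact smul_zero _
    have hS' := congrArg (evalField (m + n - p) w) (hS (l + p))
    rw [map_add, map_smul, q1.map_finsum, q2.map_finsum] at hS'
    refine hS'.trans ?_
    rw [smul_add, ← add_assoc]
    congr 1
    rw [show (∑ᶠ r : ℕ, binomSum (-j - r - 1) (fun i : ℕ => (((j + r).choose r : ℂ) •
        (S₁ (l + (p + i : ℕ))).1 (m + n - (p + i : ℕ) - j - 1 - r) (β r w)))) =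
      ∑ᶠ i : ℕ, ∑ᶠ r : ℕ, zchoose (-j - r - 1) i • (((j + r).choose r : ℂ) •
        (S₁ (l + (p + i : ℕ))).1 (m + n - (p + i : ℕ) - j - 1 - r) (β r w)) from
        (h4 p).finsum_comm.symm, (finsum_eventuallyZero (h4 p)).smul_finsum,
      ← (finsum_eventuallyZero (h3 p)).finsum_add ((finsum_eventuallyZero (h4 p)).mono
        fun i h => by rw [h, smul_zero])]
    refine finsum_congr fun i => ?_
    change ((j + i).choose i : ℂ) • (normalOrd hβ (j + i) (S₁ (l + p + i))).1 (m + n - p) w = _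
    have z1 := eventuallyZero_creation (β := β) (S₁ (l + p + i)) (j + i) (m + n - p) w
    have z2 := eventuallyZero_annihilation hβ (S₁ (l + p + i)).1 (j + i) (m + n - p) w
    rw [normalOrd_apply, smul_add, z1.smul_finsum, smul_smul, z2.smul_finsum,
      ((h4 p).row i).smul_finsum]
    congr 1
    · refine finsum_congr fun r => ?_
      rw [smul_smul, smul_smul]
      congr 1
      · have := choose_mul_choose_add j i r
        rw [mul_comm ((i + r).choose i : ℂ)]
        exact_mod_cast this.symm
      · push_cast
        rw [show (-(j + i) - 1 - r : ℤ) = -j - 1 - (i + r) by ring, ← add_assoc l,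
          show m + n - p + r = m + n - (p + i) + (i + r) by ring]
    · refine finsum_congr fun r => ?_
      rw [smul_smul, smul_smul, smul_smul]
      congr 1
      · have := congrArg (Nat.cast (R := ℂ)) (choose_mul_choose_comm j r i)
        push_cast at this
        rw [zchoose_neg (j + r) _ (by push_cast; ring), pow_add]
        linear_combination ((-1) ^ j * (-1) ^ i) * this
      · push_cast
        rw [← add_assoc l, show m + n - p - (j + i) - 1 - r = m + n - (p + i) - j - 1 - r by ring]
  have v1 : EventuallyZero fun p : ℕ => ∑ᶠ i : ℕ, ∑ᶠ r : ℕ, ((i + r).choose i : ℂ) •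
      (((j + (i + r)).choose (i + r) : ℂ) • β (-j - 1 - (i + r : ℕ))
        ((S₁ (l + (p + i : ℕ))).1 (m + n - (p + i : ℕ) + (i + r : ℕ)) w)) := by
    obtain ⟨N, hN⟩ := b₁
    refine ⟨N, fun p hp => ?_⟩
    have : ∀ i : ℕ, S₁ (l + (p + i : ℕ)) = 0 := fun i => hN _ (by omega)
    refine (finsum_congr fun i => (finsum_congr fun r => ?_).trans finsum_zero).trans finsum_zero
    rw [this]
    simp
  have v2 : EventuallyZero₂ fun p r : ℕ => binomSum (-j - r - 1) fun i : ℕ =>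
      (((j + r).choose r : ℂ) •
        (S₁ (l + (p + i : ℕ))).1 (m + n - (p + i : ℕ) - j - 1 - r) (β r w)) := by
    obtain ⟨N, hN⟩ := hH
    refine ⟨N, fun p r h => ?_⟩
    have h0 := fun i : ℕ => hN (p + i) r (h.imp (fun h => by omega) id)
    simp only [binomSum, h0, smul_zero, finsum_zero]
  rw [opIter, funext e, binomSum_add _ v1, binomSum_smul, binomSum_add _ (finsum_eventuallyZero v2)
    (finsum_eventuallyZero hK), binomSum_finsum_finsum m hG, binomSum_finsum m v2,
    binomSum_finsum m hK]
  · congr 1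
    · refine finsum_congr fun q => ?_
      have hq : EventuallyZero fun p : ℕ => (S₁ (l + p)).1 (m + q + n - p) w :=
        (h₁ l).mono fun p h => by rw [h]; rfl
      rw [opIter, binomSum_map _ hq, ← binomSum_smul _ (hq.map _)]
      congr 1
      ext p
      rw [show m + n - p + q = m + q + n - p by ring]
    · congr 2
      · refine finsum_congr fun r => ?_
        have hr : EventuallyZero fun p : ℕ => (S₁ (l + p)).1 (m - j - 1 - r + n - p) (β r w) :=
          (h₁ l).mono fun p h => by rw [h]; rfl
        have := binomSum_binomSum m (-j - r - 1) (hr.smul fun _ => ((j + r).choose r : ℂ))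
        rw [opIter, ← binomSum_smul _ hr, show m - j - 1 - r = m + (-j - r - 1) by ring] at *
        rw [← this]
        congr 1
        ext p
        congr 1
        ext i
        push_cast
        rw [show m + n - (p + i) - j - 1 - r = m + (-j - r - 1) + n - (p + i) by ring]
      · refine finsum_congr fun k => ?_
        have hk : EventuallyZero fun p : ℕ => (S₂ k (l - j - k - 1 + p)).1 (m + n - p) w :=
          (h₂ k _).mono fun p h => by rw [h]; rfl
        rw [opIter, ← binomSum_smul _ hk]
        congr 1
        ext p
        rw [show l + p - j - 1 - k = l - j - k - 1 + p by ring]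
  · exact (finsum_eventuallyZero v2).add (finsum_eventuallyZero hK)
  · exact ((finsum_eventuallyZero v2).add (finsum_eventuallyZero hK)).mono
      fun i h => by rw [h, smul_zero]

/-! ## The Jacobi identity -/

theorem altSum_single (l : ℤ) {f : ℕ → W} (k : ℕ) (h : ∀ i, i ≠ k → f i = 0) :
    altSum l f = ((-1 : ℂ) ^ k * zchoose l k) • f k :=
  finsum_eq_single _ k fun i hi => by rw [h i hi, smul_zero]

theorem binomSum_single (l : ℤ) {f : ℕ → W} (k : ℕ) (h : ∀ i, i ≠ k → f i = 0) :
    binomSum l f = zchoose l k • f k :=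
  finsum_eq_single _ k fun i hi => by rw [h i hi, smul_zero]

theorem altSum_zero (l : ℤ) {f : ℕ → W} (h : ∀ i, f i = 0) : altSum l f = 0 :=
  (finsum_congr fun i => by rw [h i, smul_zero]).trans finsum_zero

theorem binomSum_zero (l : ℤ) {f : ℕ → W} (h : ∀ i, f i = 0) : binomSum l f = 0 :=
  (finsum_congr fun i => by rw [h i, smul_zero]).trans finsum_zero

theorem idField_apply (m : ℤ) (w : W) :
    (idField W).1 m w = if m = -1 then w else 0 := by
  rw [idField]
  dsimp only
  split_ifs <;> rfl

theorem neg_one_zpow_natCast_sub (a b : ℕ) : (-1 : ℂ) ^ ((a : ℤ) - b) = (-1) ^ a * (-1) ^ b := by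
  rw [zpow_sub₀ (by norm_num), zpow_natCast, zpow_natCast, div_eq_mul_inv, ← inv_pow]
  norm_num

/-- The Jacobi identity for the vacuum as first state. The identity field selects one term from each
sum: the first contributes only for `m + l + 1 ≥ 0`, the second only for `m < 0`, the right-hand
side only for `l < 0`. According to the signs of `l` and `m` the claim is a symmetry, a negation or
a vanishing of binomial coefficients. -/
theorem opProd_idField (C : FieldSpace W) (l m n : ℤ) (w : W) :
    opProd (idField W) C l m n w - (-1 : ℂ) ^ l • opProdRev (idField W) C l m n w =
      binomSum m fun p : ℕ => if l + p = -1 then C.1 (m + n - p) w else 0 := by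
  have e1 : ∀ k : ℕ, m + l + 1 = k → opProd (idField W) C l m n w =
      ((-1 : ℂ) ^ k * zchoose l k) • C.1 (m + n + l + 1) w := fun k hk => by
    rw [opProd, altSum_single l k, idField_apply, if_pos (by omega),
      show n + (k : ℤ) = m + n + l + 1 by omega]
    intro i hi
    rw [idField_apply, if_neg (by omega)]
  have e1' : m + l + 1 < 0 → opProd (idField W) C l m n w = 0 := fun h => by
    rw [opProd, altSum_zero]
    intro i
    rw [idField_apply, if_neg (by omega)]
  have e2 : ∀ k : ℕ, m = -k - 1 → opProdRev (idField W) C l m n w =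
      ((-1 : ℂ) ^ k * zchoose l k) • C.1 (m + n + l + 1) w := fun k hk => by
    rw [opProdRev, altSum_single l k, idField_apply, if_pos (by omega),
      show n + l - (k : ℤ) = m + n + l + 1 by omega]
    intro i hi
    rw [idField_apply, if_neg (by omega), map_zero]
  have e2' : 0 ≤ m → opProdRev (idField W) C l m n w = 0 := fun h => by
    rw [opProdRev, altSum_zero]
    intro i
    rw [idField_apply, if_neg (by omega), map_zero]
  have e3 : ∀ k : ℕ, l = -k - 1 →
      (binomSum m fun p : ℕ => if l + p = -1 then C.1 (m + n - p) w else 0) =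
      zchoose m k • C.1 (m + n + l + 1) w := fun k hk => by
    rw [binomSum_single m k, if_pos (by omega), show m + n - (k : ℤ) = m + n + l + 1 by omega]
    intro i hi
    rw [if_neg (by omega)]
  have e3' : 0 ≤ l → (binomSum m fun p : ℕ => if l + p = -1 then C.1 (m + n - p) w else 0) = 0 :=
    fun h => by
      rw [binomSum_zero]
      intro i
      rw [if_neg (by omega)]
  rcases le_or_gt 0 l with hl | hl <;> rcases le_or_gt 0 m with hm | hm
  · obtain ⟨l, rfl⟩ := Int.eq_ofNat_of_zero_le hl
    obtain ⟨m, rfl⟩ := Int.eq_ofNat_of_zero_le hm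
    rw [e1 (m + l + 1) (by push_cast; ring), e2' hm, e3' hl, zchoose_natCast,
      Nat.choose_eq_zero_of_lt (by omega)]
    simp
  · obtain ⟨l, rfl⟩ := Int.eq_ofNat_of_zero_le hl
    obtain ⟨M, hM⟩ : ∃ M : ℕ, m = -M - 1 := ⟨(-m - 1).toNat, by omega⟩
    rw [e2 M hM, e3' hl]
    by_cases h : M ≤ l
    · obtain ⟨k, rfl⟩ := Nat.exists_eq_add_of_le h
      rw [e1 k (by push_cast; omega), smul_smul, ← sub_smul, zchoose_natCast, zchoose_natCast,
        zpow_natCast, Nat.choose_symm_add]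
      have : ((-1 : ℂ) ^ M) * (-1) ^ M = 1 := by rw [← mul_pow]; simp
      convert zero_smul ℂ _
      rw [pow_add]
      linear_combination (-(-1) ^ k * ((M + k).choose k : ℂ)) * this
    · rw [e1' (by omega), zchoose_natCast, Nat.choose_eq_zero_of_lt (by omega)]
      simp
  · obtain ⟨m, rfl⟩ := Int.eq_ofNat_of_zero_le hm
    obtain ⟨L, hL⟩ : ∃ L : ℕ, l = -L - 1 := ⟨(-l - 1).toNat, by omega⟩
    rw [e2' hm, e3 L hL, smul_zero, sub_zero, zchoose_natCast]
    by_cases h : L ≤ m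
    · obtain ⟨k, rfl⟩ := Nat.exists_eq_add_of_le h
      rw [e1 k (by push_cast; omega), zchoose_neg L l hL, ← mul_assoc, ← mul_pow,
        Nat.choose_symm_add]
      simp
    · rw [e1' (by omega), Nat.choose_eq_zero_of_lt (by omega)]
      simp
  · obtain ⟨L, hL⟩ : ∃ L : ℕ, l = -L - 1 := ⟨(-l - 1).toNat, by omega⟩
    obtain ⟨M, hM⟩ : ∃ M : ℕ, m = -M - 1 := ⟨(-m - 1).toNat, by omega⟩
    rw [e1' (by omega), e2 M hM, e3 L hL, zchoose_neg L l hL, zchoose_neg M m hM, zero_sub,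
      smul_smul, ← neg_smul]
    congr 1
    have h1 : (-1 : ℂ) ^ l = -(-1) ^ L := by
      rw [hL, show (-L - 1 : ℤ) = ((0 : ℕ) : ℤ) - ((L + 1 : ℕ) : ℤ) by push_cast; ring,
        neg_one_zpow_natCast_sub]
      ring
    have h2 : ((-1 : ℂ) ^ M) * (-1) ^ M = 1 := by rw [← mul_pow]; simp
    rw [h1, add_comm M L, Nat.choose_symm_add]
    linear_combination ((-1) ^ L * ((L + M).choose M : ℂ)) * h2

theorem opProd_add (A B C : FieldSpace W) (l m n : ℤ) (w : W) :
    opProd (A + B) C l m n w = opProd A C l m n w + opProd B C l m n w :=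
  altSum_add l (eventuallyZero_left A C _ n w) (eventuallyZero_left B C _ n w)

theorem opProdRev_add (A B C : FieldSpace W) (l m n : ℤ) (w : W) :
    opProdRev (A + B) C l m n w = opProdRev A C l m n w + opProdRev B C l m n w := by
  rw [opProdRev, opProdRev, opProdRev, ← altSum_add l (eventuallyZero_right A C _ _ w)
    (eventuallyZero_right B C _ _ w)]
  congr 1
  ext i
  exact map_add (C.1 (n + l - i)) _ _

theorem opProd_smul (c : ℂ) (A C : FieldSpace W) (l m n : ℤ) (w : W) :
    opProd (c • A) C l m n w = c • opProd A C l m n w :=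
  altSum_smul l (eventuallyZero_left A C _ n w) c

theorem opProdRev_smul (c : ℂ) (A C : FieldSpace W) (l m n : ℤ) (w : W) :
    opProdRev (c • A) C l m n w = c • opProdRev A C l m n w := by
  rw [opProdRev, opProdRev, ← altSum_smul l (eventuallyZero_right A C _ _ w)]
  congr 1
  ext i
  exact map_smul (C.1 (n + l - i)) _ _

open Heisenberg MvPolynomial

/-- The product `a_(n) c` of the Heisenberg vertex algebra. -/
def stateProd (n : ℤ) (a c : Fock) : Fock := (vertexOp isSmooth_osc a).1 n c

theorem stateProd_eventuallyZero (a c : Fock) (l : ℤ) :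
    EventuallyZero fun p : ℕ => stateProd (l + p) a c := eventuallyZero_field _ l c

/-- The fields of the states `a_(l) c`. -/
def prodField (hβ : IsSmoothHeisenberg β) (a c : Fock) (l : ℤ) : FieldSpace W :=
  vertexOp hβ (stateProd l a c)

theorem prodField_eventuallyZero (hβ : IsSmoothHeisenberg β) (a c : Fock) (l : ℤ) :
    EventuallyZero fun p : ℕ => prodField hβ a c (l + p) :=
  (stateProd_eventuallyZero a c l).map (vertexOp hβ)

theorem opIter_prodField_eventuallyZero (hβ : IsSmoothHeisenberg β) (a c : Fock) (l m n : ℤ)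
    (w : W) : EventuallyZero fun p : ℕ => (prodField hβ a c (l + p)).1 (m + n - p) w :=
  (prodField_eventuallyZero hβ a c l).mono fun p h => by rw [h]; rfl

/-- The recursion for `(b_{-j-1} a)_(l) c` carried over to fields. A creation operator on the Fock
space multiplies by `X (j + i)`, so on fields it becomes `normalOrd hβ (j + i)`. This is the
hypothesis `hS` of `opIter_normalOrd`. -/
theorem prodField_X_mul (hβ : IsSmoothHeisenberg β) (j : ℕ) (a c : Fock) (l : ℤ) :
    prodField hβ (X j * a) c l =
      ∑ᶠ i : ℕ, ((j + i).choose i : ℂ) • normalOrd hβ (j + i) (prodField hβ a c (l + i)) +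
      (-1 : ℂ) ^ j • ∑ᶠ i : ℕ, ((j + i).choose i : ℂ) •
        prodField hβ a (osc i c) (l - j - 1 - i) := by
  rw [prodField, stateProd, vertexOp_X_mul, normalOrd_apply, map_add, map_smul,
    (eventuallyZero_creation _ j l c).map_finsum,
    (eventuallyZero_annihilation isSmooth_osc _ j l c).map_finsum]
  congr 2
  · ext1 i
    rw [map_smul, osc_neg (j + i) _ (by push_cast; ring), vertexOp_X_mul]
    rfl
  · congr 1
    ext1 i
    rw [map_smul]
    rfl

theorem prodField_add (hβ : IsSmoothHeisenberg β) (a b c : Fock) (l : ℤ) :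
    prodField hβ (a + b) c l = prodField hβ a c l + prodField hβ b c l := by
  have : stateProd l (a + b) c = stateProd l a c + stateProd l b c := by
    rw [stateProd, map_add]; rfl
  rw [prodField, this, map_add]; rfl

theorem prodField_smul (hβ : IsSmoothHeisenberg β) (x : ℂ) (a c : Fock) (l : ℤ) :
    prodField hβ (x • a) c l = x • prodField hβ a c l := by
  have : stateProd l (x • a) c = x • stateProd l a c := by
    rw [stateProd, map_smul]; rfl
  rw [prodField, this, map_smul]; rfl

theorem prodField_one (hβ : IsSmoothHeisenberg β) (c : Fock) (l : ℤ) :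
    prodField hβ 1 c l = if l = -1 then vertexOp hβ c else 0 := by
  rw [prodField, stateProd, vertexOp_one, idField_apply]
  split_ifs
  · rfl
  · exact map_zero _

theorem opProd_eventuallyZero (A C : FieldSpace W) (l m n : ℤ) (w : W) :
    EventuallyZero fun i : ℕ => opProd A C l (m + i) n w := by
  refine altSum_eventuallyZero (fun _ => l)
    (f := fun i r : ℕ => A.1 (m + i + l - r) (C.1 (n + r) w)) ?_
  refine (EventuallyZero₂.of_rows (f := fun r i : ℕ => A.1 (m + i + l - r) (C.1 (n + r) w))
    ?_ fun r => ?_).swap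
  · obtain ⟨N, hN⟩ := exists_bound_field C n w
    exact ⟨N, fun r hr i => by rw [hN r hr, map_zero]⟩
  · refine (eventuallyZero_field A (m + l - r) (C.1 (n + r) w)).mono fun i h => ?_
    rw [show m + i + l - r = m + l - r + i by ring, h]

theorem opProdRev_eventuallyZero (A C : FieldSpace W) (l m n : ℤ) (w : W) :
    EventuallyZero fun i : ℕ => opProdRev A C l (m + i) n w := by
  refine altSum_eventuallyZero (fun _ => l)
    (f := fun i r : ℕ => C.1 (n + l - r) (A.1 (m + i + r) w)) ?_
  obtain ⟨N, hN⟩ := exists_bound_field A m w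
  refine ⟨N, fun i r h => ?_⟩
  have := hN (i + r) (by omega)
  rw [Nat.cast_add, ← add_assoc] at this
  beta_reduce
  rw [this, map_zero]

theorem opProd_zero_vec (A C : FieldSpace W) (l m n : ℤ) : opProd A C l m n 0 = 0 :=
  altSum_zero l fun i => by rw [map_zero, map_zero]

theorem opProdRev_zero_vec (A C : FieldSpace W) (l m n : ℤ) : opProdRev A C l m n 0 = 0 :=
  altSum_zero l fun i => by rw [map_zero, map_zero]

theorem opProd_zero_right (A : FieldSpace W) (l m n : ℤ) (w : W) : opProd A 0 l m n w = 0 :=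
  altSum_zero l fun _ => map_zero (A.1 _)

theorem opProdRev_zero_right (A : FieldSpace W) (l m n : ℤ) (w : W) : opProdRev A 0 l m n w = 0 :=
  altSum_zero l fun _ => rfl

/-- The Jacobi identity for the fields on a smooth module. -/
theorem jacobi (hβ : IsSmoothHeisenberg β) (a c : Fock) (l m n : ℤ) (w : W) :
    opProd (vertexOp hβ a) (vertexOp hβ c) l m n w -
        (-1 : ℂ) ^ l • opProdRev (vertexOp hβ a) (vertexOp hβ c) l m n w =
      opIter (prodField hβ a c) l m n w := by
  induction a using MvPolynomial.induction_on generalizing c l m n w with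
  | C x =>
    have h : (C x : Fock) = x • 1 := by rw [smul_eq_C_mul, mul_one]
    rw [h, map_smul, opProd_smul, opProdRev_smul, smul_comm _ x, ← smul_sub, vertexOp_one,
      opProd_idField, opIter, ← binomSum_smul]
    · congr 1
      ext p
      rw [prodField_smul, prodField_one]
      split_ifs
      · rfl
      · rw [smul_zero, smul_zero]
        rfl
    · exact ⟨l.natAbs + 1, fun p hp => if_neg (by omega)⟩
  | add p q hp hq =>
    rw [map_add, opProd_add, opProdRev_add, smul_add, add_sub_add_comm, hp, hq, opIter, opIter,
      opIter, ← binomSum_add m (opIter_prodField_eventuallyZero hβ p c l m n w)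
        (opIter_prodField_eventuallyZero hβ q c l m n w)]
    congr 1
    ext i
    rw [prodField_add]
    rfl
  | mul_X a j ih =>
    have hZ : EventuallyZero fun p : ℕ => vertexOp hβ (osc p c) :=
      eventuallyZero_osc c fun _ => vertexOp hβ
    have hC := fun k => adField_vertexOp hβ k c
    have h2 : EventuallyZero fun i : ℕ => prodField hβ a (osc i c) := by
      refine (isSmooth_osc.smooth c).mono fun i h => ?_
      ext1 l
      rw [h, prodField, stateProd, map_zero, map_zero]
      rfl
    -- All three expressions obey the same recursion. It replaces `c` by `b_k c`, lowers `l`, shifts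
    -- `m` and changes `w`, so the induction hypothesis is needed for all of these.
    rw [mul_comm, vertexOp_X_mul, opProd_normalOrd hβ hZ hC, opProdRev_normalOrd hβ hZ hC,
      opIter_normalOrd hβ j (prodField_eventuallyZero hβ a c)
        (fun i => prodField_eventuallyZero hβ a (osc i c)) h2 (prodField_X_mul hβ j a c)]
    simp only [← ih]
    set A := vertexOp hβ a
    set C := vertexOp hβ c
    have x1 : EventuallyZero fun i : ℕ =>
        ((j + i).choose i : ℂ) • β (-j - 1 - i) (opProd A C l (m + i) n w) :=
      (opProd_eventuallyZero A C l m n w).mono fun i h => by rw [h, map_zero, smul_zero]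
    have x2 : EventuallyZero fun i : ℕ =>
        ((j + i).choose i : ℂ) • opProd A C l (m - j - 1 - i) n (β i w) :=
      (hβ.smooth w).mono fun i h => by rw [h, opProd_zero_vec, smul_zero]
    have x3 : EventuallyZero fun k : ℕ =>
        ((j + k).choose k : ℂ) • opProd A (vertexOp hβ (osc k c)) (l - j - k - 1) m n w :=
      hZ.mono fun i h => by rw [h, opProd_zero_right, smul_zero]
    have y1 : EventuallyZero fun i : ℕ => (-1 : ℂ) ^ l •
        ((j + i).choose i : ℂ) • β (-j - 1 - i) (opProdRev A C l (m + i) n w) :=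
      (opProdRev_eventuallyZero A C l m n w).mono fun i h => by
        rw [h, map_zero, smul_zero, smul_zero]
    have y2 : EventuallyZero fun i : ℕ => (-1 : ℂ) ^ l •
        ((j + i).choose i : ℂ) • opProdRev A C l (m - j - 1 - i) n (β i w) :=
      (hβ.smooth w).mono fun i h => by rw [h, opProdRev_zero_vec, smul_zero, smul_zero]
    have y3 : EventuallyZero fun k : ℕ => (-1 : ℂ) ^ l •
        ((j + k).choose k : ℂ) • (-1 : ℂ) ^ (j + k + 1) •
          opProdRev A (vertexOp hβ (osc k c)) (l - j - k - 1) m n w :=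
      hZ.mono fun i h => by rw [h, opProdRev_zero_right, smul_zero, smul_zero, smul_zero]
    have hl : (-1 : ℂ) ^ l ≠ 0 := zpow_ne_zero _ (by norm_num)
    have z : ∀ {f : ℕ → W}, EventuallyZero (fun i => (-1 : ℂ) ^ l • f i) → EventuallyZero f :=
      fun h => h.mono fun i h => (smul_eq_zero.1 h).resolve_left hl
    rw [smul_add ((-1 : ℂ) ^ l), smul_comm ((-1 : ℂ) ^ l) ((-1 : ℂ) ^ j), smul_add ((-1 : ℂ) ^ l),
      (z y1).smul_finsum,
      (z y2).smul_finsum, (z y3).smul_finsum, add_sub_add_comm, ← smul_sub, add_sub_add_comm,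
      ← x1.finsum_sub y1, ← x2.finsum_sub y2, ← x3.finsum_sub y3]
    congr 1
    · refine finsum_congr fun i => ?_
      rw [smul_comm ((-1 : ℂ) ^ l), ← smul_sub, map_sub, map_smul]
    · congr 2
      · refine finsum_congr fun i => ?_
        rw [smul_comm ((-1 : ℂ) ^ l), ← smul_sub]
      · refine finsum_congr fun k => ?_
        rw [smul_comm ((-1 : ℂ) ^ l), ← smul_sub, smul_smul]
        -- The sign of the reversed product agrees with the one in the induction hypothesis at the
        -- lowered exponent: `(-1)^l (-1)^(j+k+1) = (-1)^(l-j-k-1)`.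
        congr 3
        rw [show l - j - k - 1 = l - ((j + k + 1 : ℕ) : ℤ) by push_cast; ring,
          zpow_sub₀ (by norm_num), zpow_natCast, div_eq_mul_inv, ← inv_pow]
        norm_num

end Iterate

/-! ### The products of `vertexData` as modes of fields -/

namespace Heisenberg

open MvPolynomial

theorem monomial_eq_prod (s : ℕ →₀ ℕ) :
    (monomial s 1 : Fock) = ((Finsupp.toMultiset s).map X).prod := by
  induction s using Finsupp.induction_linear with
  | zero => simp
  | add f g hf hg =>
    rw [map_add, Multiset.map_add, Multiset.prod_add, ← hf, ← hg, monomial_mul, mul_one]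
  | single i k =>
    rw [Finsupp.toMultiset_single, Multiset.map_nsmul, Multiset.prod_nsmul,
      Multiset.map_singleton, Multiset.prod_singleton, X_pow_eq_monomial]

theorem weight_natCast (s : ℕ →₀ ℕ) :
    ((Finsupp.weight (fun i : ℕ => i + 1) s : ℕ) : ℤ) = Finsupp.weight wt s := by
  induction s using Finsupp.induction_linear with
  | zero => simp
  | add f g hf hg => rw [map_add, map_add, Nat.cast_add, hf, hg]
  | single i k => simp [Finsupp.weight_single, wt]

theorem eq_zero_of_mem_grade_neg {p : ℤ} (hp : p < 0) {v : Fock} (hv : v ∈ grade p) : v = 0 := by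
  rw [grade_neg p hp] at hv
  exact hv

/-- The truncation in the definition of `fieldMode` loses nothing. Beyond the cut-off `N` both
`fieldMode l (m + i)` and `osc i` send the monomial to negative weight, hence to zero. -/
theorem fieldMode_eq (l : List ℕ) (m : ℤ) :
    fieldMode l m = (vertexOp isSmooth_osc (l.map X).prod).1 m := by
  induction l generalizing m with
  | nil =>
    rw [List.map_nil, List.prod_nil, vertexOp_one]
    rfl
  | cons j l ih =>
    refine (basisMonomials ℕ ℂ).ext fun s => ?_
    rw [fieldMode, Module.Basis.constr_basis, List.map_cons, List.prod_cons, vertexOp_X_mul,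
      normalOrd_apply, coe_basisMonomials]
    have hl : (((l.map (· + 1)).sum : ℕ) : ℤ) = (l.map wt).sum := by
      clear ih
      induction l with
      | nil => rfl
      | cons k l ih => simp [wt, ← ih]
    set N := Finsupp.weight (fun i : ℕ => i + 1) s + (l.map (· + 1)).sum + m.natAbs + 1
    have hs := weight_natCast s
    have h1 : ∀ i : ℕ, N ≤ i → fieldMode l (m + i) (monomial s 1) = 0 := fun i hi =>
      eq_zero_of_mem_grade_neg (by omega) (fieldMode_mem l (m + i) (monomial_mem_grade s))
    have h2 : ∀ i : ℕ, N ≤ i → osc i (monomial s 1) = 0 := fun i hi =>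
      eq_zero_of_mem_grade_neg (by omega) (osc_mem i (monomial_mem_grade s))
    rw [finsum_eq_sum_range (n := N), finsum_eq_sum_range (n := N), Finset.smul_sum,
      ← Finset.sum_add_distrib]
    · refine Finset.sum_congr rfl fun i _ => ?_
      rw [smul_add, ih, ih, smul_comm ((-1 : ℂ) ^ j)]
    · intro i hi
      rw [h2 i hi, map_zero, smul_zero]
    · intro i hi
      rw [← ih, h1 i hi, map_zero, smul_zero]

/-- Through this the Jacobi identity `jacobi` becomes a statement about the products of
`vertexData`. -/
theorem nth_eq_stateProd (n : ℤ) (a c : Fock) : nth n a c = stateProd n a c := by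
  have key : (nth n).flip c = evalField n c ∘ₗ vertexOp isSmooth_osc := by
    refine (basisMonomials ℕ ℂ).ext fun s => ?_
    rw [LinearMap.flip_apply, nth, Module.Basis.constr_basis, fieldMode_eq,
      show basisMonomials ℕ ℂ s = monomial s (1 : ℂ) by simp, monomial_eq_prod, ← Multiset.prod_coe, ← Multiset.map_coe, Multiset.sort_eq]
    rfl
  exact LinearMap.congr_fun key a

end Heisenberg

/-! ### Translation covariance and the action of the enveloping algebra -/

section Representation

variable {W : Type*} [AddCommGroup W] [Module ℂ W] {β : ℤ → Module.End ℂ W}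

open Heisenberg MvPolynomial

/-- The derivative of a field. -/
def derivField : Module.End ℂ (FieldSpace W) where
  toFun A := ⟨fun m => (-m : ℂ) • A.1 (m - 1), fun w => by
    obtain ⟨n, hn⟩ := A.2 w
    exact ⟨n + 1, fun m hm => by
      rw [LinearMap.smul_apply, hn _ (by omega), smul_zero]⟩⟩
  map_add' A B := by
    ext m w
    simp
  map_smul' c A := by
    ext m w
    simp only [Submodule.coe_smul, Pi.smul_apply, LinearMap.smul_apply, RingHom.id_apply]
    rw [smul_comm]

theorem derivField_apply (A : FieldSpace W) (m : ℤ) (w : W) :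
    (derivField A).1 m w = (-m : ℂ) • A.1 (m - 1) w := rfl

/-- The Leibniz rule: differentiating `∂^j b / j!` gives `j + 1` times `∂^(j+1) b / (j+1)!`. After
moving the term with `∂A` to the other side the summand at `i = 0` cancels, which permits the shift
by one. -/
theorem derivField_creationPart (j : ℕ) (A : FieldSpace W) :
    derivField (creationPart β j A) =
      creationPart β j (derivField A) + ((j : ℂ) + 1) • creationPart β (j + 1) A := by
  ext m w
  have h1 := eventuallyZero_creation (β := β) A j (m - 1) w
  have h2 := eventuallyZero_creation (β := β) (derivField A) j m w
  have h3 := eventuallyZero_creation (β := β) A (j + 1) m w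
  rw [derivField_apply, creationPart_apply, Submodule.coe_add, Pi.add_apply, LinearMap.add_apply,
    Submodule.coe_smul, Pi.smul_apply, LinearMap.smul_apply, creationPart_apply,
    creationPart_apply, h1.smul_finsum, h3.smul_finsum, ← sub_eq_iff_eq_add',
    ← (h1.smul fun _ => (-m : ℂ)).finsum_sub h2, finsum_shift 1]
  · refine finsum_congr fun i => ?_
    rw [derivField_apply, map_smul, smul_smul, smul_smul, smul_smul,
      show m + ((1 + i : ℕ) : ℤ) - 1 = m + i by push_cast; ring,
      show m - 1 + ((1 + i : ℕ) : ℤ) = m + i by push_cast; ring,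
      show -(j : ℤ) - 1 - ((1 + i : ℕ) : ℤ) = -((j + 1 : ℕ) : ℤ) - 1 - i by push_cast; ring,
      ← sub_smul]
    congr 1
    have h := Nat.add_one_mul_choose_eq (j + i) i
    have h' := Nat.add_one_mul_choose_eq (j + i) j
    have hs : (j + i).choose j = (j + i).choose i := Nat.choose_symm_add
    have hs' : (j + 1 + i).choose i = (j + i + 1).choose (j + 1) := by
      rw [← Nat.choose_symm_add]
      congr 1; ring
    have e : ((j + (1 + i)).choose (1 + i) : ℂ) * (i + 1) = (j + 1) * (j + 1 + i).choose i := by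
      rw [hs', show j + (1 + i) = j + i + 1 by ring, show 1 + i = i + 1 by ring]
      exact_mod_cast (by rw [← h, ← hs, h', mul_comm])
    push_cast
    linear_combination e
  · intro i hi
    obtain rfl : i = 0 := by omega
    simp [derivField_apply]

theorem derivField_annihilationPart (hβ : IsSmoothHeisenberg β) (j : ℕ) (A : FieldSpace W) :
    derivField (annihilationPart hβ j A) =
      annihilationPart hβ j (derivField A) + ((j : ℂ) + 1) • annihilationPart hβ (j + 1) A := by
  ext m w
  have h1 := eventuallyZero_annihilation hβ A.1 j (m - 1) w
  have h2 := eventuallyZero_annihilation hβ (derivField A).1 j m w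
  have h3 := eventuallyZero_annihilation hβ A.1 (j + 1) m w
  rw [derivField_apply, annihilationPart_apply, Submodule.coe_add, Pi.add_apply,
    LinearMap.add_apply, Submodule.coe_smul, Pi.smul_apply, LinearMap.smul_apply,
    annihilationPart_apply, annihilationPart_apply, smul_comm (-m : ℂ),
    smul_comm ((j : ℂ) + 1), pow_succ, mul_smul, ← smul_add]
  congr 1
  rw [h1.smul_finsum, h3.smul_finsum, ((h3.smul _).mono fun i h => h).smul_finsum,
    ← h2.finsum_add ((h3.smul fun _ => (j : ℂ) + 1).smul _)]
  refine finsum_congr fun i => ?_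
  rw [derivField_apply, smul_smul, smul_smul, smul_smul, smul_smul,
    show m - 1 - j - 1 - i = m - j - 1 - i - 1 by ring,
    show m - ((j + 1 : ℕ) : ℤ) - 1 - i = m - j - 1 - i - 1 by push_cast; ring, ← add_smul]
  congr 1
  have h' := Nat.add_one_mul_choose_eq (j + i) j
  have hs : (j + i).choose j = (j + i).choose i := Nat.choose_symm_add
  have hs' : (j + 1 + i).choose i = (j + i + 1).choose (j + 1) := by
    rw [← Nat.choose_symm_add]
    congr 1; ring
  have e : ((j : ℂ) + i + 1) * (j + i).choose i = (j + 1 + i).choose i * (j + 1) := by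
    rw [hs', ← hs]
    exact_mod_cast h'
  push_cast
  linear_combination (-1 : ℂ) * e

theorem transl_X_mul (j : ℕ) (a : Fock) :
    transl (X j * a) = ((j : ℂ) + 1) • (X (j + 1) * a) + X j * transl a := by
  rw [transl]
  simp only [Derivation.coeFn_coe, Derivation.leibniz, mkDerivation_X, smul_eq_mul]
  rw [mul_smul_comm, mul_comm a, add_comm]

/-- Translation acts on fields as `d/dz`. Hence the modes vanish on the image of `nabla` and the
ancillary Lie algebra acts. -/
theorem vertexOp_transl (hβ : IsSmoothHeisenberg β) (a : Fock) :
    vertexOp hβ (transl a) = derivField (vertexOp hβ a) := by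
  induction a using MvPolynomial.induction_on with
  | C x =>
    have h : (C x : Fock) = x • 1 := by rw [smul_eq_C_mul, mul_one]
    have h1 : transl (1 : Fock) = 0 := by simp [transl]
    rw [h, map_smul, map_smul, map_smul, map_smul, h1, map_zero, vertexOp_one]
    congr 1
    ext m w
    rw [derivField_apply, idField_apply]
    by_cases hm : m = 0
    · simp [hm]
    · rw [if_neg (by omega), smul_zero]
      rfl
  | add p q hp hq => simp only [map_add, hp, hq]
  | mul_X a j ih =>
    rw [mul_comm, transl_X_mul, map_add, map_smul, vertexOp_X_mul, vertexOp_X_mul, vertexOp_X_mul,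
      ih, normalOrd, normalOrd, LinearMap.add_apply, LinearMap.add_apply, LinearMap.add_apply,
      map_add, derivField_creationPart, derivField_annihilationPart, smul_add]
    abel

/-- The action of the modes `a_[n]` of the finite ancillary Lie algebra. -/
def ancillaryRep (hβ : IsSmoothHeisenberg β) : vertexData.Ancillary →ₗ[ℂ] Module.End ℂ W :=
  (LinearMap.range vertexData.nabla).liftQ
    (Finsupp.lsum ℂ fun n : ℤ => LinearMap.proj n ∘ₗ (FieldSpace W).subtype ∘ₗ vertexOp hβ) (by
      rw [LinearMap.range_le_ker_iff]
      refine Finsupp.lhom_ext fun n a => ?_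
      rw [LinearMap.comp_apply, GradedVertexData.nabla, Finsupp.lsum_single, LinearMap.add_apply,
        LinearMap.comp_apply, LinearMap.smul_apply, map_add, map_smul, Finsupp.lsingle_apply,
        Finsupp.lsingle_apply, Finsupp.lsum_single, Finsupp.lsum_single]
      have h := vertexOp_transl hβ a
      change (vertexOp hβ (transl a)).1 n + (n : ℂ) • (vertexOp hβ a).1 (n - 1) = 0
      rw [h]
      change (-n : ℂ) • (vertexOp hβ a).1 (n - 1) + (n : ℂ) • (vertexOp hβ a).1 (n - 1) = 0
      rw [← add_smul, neg_add_cancel, zero_smul])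

theorem ancillaryRep_ancMode (hβ : IsSmoothHeisenberg β) (a : Fock) (n : ℤ) :
    ancillaryRep hβ (vertexData.ancMode a n) = (vertexOp hβ a).1 n := by
  rw [ancillaryRep, GradedVertexData.ancMode]
  erw [Submodule.liftQ_apply]
  rw [Finsupp.lsum_single]
  rfl

/-- The case `l = 0` of the Jacobi identity, where each of the two sums on the left reduces to its
first term. -/
theorem vertexOp_commutator (hβ : IsSmoothHeisenberg β) (a c : Fock) (m n : ℤ) (w : W) :
    (vertexOp hβ a).1 m ((vertexOp hβ c).1 n w) =
      (vertexOp hβ c).1 n ((vertexOp hβ a).1 m w) +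
      ∑ᶠ k : ℕ, zchoose m k • (vertexOp hβ (nth k a c)).1 (m + n - k) w := by
  have h := jacobi hβ a c 0 m n w
  have h0 : ∀ f : ℕ → W, altSum 0 f = f 0 := fun f => by
    rw [altSum, finsum_eq_single _ 0]
    · simp [zchoose]
    · intro i hi
      simp [zchoose, Ring.choose_zero_pos ℤ (Nat.pos_of_ne_zero hi)]
  rw [opProd, opProdRev, h0, h0, opIter, sub_eq_iff_eq_add'] at h
  simp only [Nat.cast_zero, sub_zero, add_zero, zpow_zero, one_smul] at h
  rw [h]
  congr 1
  refine finsum_congr fun k => ?_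
  beta_reduce
  rw [zero_add, nth_eq_stateProd]
  rfl

theorem nth_eventuallyZero (a c : Fock) (l : ℤ) : EventuallyZero fun k : ℕ => nth (l + k) a c :=
  (stateProd_eventuallyZero a c l).mono fun k h => by rw [nth_eq_stateProd, h]

theorem ancMode_zero (n : ℤ) : vertexData.ancMode (0 : Fock) n = 0 := by
  rw [GradedVertexData.ancMode, Finsupp.single_zero]; rfl

theorem ancMode_eventuallyZero (a c : Fock) (l : ℤ) (s : ℤ) :
    EventuallyZero fun k : ℕ => vertexData.ancMode (vertexData.nth (l + k) a c) (s - k) :=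
  (nth_eventuallyZero a c l).mono fun k h => by
    change vertexData.ancMode (nth (l + k) a c) (s - k) = 0
    rw [h, ancMode_zero]

/-- The action of the universal enveloping algebra on a smooth module. -/
def envRep (hβ : IsSmoothHeisenberg β) : vertexData.Env →ₐ[ℂ] Module.End ℂ W :=
  RingQuot.liftAlgHom ℂ ⟨TensorAlgebra.lift ℂ (ancillaryRep hβ), by
    rintro _ _ ⟨a, c, i, j⟩
    have hz := ancMode_eventuallyZero a c 0 (i + j)
    simp only [zero_add] at hz
    rw [map_add, map_mul, map_mul, TensorAlgebra.lift_ι_apply, TensorAlgebra.lift_ι_apply,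
      TensorAlgebra.lift_ι_apply, ((hz.smul _).mono fun k h => h).map_finsum]
    ext w
    rw [LinearMap.add_apply, Module.End.mul_apply, Module.End.mul_apply, ancillaryRep_ancMode,
      ancillaryRep_ancMode, vertexOp_commutator]
    congr 1
    have hz' := (((hz.smul fun k => zchoose i k).map (ancillaryRep hβ)).map_finsum
      (LinearMap.applyₗ w))
    refine Eq.trans ?_ hz'.symm
    refine finsum_congr fun k => ?_
    rw [map_smul, ancillaryRep_ancMode]
    rfl⟩

theorem envRep_envMode (hβ : IsSmoothHeisenberg β) (a : Fock) (n : ℤ) :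
    envRep hβ (vertexData.envMode a n) = (vertexOp hβ a).1 n := by
  refine (RingQuot.liftAlgHom_mkAlgHom_apply (S := ℂ) (s := vertexData.EnvRel)
    (f := TensorAlgebra.lift ℂ (ancillaryRep hβ)) _ _).trans ?_
  rw [TensorAlgebra.lift_ι_apply, ancillaryRep_ancMode]

end Representation

/-! ### The Fock representations, extended to the completion -/

namespace Heisenberg

open MvPolynomial GradedVertexData

theorem oscAt_mem (x : ℂ) (n : ℤ) {p : ℤ} {v : Fock} (hv : v ∈ grade p) :
    oscAt x n v ∈ grade (p - n) := by
  by_cases h : n = 0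
  · subst h
    rw [oscAt_zero_index, sub_zero]
    exact Submodule.smul_mem _ _ hv
  · rw [oscAt_of_ne x h]
    exact osc_mem n hv

theorem finsum_mem_submodule {W : Type*} [AddCommGroup W] [Module ℂ W] (S : Submodule ℂ W)
    {f : ℕ → W} (h : ∀ i, f i ∈ S) : ∑ᶠ i, f i ∈ S :=
  finsum_induction (· ∈ S) S.zero_mem (fun _ _ => S.add_mem) h

theorem vertexOp_list_mem (x : ℂ) (l : List ℕ) (m : ℤ) {q : ℤ} {v : Fock} (hv : v ∈ grade q) :
    (vertexOp (isSmooth_oscAt x) (l.map X).prod).1 m v ∈ grade ((l.map wt).sum + q - m - 1) := by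
  induction l generalizing m q v with
  | nil =>
    rw [List.map_nil, List.map_nil, List.prod_nil, vertexOp_one, idField_apply]
    split_ifs with h
    · simpa [h] using hv
    · exact Submodule.zero_mem _
  | cons j l ih =>
    rw [List.map_cons, List.map_cons, List.prod_cons, vertexOp_X_mul, normalOrd_apply]
    refine Submodule.add_mem _ (finsum_mem_submodule _ fun i => Submodule.smul_mem _ _ ?_)
      (Submodule.smul_mem _ _ (finsum_mem_submodule _ fun i => Submodule.smul_mem _ _ ?_))
    · convert oscAt_mem x (-j - 1 - i) (ih (m + i) hv) using 2
      simp [wt]; ring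
    · convert ih (m - j - 1 - i) (oscAt_mem x i hv) using 2
      simp [wt]; ring

theorem vertexOp_mem (x : ℂ) (m : ℤ) {p q : ℤ} {a v : Fock} (ha : a ∈ grade p)
    (hv : v ∈ grade q) : (vertexOp (isSmooth_oscAt x) a).1 m v ∈ grade (p + q - m - 1) := by
  have key : (evalField m v ∘ₗ vertexOp (isSmooth_oscAt x)) a ∈ grade (p + q - m - 1) := by
    refine map_mem_of_monomial (fun s hs => ?_) ha
    have h := vertexOp_list_mem x (Finsupp.toMultiset s).sort m hv
    rw [← Multiset.prod_coe, ← Multiset.map_coe, ← Multiset.sum_coe, ← Multiset.map_coe,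
      Multiset.sort_eq, ← monomial_eq_prod, ← weight_eq_sum, hs] at h
    exact h
  exact key

/-- The action of the enveloping algebra on the Fock space on which `b_0` acts by `x`. -/
def fockRep (x : ℂ) : vertexData.Env →ₐ[ℂ] Module.End ℂ Fock := envRep (isSmooth_oscAt x)

theorem fockRep_mem (x : ℂ) {d q : ℤ} {u : vertexData.Env} (hu : u ∈ vertexData.envDeg d)
    {v : Fock} (hv : v ∈ grade q) : fockRep x u v ∈ grade (q + d) := by
  induction hu using Submodule.span_induction with
  | mem u hu =>
    induction hu with
    | one => simpa using hv
    | @cons p d a u ha n hu ih =>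
      have e : fockRep x (vertexData.envMode a n) = (vertexOp (isSmooth_oscAt x) a).1 n :=
        envRep_envMode _ a n
      rw [map_mul, Module.End.mul_apply, e]
      convert vertexOp_mem x n ha ih using 2
      ring
  | zero => simp
  | add u u' _ _ h h' =>
    rw [map_add, LinearMap.add_apply]
    exact Submodule.add_mem _ h h'
  | smul c u _ h =>
    rw [map_smul, LinearMap.smul_apply]
    exact Submodule.smul_mem _ _ h

theorem fockRep_envNbhd (x : ℂ) {n q : ℤ} (hq : q < n) {u : vertexData.Env}
    (hu : u ∈ vertexData.envNbhd n) {v : Fock} (hv : v ∈ grade q) : fockRep x u v = 0 := by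
  induction hu using Submodule.span_induction with
  | mem u hu =>
    obtain ⟨j, hj, hu⟩ := hu
    exact eq_zero_of_mem_grade_neg (by omega) (fockRep_mem x hu hv)
  | zero => simp
  | add u u' _ _ h h' => rw [map_add, LinearMap.add_apply, h, h', add_zero]
  | smul r u _ h => rw [smul_eq_mul, map_mul, Module.End.mul_apply, h, map_zero]

/-- A vector has components in finitely many weights, and a neighbourhood of large order lowers all
of them below zero. This is the continuity of the orbit maps for the discrete topology on the Fock
space. -/
theorem exists_envNbhd_fockRep (x : ℂ) (v : Fock) :
    ∃ n, ∀ u ∈ vertexData.envNbhd n, fockRep x u v = 0 := by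
  have hv : v ∈ ⨆ p, grade p := by
    rw [show (⨆ p, grade p) = ⊤ from vertexData.isInternal.submodule_iSup_eq_top]; trivial
  induction hv using Submodule.iSup_induction' with
  | mem q v hv => exact ⟨q + 1, fun u hu => fockRep_envNbhd x (by omega) hu hv⟩
  | zero => exact ⟨0, fun u _ => map_zero _⟩
  | add v w _ _ hv hw =>
    obtain ⟨m, hm⟩ := hv
    obtain ⟨k, hk⟩ := hw
    refine ⟨max m k, fun u hu => ?_⟩
    rw [map_add, hm u (vertexData.envNbhd_anti (le_max_left _ _) hu),
      hk u (vertexData.envNbhd_anti (le_max_right _ _) hu), add_zero]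

/-- The discrete uniformity on the Fock space. -/
@[reducible] def fockUniform : UniformSpace Fock := ⊥

attribute [local instance] fockUniform

instance : DiscreteUniformity Fock := ⟨rfl⟩

/-- The orbit map of `v`. -/
def orbitHom (x : ℂ) (v : Fock) : vertexData.Env →+ Fock :=
  (LinearMap.applyₗ v ∘ₗ (fockRep x).toLinearMap).toAddMonoidHom

theorem continuous_orbitHom (x : ℂ) (v : Fock) : Continuous (orbitHom x v) := by
  refine continuous_of_continuousAt_zero _ ?_
  obtain ⟨n, hn⟩ := exists_envNbhd_fockRep x v
  rw [ContinuousAt, map_zero, nhds_discrete Fock, Filter.tendsto_pure]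
  exact Filter.mem_of_superset (vertexData.envBasis.hasBasis_nhds_zero.mem_of_mem (i := n) trivial)
    fun u hu => hn u hu

/-- The continuous extension of the orbit map of `v` to the completion. -/
def complOrbit (x : ℂ) (v : Fock) : vertexData.Compl →+ Fock :=
  (orbitHom x v).extension (continuous_orbitHom x v)

theorem continuous_complOrbit (x : ℂ) (v : Fock) : Continuous (complOrbit x v) :=
  AddMonoidHom.continuous_extension _ _

theorem complOrbit_coe (x : ℂ) (v : Fock) (u : vertexData.Env) :
    complOrbit x v (vertexData.toCompl u) = fockRep x u v :=
  AddMonoidHom.extension_coe _ (continuous_orbitHom x v) u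

theorem compl_induction {P : vertexData.Compl → Prop} (ξ : vertexData.Compl)
    (hP : IsClosed {ξ | P ξ}) (h : ∀ u, P (vertexData.toCompl u)) : P ξ :=
  UniformSpace.Completion.induction_on ξ hP h

/-- The action of the completion on the Fock space. -/
def complRep (x : ℂ) : vertexData.Compl →ₐ[ℂ] Module.End ℂ Fock :=
  AlgHom.ofLinearMap
    { toFun := fun ξ =>
        { toFun := fun v => complOrbit x v ξ
          map_add' := fun v w => compl_induction ξ
            (isClosed_eq (continuous_complOrbit x _)
              ((continuous_complOrbit x v).add (continuous_complOrbit x w)))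
            fun u => by
              change _ = complOrbit x v _ + complOrbit x w _
              rw [complOrbit_coe, complOrbit_coe, complOrbit_coe, map_add]
          map_smul' := fun c v => compl_induction ξ
            (isClosed_eq (continuous_complOrbit x _)
              (continuous_of_discreteTopology.comp (continuous_complOrbit x v)))
            fun u => by
              change _ = c • complOrbit x v _
              rw [complOrbit_coe, complOrbit_coe, map_smul] }
      map_add' := fun ξ η => LinearMap.ext fun v => map_add (complOrbit x v) ξ η
      map_smul' := fun c ξ => LinearMap.ext fun v => by
        refine compl_induction (P := fun ξ => complOrbit x v (c • ξ) = c • complOrbit x v ξ) ξ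
          (isClosed_eq ((continuous_complOrbit x v).comp (continuous_const_smul c))
            (continuous_of_discreteTopology.comp (continuous_complOrbit x v))) fun u => ?_
        rw [← map_smul, complOrbit_coe, complOrbit_coe, map_smul, LinearMap.smul_apply] }
    (LinearMap.ext fun v => by
      change complOrbit x v 1 = v
      rw [← map_one vertexData.toCompl, complOrbit_coe, map_one, Module.End.one_apply])
    (fun ξ η => LinearMap.ext fun v => by
      change complOrbit x v (ξ * η) = complOrbit x (complOrbit x v η) ξ
      -- Both sides are continuous in `ξ` for fixed `η`, and then in `η` once `ξ` comes from `U`.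
      -- Thus the equation needs checking only on `U`, where it is multiplicativity of `fockRep`.
      refine compl_induction
        (P := fun ξ => complOrbit x v (ξ * η) = complOrbit x (complOrbit x v η) ξ) ξ
        (isClosed_eq ((continuous_complOrbit x v).comp (continuous_mul_const η))
          (continuous_complOrbit x _)) fun u => ?_
      refine compl_induction
        (P := fun η => complOrbit x v (vertexData.toCompl u * η) =
          complOrbit x (complOrbit x v η) (vertexData.toCompl u)) η
        (isClosed_eq ((continuous_complOrbit x v).comp (continuous_const_mul _)) ?_) fun u' => ?_
      · exact (continuous_of_discreteTopology
          (f := fun w => complOrbit x w (vertexData.toCompl u))).comp (continuous_complOrbit x v)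
      · rw [← map_mul, complOrbit_coe, complOrbit_coe, complOrbit_coe, map_mul,
          Module.End.mul_apply])

theorem complRep_toCompl (x : ℂ) (u : vertexData.Env) :
    complRep x (vertexData.toCompl u) = fockRep x u :=
  LinearMap.ext fun v => complOrbit_coe x v u

theorem continuous_complRep_apply (x : ℂ) (v : Fock) :
    Continuous fun ξ => complRep x ξ v := continuous_complOrbit x v

theorem complRep_complMode (x : ℂ) (a : Fock) (n : ℤ) :
    complRep x (vertexData.complMode a n) = (vertexOp (isSmooth_oscAt x) a).1 n := by
  rw [complMode, complRep_toCompl, fockRep, envRep_envMode]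

/-- Every subspace of the discrete space `Fock` is closed, so its preimage under a continuous orbit
map is closed too. -/
theorem complRep_closureIn (x : ℂ) {S : Submodule ℂ vertexData.Env} {P : Submodule ℂ Fock}
    {v : Fock} (h : ∀ u ∈ S, fockRep x u v ∈ P) {ξ : vertexData.Compl}
    (hξ : ξ ∈ vertexData.closureIn S) : complRep x ξ v ∈ P := by
  have hc : IsClosed {ξ | complRep x ξ v ∈ P} :=
    (isClosed_discrete (P : Set Fock)).preimage (continuous_complRep_apply x v)
  refine closure_minimal ?_ hc hξ
  rintro _ ⟨u, hu, rfl⟩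
  change complRep x (vertexData.toCompl u) v ∈ P
  rw [complRep_toCompl]
  exact h u hu

end Heisenberg

/-! ### The Fock spaces as modules over `𝒰(π)` -/

section Modes

variable {V : Type*} [AddCommGroup V] [Module ℂ V] (D : GradedVertexData V)

/-- The modes in the completion, linear in the state. -/
def GradedVertexData.complModeHom (n : ℤ) : V →ₗ[ℂ] D.Compl :=
  D.toCompl.toLinearMap ∘ₗ D.envOf ∘ₗ Submodule.mkQ _ ∘ₗ (Finsupp.lsingle n : V →ₗ[ℂ] (ℤ →₀ V))

theorem GradedVertexData.complModeHom_apply (n : ℤ) (a : V) :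
    D.complModeHom n a = D.complMode a n := rfl

end Modes

namespace Heisenberg

open MvPolynomial GradedVertexData

attribute [local instance] fockUniform

theorem complMode_eventuallyZero (a c : Fock) (l m s : ℤ) :
    EventuallyZero fun i : ℕ => ((Ring.choose m i : ℤ) : ℂ) •
      vertexData.complMode (vertexData.nth (l + i) a c) (s - i) :=
  (nth_eventuallyZero a c l).mono fun i h => by
    change _ • vertexData.complMode (nth (l + i) a c) (s - i) = 0
    rw [h, ← complModeHom_apply, map_zero, smul_zero]

theorem hasSum_of_eventuallyZero {f : ℕ → Fock} (hf : EventuallyZero f) :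
    HasSum f (∑ᶠ i, f i) := by
  obtain ⟨n, hn⟩ := hf
  rw [finsum_eq_sum_range hn]
  exact hasSum_sum_of_ne_finset_zero fun i hi => hn i (by simpa using hi)

/-- A continuous orbit map sends the convergent series to a series in the discrete Fock space with
finitely many nonzero terms. By `jacobi` its sum is the iterate, so uniqueness of limits leaves
nothing for `ξ`. -/
theorem complRep_jacobi (x : ℂ) {ξ : vertexData.Compl} {a c : Fock} {l m n : ℤ}
    (h : HasSum (fun i : ℕ => ((-1 : ℂ) ^ i * ((Ring.choose l i : ℤ) : ℂ)) •
            (vertexData.complMode a (m + l - i) * vertexData.complMode c (n + i)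
              - (-1 : ℂ) ^ l • (vertexData.complMode c (n + l - i) * vertexData.complMode a (m + i))))
          (ξ + ∑ᶠ i : ℕ, ((Ring.choose m i : ℤ) : ℂ) •
            vertexData.complMode (vertexData.nth (l + i) a c) (m + n - i))) :
    complRep x ξ = 0 := by
  refine LinearMap.ext fun v => ?_
  set hβ := isSmooth_oscAt x
  have h1 := h.map (complOrbit x v) (continuous_complOrbit x v)
  have e1 := (eventuallyZero_left (vertexOp hβ a) (vertexOp hβ c) (m + l) n v).smul
    fun i => (-1 : ℂ) ^ i * zchoose l i
  have e2 := (eventuallyZero_right (vertexOp hβ a) (vertexOp hβ c) m (n + l) v).smul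
    fun i => (-1 : ℂ) ^ i * zchoose l i
  have e3 := e2.smul fun _ => (-1 : ℂ) ^ l
  have h2 : HasSum _ _ := hasSum_of_eventuallyZero e1
  have h3 : HasSum _ _ := hasSum_of_eventuallyZero e3
  have hf : ∀ i : ℕ, complOrbit x v (((-1 : ℂ) ^ i * ((Ring.choose l i : ℤ) : ℂ)) •
            (vertexData.complMode a (m + l - i) * vertexData.complMode c (n + i)
              - (-1 : ℂ) ^ l • (vertexData.complMode c (n + l - i) * vertexData.complMode a (m + i))))
      = ((-1 : ℂ) ^ i * zchoose l i) • (vertexOp hβ a).1 (m + l - i) ((vertexOp hβ c).1 (n + i) v)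
        - (-1 : ℂ) ^ l • (((-1 : ℂ) ^ i * zchoose l i) •
          (vertexOp hβ c).1 (n + l - i) ((vertexOp hβ a).1 (m + i) v)) := fun i => by
    change complRep x _ v = _
    rw [map_smul, map_sub, map_smul, map_mul, map_mul, complRep_complMode, complRep_complMode,
      complRep_complMode, complRep_complMode, smul_comm ((-1 : ℂ) ^ l), ← smul_sub]
    rfl
  rw [show (_ ∘ _ : ℕ → Fock) = _ from funext hf] at h1
  have h4 := h1.unique (h2.sub h3)
  rw [← e2.smul_finsum] at h4
  have h5 := (complMode_eventuallyZero a c l m (m + n)).map_finsum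
    (LinearMap.applyₗ v ∘ₗ (complRep x).toLinearMap)
  have h6 := jacobi hβ a c l m n v
  have h7 : complOrbit x v (ξ + ∑ᶠ i : ℕ, ((Ring.choose m i : ℤ) : ℂ) •
          vertexData.complMode (vertexData.nth (l + i) a c) (m + n - i)) =
      complRep x ξ v + opIter (prodField hβ a c) l m n v := by
    rw [map_add]
    refine congrArg (complRep x ξ v + ·) (h5.trans (finsum_congr fun i => ?_))
    rw [map_smul, LinearMap.comp_apply, AlgHom.toLinearMap_apply, complRep_complMode]
    change _ • (vertexOp hβ (nth (l + i) a c)).1 _ v = _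
    rw [nth_eq_stateProd]
    rfl
  rw [h7] at h4
  change _ = opProd _ _ _ _ _ _ - _ • opProdRev _ _ _ _ _ _ at h4
  rw [h6] at h4
  exact add_eq_right.1 h4

/-- The action of the graded completion on the Fock space. -/
def grRep (x : ℂ) : vertexData.GrCompl →ₐ[ℂ] Module.End ℂ Fock :=
  (complRep x).comp vertexData.GrCompl.val

theorem jacobiIdeal_le_ker (x : ℂ) : vertexData.jacobiIdeal ≤ TwoSidedIdeal.ker (grRep x) := by
  refine (fun y hy => TwoSidedIdeal.mem_span_iff.1 hy _ ?_)
  rintro ξ (⟨a, c, l, m, n, h⟩ | h)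
  · exact (TwoSidedIdeal.mem_ker _).2 (complRep_jacobi x h)
  · refine (TwoSidedIdeal.mem_ker _).2 ?_
    change complRep x ξ = 0
    rw [show (ξ : vertexData.Compl) = _ from h, map_sub, map_one, complRep_complMode]
    change (vertexOp (isSmooth_oscAt x) 1).1 (-1) - 1 = 0
    rw [vertexOp_one, idField]
    exact sub_self _

/-- The annihilator of a vector is closed, so passing from `J` to the closures of its degree pieces
adds nothing that acts nontrivially. -/
theorem jacobiClosure_le_ker (x : ℂ) :
    vertexData.jacobiClosure ≤ TwoSidedIdeal.ker (grRep x) := by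
  refine (fun y hy => TwoSidedIdeal.mem_span_iff.1 hy _ ?_)
  rintro ξ ⟨d, hξ⟩
  refine (TwoSidedIdeal.mem_ker _).2 (LinearMap.ext fun v => ?_)
  have hc : IsClosed {ξ : vertexData.GrCompl | grRep x ξ v = 0} :=
    isClosed_eq ((continuous_complRep_apply x v).comp continuous_subtype_val) continuous_const
  refine closure_minimal (fun y hy => ?_) hc hξ
  exact LinearMap.congr_fun ((TwoSidedIdeal.mem_ker _).1 (jacobiIdeal_le_ker x hy.1)) v

/-- The action of `𝒰(π)` on the Fock space on which `b_0` acts by `x`. -/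
def vRep (x : ℂ) : vertexData.VEnv →ₐ[ℂ] Module.End ℂ Fock :=
  RingCon.liftₐ _ (grRep x) (TwoSidedIdeal.ringCon_le_iff.1 (jacobiClosure_le_ker x))

theorem vRep_toVEnv (x : ℂ) (ξ : vertexData.GrCompl) :
    vRep x (vertexData.toVEnv ξ) = complRep x ξ := rfl

theorem vRep_mode (x : ℂ) (a : Fock) (n : ℤ) :
    vRep x (vertexData.mode a n) = (vertexOp (isSmooth_oscAt x) a).1 n := by
  rw [mode, vRep_toVEnv, complRep_complMode]

/-- The identity field leaves one term of the normally ordered product: a creation term for `n < 0`,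
an annihilation term for `n ≥ 0`. -/
theorem vertexOp_b {W : Type*} [AddCommGroup W] [Module ℂ W] {β : ℤ → Module.End ℂ W}
    (hβ : IsSmoothHeisenberg β) (n : ℤ) : (vertexOp hβ b).1 n = β n := by
  refine LinearMap.ext fun v => ?_
  rw [b, ← mul_one (X 0), vertexOp_X_mul, vertexOp_one, normalOrd_apply]
  simp only [idField_apply]
  rcases lt_or_ge n 0 with hn | hn
  · obtain ⟨k, rfl⟩ : ∃ k : ℕ, n = -1 - k := ⟨(-1 - n).toNat, by omega⟩
    rw [finsum_eq_single _ k, finsum_eq_zero_of_forall_eq_zero]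
    · rw [if_pos (by omega)]
      simp
    · intro i
      rw [if_neg (by omega), smul_zero]
    · intro i hi
      rw [if_neg (by omega), map_zero, smul_zero]
  · obtain ⟨k, rfl⟩ := Int.eq_ofNat_of_zero_le hn
    rw [finsum_eq_zero_of_forall_eq_zero, finsum_eq_single _ k]
    · rw [if_pos (by simp)]
      simp
    · intro i hi
      rw [if_neg (by omega), smul_zero]
    · intro i
      rw [if_neg (by omega), map_zero, smul_zero]

theorem vRep_H (x : ℂ) (n : ℤ) : vRep x (H n) = oscAt x n := by
  rw [H, vRep_mode, vertexOp_b]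

theorem vRep_vImage (x : ℂ) {S : Submodule ℂ vertexData.Env} {P : Submodule ℂ Fock}
    {v : Fock} (h : ∀ u ∈ S, fockRep x u v ∈ P) {y : vertexData.VEnv}
    (hy : y ∈ vertexData.vImage S) : vRep x y v ∈ P := by
  obtain ⟨ξ, hξ, rfl⟩ := hy
  exact complRep_closureIn x h hξ

theorem vRep_mem (x : ℂ) {p q : ℤ} {y : vertexData.VEnv} (hy : y ∈ vertexData.grading.deg p)
    {v : Fock} (hv : v ∈ grade q) : vRep x y v ∈ grade (q + p) :=
  vRep_vImage x (fun _ hu => fockRep_mem x hu hv) hy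

theorem envNL_le_envNbhd (n p : ℤ) :
    vertexData.envNL n p ≤ (vertexData.envNbhd n).restrictScalars ℂ :=
  iSup_le fun j => Submodule.mul_le.2 fun _ _ _ hu =>
    Ideal.mul_mem_left _ _ (Ideal.subset_span ⟨j, j.2, hu⟩)

/-- A factor of degree at most `-n` acts first and produces negative weight. This lets the actions
on the vacuum and on weight `d` factor through the quotients by `N_L^1` and `N_R^1`. -/
theorem vRep_NL (x : ℂ) {n p q : ℤ} (hq : q < n) {y : vertexData.VEnv}
    (hy : y ∈ vertexData.grading.NL n p) {v : Fock} (hv : v ∈ grade q) : vRep x y v = 0 :=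
  (Submodule.mem_bot ℂ).1 (vRep_vImage x (P := ⊥)
    (fun _ hu => fockRep_envNbhd x hq (envNL_le_envNbhd n p hu) hv) hy)

end Heisenberg

/-! ### Approximation inside the completed degree pieces -/

namespace GradedVertexData

variable {V : Type*} [AddCommGroup V] [Module ℂ V] (D : GradedVertexData V)

theorem envMode_mul_envMode (a c : V) (i j : ℤ) :
    D.envMode a i * D.envMode c j = D.envMode c j * D.envMode a i +
      D.envOf (∑ᶠ k : ℕ, ((Ring.choose i k : ℤ) : ℂ) • D.ancMode (D.nth k a c) (i + j - k)) := by
  have h := RingQuot.mkAlgHom_rel ℂ (EnvRel.bracket (D := D) a c i j)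
  rw [map_mul, map_add, map_mul] at h
  exact h

theorem envNbhd_le_iSup_envNL (n : ℤ) :
    (D.envNbhd n).restrictScalars ℂ ≤ ⨆ p, D.envNL n p := by
  intro u hu
  induction hu using Submodule.span_induction with
  | mem u hu =>
    obtain ⟨j, hj, hu⟩ := hu
    refine Submodule.mem_iSup_of_mem j (Submodule.mem_iSup_of_mem ⟨j, hj⟩ ?_)
    rw [← one_mul u]
    refine Submodule.mul_mem_mul ?_ hu
    simpa using D.one_mem_envDeg
  | zero => exact Submodule.zero_mem _
  | add u v _ _ hu hv => exact Submodule.add_mem _ hu hv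
  | smul r u _ hu =>
    have hr : r ∈ ⨆ d, D.envDeg d := by rw [D.iSup_envDeg]; trivial
    have h := Submodule.mul_mem_mul hr hu
    rw [Submodule.iSup_mul] at h
    refine (iSup_le fun p => ?_ : _ ≤ ⨆ d, D.envNL n d) h
    rw [Submodule.mul_iSup]
    exact iSup_le fun q => (D.envDeg_mul_envNL_le n p q).trans (le_iSup _ _)

/-- `N_L^n U` is the sum of its pieces `N_L^n U_p`, and by independence an element of `U_d` has only
its component in degree `d`. So the topology of `U` induces on `U_d` the one given by the `N_L^n
U_d`. -/
theorem envDeg_inf_envNbhd (hD : iSupIndep D.envDeg) (n d : ℤ) {u : D.Env} (hu : u ∈ D.envDeg d)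
    (hn : u ∈ D.envNbhd n) : u ∈ D.envNL n d := by
  have h : u ∈ ⨆ p, D.envNL n p := D.envNbhd_le_iSup_envNL n hn
  rw [iSup_split_single (fun p => D.envNL n p) d] at h
  obtain ⟨s, hs, t, ht, rfl⟩ := Submodule.mem_sup.1 h
  have ht' : t ∈ ⨆ j, ⨆ (_ : j ≠ d), D.envDeg j :=
    (iSup_mono fun p => iSup_mono fun _ => D.envNL_le n p) ht
  have ht'' : t ∈ D.envDeg d := by
    simpa using Submodule.sub_mem _ hu (D.envNL_le n d hs)
  rw [Submodule.disjoint_def.1 (hD d) t ht'' ht', add_zero]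
  exact hs

/-- The closure `O` of `N_L^n U` is an open subgroup of the completion, so some `u ∈ U_d` lies in
the coset of `ξ`. The difference is in `O` and in the closure of `U_d`. As `O` is open, it is in the
closure of `U_d ∩ O`, which is contained in `N_L^n U_d`. -/
theorem closureIn_envDeg_le (hD : iSupIndep D.envDeg) (n d : ℤ) {ξ : D.Compl}
    (hξ : ξ ∈ D.complDeg d) :
    ∃ u ∈ D.envDeg d, ξ - D.toCompl u ∈ D.closureIn (D.envNL n d) := by
  set N : AddSubgroup D.Env := (D.envNbhd n).toAddSubgroup
  have hN : IsOpen (N : Set D.Env) := N.isOpen_of_mem_nhds (g := 0)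
    (D.envBasis.hasBasis_nhds_zero.mem_of_mem (i := n) trivial)
  set O : AddSubgroup D.Compl := (N.map D.toCompl.toRingHom.toAddMonoidHom).topologicalClosure
  have hO : IsOpen (O : Set D.Compl) := by
    refine O.isOpen_of_mem_nhds (g := 0) ?_
    have h := UniformSpace.Completion.isDenseInducing_coe.closure_image_mem_nhds (hN.mem_nhds N.zero_mem)
    rw [UniformSpace.Completion.coe_zero] at h
    exact h
  have hA : ((D.envDeg d).map D.toCompl.toLinearMap : Set D.Compl) ∩ O ⊆
      ((D.envNL n d).map D.toCompl.toLinearMap : Set D.Compl) := by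
    rintro _ ⟨⟨u, hu, rfl⟩, hu'⟩
    refine ⟨u, D.envDeg_inf_envNbhd hD n d hu ?_, rfl⟩
    have hc : u ∈ closure (N : Set D.Env) := by
      rw [(UniformSpace.Completion.isDenseInducing_coe (α := D.Env)).isInducing.closure_eq_preimage_closure_image]
      exact hu'
    rwa [(N.isClosed_of_isOpen hN).closure_eq] at hc
  obtain ⟨_, h1, u, hu, rfl⟩ := mem_closure_iff_nhds.1 hξ ((ξ - ·) ⁻¹' O)
    ((continuous_const.sub continuous_id).continuousAt.preimage_mem_nhds
      (hO.mem_nhds (by simp [O.zero_mem])))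
  refine ⟨u, hu, closure_mono hA ?_⟩
  rw [Set.inter_comm]
  refine hO.inter_closure ⟨h1, ?_⟩
  exact (D.complDeg d).sub_mem hξ (Submodule.le_topologicalClosure _ ⟨u, hu, rfl⟩)

theorem complDeg_le_grCompl (d : ℤ) {ξ : D.Compl} (h : ξ ∈ D.complDeg d) : ξ ∈ D.GrCompl :=
  Submodule.mem_iSup_of_mem (p := D.complDeg) d h

theorem toCompl_mem_complDeg {d : ℤ} {u : D.Env} (hu : u ∈ D.envDeg d) :
    D.toCompl u ∈ D.complDeg d := Submodule.le_topologicalClosure _ ⟨u, hu, rfl⟩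

theorem toCompl_mem_grCompl (u : D.Env) : D.toCompl u ∈ D.GrCompl := by
  have h : u ∈ ⨆ d, D.envDeg d := by rw [D.iSup_envDeg]; trivial
  have hle : ⨆ d, D.envDeg d ≤ (⨆ d, D.complDeg d).comap D.toCompl.toLinearMap :=
    iSup_le fun d x hx => Submodule.mem_iSup_of_mem d (D.toCompl_mem_complDeg hx)
  exact hle h

/-- The canonical map `U → 𝒰`. -/
def ofEnv : D.Env →ₐ[ℂ] D.VEnv :=
  D.toVEnv.comp (D.toCompl.codRestrict D.GrCompl D.toCompl_mem_grCompl)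

theorem ofEnv_envMode (a : V) (n : ℤ) : D.ofEnv (D.envMode a n) = D.mode a n := rfl

theorem exists_sub_ofEnv_mem (hD : iSupIndep D.envDeg) (n d : ℤ) {y : D.VEnv}
    (hy : y ∈ D.grading.deg d) : ∃ u ∈ D.envDeg d, y - D.ofEnv u ∈ D.grading.NL n d := by
  obtain ⟨ξ, hξ, rfl⟩ := hy
  obtain ⟨u, hu, h⟩ := D.closureIn_envDeg_le hD n d hξ
  exact ⟨u, hu, ξ - ⟨D.toCompl u, D.toCompl_mem_grCompl u⟩, h, map_sub D.toVEnv _ _⟩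

end GradedVertexData

/-! ### Independence of the graded pieces of the enveloping algebra -/

namespace Heisenberg

open MvPolynomial GradedVertexData

/-- The operator multiplying states of weight `p` by `2^p`. -/
def weightOp : Fock →ₗ[ℂ] Fock :=
  (basisMonomials ℕ ℂ).constr ℂ fun s => (2 : ℂ) ^ (Finsupp.weight wt s) • monomial s 1

theorem ancMode_smul (x : ℂ) (a : Fock) (n : ℤ) :
    vertexData.ancMode (x • a) n = x • vertexData.ancMode a n := by
  rw [GradedVertexData.ancMode, ← Finsupp.smul_single]; rfl

theorem weightOp_of_mem {p : ℤ} {a : Fock} (ha : a ∈ grade p) : weightOp a = (2 : ℂ) ^ p • a := by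
  have key : (weightOp - (2 : ℂ) ^ p • LinearMap.id : Module.End ℂ Fock) a ∈ (⊥ : Submodule ℂ Fock) := by
    refine map_mem_of_monomial (fun s hs => ?_) ha
    have e : (monomial s (1 : ℂ)) = basisMonomials ℕ ℂ s := by simp
    rw [LinearMap.sub_apply, weightOp, e, Module.Basis.constr_basis, ← e, hs]
    simp
  rw [Submodule.mem_bot] at key
  exact sub_eq_zero.1 key

theorem linearMap_ext_grade {M : Type*} [AddCommGroup M] [Module ℂ M] {f g : Fock →ₗ[ℂ] M}
    (h : ∀ p, ∀ a ∈ grade p, f a = g a) : f = g :=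
  (basisMonomials ℕ ℂ).ext fun s => by
    rw [show basisMonomials ℕ ℂ s = monomial s (1 : ℂ) by simp]
    exact h _ _ (monomial_mem_grade s)

theorem weightOp_transl (a : Fock) : weightOp (transl a) = (2 : ℂ) • transl (weightOp a) := by
  have key : weightOp ∘ₗ transl = (2 : ℂ) • (transl ∘ₗ weightOp) :=
    linearMap_ext_grade fun p a ha => by
      rw [LinearMap.comp_apply, LinearMap.smul_apply, LinearMap.comp_apply, weightOp_of_mem ha,
        weightOp_of_mem (transl_mem ha), map_smul, smul_smul, zpow_add₀ two_ne_zero, zpow_one,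
        mul_comm]
  exact LinearMap.congr_fun key a

/-- The products are homogeneous, which makes the scaling by degree compatible with the bracket, so
that it extends to the enveloping algebra. -/
theorem weightOp_nth (n : ℤ) (a c : Fock) :
    weightOp (nth n a c) = (2 : ℂ) ^ (-n - 1) • nth n (weightOp a) (weightOp c) := by
  have key : (nth n).compr₂ weightOp = (2 : ℂ) ^ (-n - 1) • (nth n).compl₁₂ weightOp weightOp :=
    linearMap_ext_grade fun p a ha => linearMap_ext_grade fun q c hc => by
      rw [LinearMap.compr₂_apply, LinearMap.smul_apply, LinearMap.smul_apply,
        LinearMap.compl₁₂_apply, weightOp_of_mem ha, weightOp_of_mem hc,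
        weightOp_of_mem (nth_mem n ha hc), map_smul, map_smul, LinearMap.smul_apply, smul_smul,
        smul_smul, ← zpow_add₀ two_ne_zero, ← zpow_add₀ two_ne_zero]
      congr 2
      ring
  exact LinearMap.congr_fun₂ key a c

/-- The operator on the ancillary Lie algebra multiplying elements of degree `d` by `2^d`. -/
def ancDegreeOp : vertexData.Ancillary →ₗ[ℂ] vertexData.Ancillary :=
  Submodule.mapQ _ _ (Finsupp.lsum ℂ fun n : ℤ =>
      (2 : ℂ) ^ (-n - 1) • ((Finsupp.lsingle n : Fock →ₗ[ℂ] (ℤ →₀ Fock)) ∘ₗ weightOp)) (by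
    rw [LinearMap.range_eq_map, Submodule.map_le_iff_le_comap]
    rintro f -
    induction f using Finsupp.induction_linear with
    | zero => exact Submodule.zero_mem _
    | add f g hf hg => exact Submodule.add_mem _ hf hg
    | single n a =>
      -- The image of `a ⊗ t^n` under `nabla` has degree `deg a - n`, one more than `a ⊗ t^n`
      -- itself, hence the factor `2^(-n)` in place of `2^(-n-1)`.
      refine ⟨(2 : ℂ) ^ (-n) • Finsupp.single n (weightOp a), trivial, ?_⟩
      rw [map_smul, GradedVertexData.nabla, Finsupp.lsum_single, Finsupp.lsum_single]
      simp only [LinearMap.add_apply, LinearMap.comp_apply, LinearMap.smul_apply, map_add, map_smul,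
        Finsupp.lsingle_apply, Finsupp.lsum_single]
      change (2 : ℂ) ^ (-n) • (Finsupp.single n (transl (weightOp a)) +
          (n : ℂ) • Finsupp.single (n - 1) (weightOp a)) =
        (2 : ℂ) ^ (-n - 1) • Finsupp.single n (weightOp (transl a)) +
          (n : ℂ) • (2 : ℂ) ^ (-(n - 1) - 1) • Finsupp.single (n - 1) (weightOp a)
      have e1 : (2 : ℂ) ^ (-n) = (2 : ℂ) ^ (-n - 1) * 2 := by
        rw [zpow_sub₀ two_ne_zero, zpow_one, div_mul_cancel₀ _ two_ne_zero]
      have e2 : Finsupp.single n ((2 : ℂ) • transl (weightOp a)) =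
          (2 : ℂ) • Finsupp.single n (transl (weightOp a)) := (Finsupp.smul_single _ _ _).symm
      rw [weightOp_transl, smul_add, e2, smul_smul ((2 : ℂ) ^ (-n - 1)), ← e1,
        smul_comm ((2 : ℂ) ^ (-n)), show -(n - 1) - 1 = -n by ring])

theorem ancDegreeOp_ancMode (a : Fock) (n : ℤ) :
    ancDegreeOp (vertexData.ancMode a n) =
      (2 : ℂ) ^ (-n - 1) • vertexData.ancMode (weightOp a) n := by
  rw [ancDegreeOp, GradedVertexData.ancMode]
  erw [Submodule.mapQ_apply]
  rw [Finsupp.lsum_single]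
  rfl

/-- The endomorphism of the enveloping algebra multiplying elements of degree `d` by `2^d`. -/
def degreeHom : vertexData.Env →ₐ[ℂ] vertexData.Env :=
  RingQuot.liftAlgHom ℂ ⟨TensorAlgebra.lift ℂ (vertexData.envOf ∘ₗ ancDegreeOp), by
    rintro _ _ ⟨a, c, i, j⟩
    have hz := ancMode_eventuallyZero a c 0 (i + j)
    have hz' := ancMode_eventuallyZero (weightOp a) (weightOp c) 0 (i + j)
    simp only [zero_add] at hz hz'
    rw [map_add, map_mul, map_mul, TensorAlgebra.lift_ι_apply, TensorAlgebra.lift_ι_apply,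
      TensorAlgebra.lift_ι_apply, LinearMap.comp_apply, LinearMap.comp_apply, LinearMap.comp_apply,
      ancDegreeOp_ancMode, ancDegreeOp_ancMode,
      ((hz.smul fun k => ((Ring.choose i k : ℤ) : ℂ))).map_finsum, map_smul, map_smul]
    have e1 := vertexData.envMode_mul_envMode (weightOp a) (weightOp c) i j
    have e2 : ∑ᶠ k : ℕ, ancDegreeOp (((Ring.choose i k : ℤ) : ℂ) •
          vertexData.ancMode (vertexData.nth k a c) (i + j - k)) =
        (2 : ℂ) ^ (-i - 1) • (2 : ℂ) ^ (-j - 1) • ∑ᶠ k : ℕ, ((Ring.choose i k : ℤ) : ℂ) •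
          vertexData.ancMode (vertexData.nth k (weightOp a) (weightOp c)) (i + j - k) := by
      rw [smul_smul, (hz'.smul fun k => ((Ring.choose i k : ℤ) : ℂ)).smul_finsum]
      refine finsum_congr fun k => ?_
      rw [map_smul, ancDegreeOp_ancMode]
      change _ • _ • vertexData.ancMode (weightOp (nth k a c)) _ = _
      rw [weightOp_nth]
      rw [ancMode_smul, 
        smul_comm ((2 : ℂ) ^ (-i - 1) * _) ((Ring.choose i k : ℤ) : ℂ), smul_smul ((2 : ℂ) ^ _)]
      congr 2
      rw [← zpow_add₀ two_ne_zero, ← zpow_add₀ two_ne_zero]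
      congr 1
      ring
    rw [e2, map_smul, map_smul]
    rw [smul_mul_smul_comm, smul_mul_smul_comm, smul_smul, mul_comm ((2 : ℂ) ^ (-j - 1)),
      ← smul_add]
    exact congrArg _ e1⟩

theorem degreeHom_envMode (a : Fock) (n : ℤ) :
    degreeHom (vertexData.envMode a n) =
      (2 : ℂ) ^ (-n - 1) • vertexData.envMode (weightOp a) n := by
  refine (RingQuot.liftAlgHom_mkAlgHom_apply (S := ℂ) (s := vertexData.EnvRel)
    (f := TensorAlgebra.lift ℂ (vertexData.envOf ∘ₗ ancDegreeOp)) _ _).trans ?_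
  rw [TensorAlgebra.lift_ι_apply, LinearMap.comp_apply, ancDegreeOp_ancMode, map_smul]
  rfl

theorem degreeHom_of_mem {d : ℤ} {u : vertexData.Env} (hu : u ∈ vertexData.envDeg d) :
    degreeHom u = (2 : ℂ) ^ d • u := by
  induction hu using Submodule.span_induction with
  | mem u hu =>
    induction hu with
    | one => simp
    | @cons p d a u ha n hu ih =>
      have e : vertexData.envMode (weightOp a) n = (2 : ℂ) ^ p • vertexData.envMode a n := by
        rw [weightOp_of_mem ha, envMode, ancMode_smul, map_smul]
        rfl
      rw [map_mul, degreeHom_envMode, ih, e, smul_smul, smul_mul_smul_comm,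
        ← zpow_add₀ two_ne_zero, ← zpow_add₀ two_ne_zero]
      congr 2
      ring
  | zero => simp
  | add u u' _ _ h h' => rw [map_add, h, h', smul_add]
  | smul c u _ h => rw [map_smul, h, smul_comm]

/-- `U_d` lies in the eigenspace of `degreeHom` for `2^d`. These eigenvalues are distinct, as their
absolute values are, and eigenspaces for distinct eigenvalues are independent. -/
theorem iSupIndep_envDeg : iSupIndep vertexData.envDeg := by
  have h := Module.End.eigenspaces_iSupIndep degreeHom.toLinearMap
  have hinj : Function.Injective fun d : ℤ => (2 : ℂ) ^ d := by
    intro p q hpq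
    have h2 := congrArg norm (show (2 : ℂ) ^ p = 2 ^ q from hpq)
    rw [norm_zpow, norm_zpow, Complex.norm_ofNat] at h2
    exact zpow_right_injective₀ (by norm_num) (by norm_num) h2
  exact (h.comp hinj).mono fun d u hu => Module.End.mem_eigenspace_iff.2 (degreeHom_of_mem hu)

end Heisenberg

/-! ### Convergent series in the completion -/

namespace GradedVertexData

variable {V : Type*} [AddCommGroup V] [Module ℂ V] (D : GradedVertexData V)

theorem envMode_mem {p : ℤ} {a : V} (ha : a ∈ D.grade p) (n : ℤ) :
    D.envMode a n ∈ D.envDeg (p - n - 1) := by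
  have h := IsMonomial.cons ha n (IsMonomial.one (D := D))
  rw [mul_one, add_zero] at h
  exact Submodule.subset_span h

theorem mul_mem_envNL {n e f d : ℤ} (hf : f ≤ -n) (hd : e + f = d) {u w : D.Env}
    (hu : u ∈ D.envDeg e) (hw : w ∈ D.envDeg f) : u * w ∈ D.envNL n d :=
  Submodule.mem_iSup_of_mem (⟨f, hf⟩ : {j : ℤ // j ≤ -n})
    (Submodule.mul_mem_mul (by rwa [← hd, add_sub_cancel_right]) hw)

/-- The closure of `J` is generated degree by degree, so homogeneity of `ξ` gives membership in it
at once. -/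
theorem toVEnv_eq_zero {ξ : D.GrCompl} (hξ : ξ ∈ D.jacobiIdeal) {d : ℤ}
    (hd : (ξ : D.Compl) ∈ D.complDeg d) : D.toVEnv ξ = 0 := by
  have h : ξ ∈ D.jacobiClosure := TwoSidedIdeal.subset_span ⟨d, subset_closure ⟨hξ, hd⟩⟩
  rw [← TwoSidedIdeal.ker_ringCon_mk' D.jacobiClosure] at h
  exact (TwoSidedIdeal.mem_ker _).1 h

theorem mode_vacuum : D.mode D.vacuum (-1) = 1 := by
  have hd : D.complMode D.vacuum (-1) - 1 ∈ D.complDeg 0 :=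
    Submodule.sub_mem _ (by simpa using D.complMode_mem D.vacuum_mem (-1)) D.one_mem_complDeg
  have h := D.toVEnv_eq_zero (ξ := ⟨_, D.complDeg_le_grCompl 0 hd⟩)
    (TwoSidedIdeal.subset_span (Or.inr rfl)) hd
  refine sub_eq_zero.1 (Eq.trans ?_ h)
  rw [mode, ← map_one D.toVEnv, ← map_sub]
  rfl

instance : NonarchimedeanRing D.Env := D.envBasis.nonarchimedean

theorem tendsto_zero_of_forall_envNL {d : ℤ} {g : ℕ → D.Env}
    (hg : ∀ N, ∃ k, ∀ i, k ≤ i → g i ∈ D.envNL N d) :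
    Filter.Tendsto g Filter.cofinite (nhds 0) := by
  rw [Nat.cofinite_eq_atTop, D.envBasis.hasBasis_nhds_zero.tendsto_right_iff]
  intro N _
  obtain ⟨k, hk⟩ := hg N
  refine Filter.eventually_atTop.2 ⟨k, fun i hi => ?_⟩
  have h : D.envNL N d ≤ (D.envNbhd N).restrictScalars ℂ :=
    iSup_le fun j => Submodule.mul_le.2 fun _ _ _ hu =>
      Ideal.mul_mem_left _ _ (Ideal.subset_span ⟨j, j.2, hu⟩)
  exact h (hk i hi)

/-- The topology is nonarchimedean and the completion complete, so a series converges as soon as its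
terms tend to zero. -/
theorem summable_toCompl {d : ℤ} {g : ℕ → D.Env}
    (hg : ∀ N, ∃ k, ∀ i, k ≤ i → g i ∈ D.envNL N d) : Summable fun i => D.toCompl (g i) := by
  refine NonarchimedeanAddGroup.summable_of_tendsto_cofinite_zero ?_
  have h := (UniformSpace.Completion.continuous_coe D.Env).tendsto 0
  rw [UniformSpace.Completion.coe_zero] at h
  exact h.comp (D.tendsto_zero_of_forall_envNL hg)

theorem sub_sum_mem_closureIn {d N : ℤ} {k : ℕ} {g : ℕ → D.Env}
    (hg : ∀ i, k ≤ i → g i ∈ D.envNL N d) {S : D.Compl} (hS : HasSum (fun i => D.toCompl (g i)) S) :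
    S - D.toCompl (∑ i ∈ Finset.range k, g i) ∈ D.closureIn (D.envNL N d) := by
  rw [map_sum]
  have h := (hasSum_nat_add_iff' k).2 hS
  refine IsClosed.mem_of_tendsto (Submodule.isClosed_topologicalClosure _) h
    (Filter.Eventually.of_forall fun s => Submodule.sum_mem _ fun i _ => ?_)
  exact Submodule.le_topologicalClosure _ ⟨_, hg _ (by omega), rfl⟩

end GradedVertexData

/-! ### Density of the polynomials in the Heisenberg modes -/

namespace Heisenberg

open MvPolynomial GradedVertexData

/-- The span of the products of the `H_n` of total degree `d`. -/
def modeSpan (d : ℤ) : Submodule ℂ vertexData.VEnv :=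
  Submodule.span ℂ {y | ∃ l : List ℤ, -l.sum = d ∧ (l.map H).prod = y}

theorem modeSpan_le (d : ℤ) : modeSpan d ≤ vertexData.grading.deg d := by
  refine Submodule.span_le.2 ?_
  rintro _ ⟨l, rfl, rfl⟩
  exact list_prod_mem l

theorem modeSpan_mul {p q : ℤ} {y z : vertexData.VEnv} (hy : y ∈ modeSpan p)
    (hz : z ∈ modeSpan q) : y * z ∈ modeSpan (p + q) := by
  have h : modeSpan p * modeSpan q ≤ modeSpan (p + q) := by
    rw [modeSpan, modeSpan, Submodule.span_mul_span, Submodule.span_le]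
    rintro _ ⟨_, ⟨l, rfl, rfl⟩, _, ⟨l', rfl, rfl⟩, rfl⟩
    refine Submodule.subset_span ⟨l ++ l', ?_, ?_⟩
    · rw [List.sum_append, neg_add]
    · rw [List.map_append, List.prod_append]
  exact h (Submodule.mul_mem_mul hy hz)

/-- The elements of degree `d` which can be approximated by polynomials in the `H_n`. -/
def modeClosure (d : ℤ) : Submodule ℂ vertexData.VEnv :=
  ⨅ n, modeSpan d ⊔ vertexData.grading.NL n d

theorem modeSpan_le_modeClosure (d : ℤ) : modeSpan d ≤ modeClosure d :=
  le_iInf fun _ => le_sup_left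

theorem modeClosure_mul {p q : ℤ} {y z : vertexData.VEnv} (hy : y ∈ modeClosure p)
    (hz : z ∈ modeClosure q) : y * z ∈ modeClosure (p + q) := by
  refine (Submodule.mem_iInf _).2 fun n => ?_
  -- Right multiplication by degree `q` lowers the order of a left neighbourhood by `q`, so `y` is
  -- approximated to order `n + q`.
  obtain ⟨y₁, hy₁, y₂, hy₂, rfl⟩ := Submodule.mem_sup.1 ((Submodule.mem_iInf _).1 hy (n + q))
  obtain ⟨z₁, hz₁, z₂, hz₂, rfl⟩ := Submodule.mem_sup.1 ((Submodule.mem_iInf _).1 hz n)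
  rw [add_mul, mul_add, add_assoc]
  refine Submodule.add_mem_sup (modeSpan_mul hy₁ hz₁) (Submodule.add_mem _ ?_ ?_)
  · exact vertexData.grading.mul_NL (modeSpan_le _ hy₁) hz₂
  · have h := vertexData.grading.NL_mul hy₂
      (Submodule.add_mem _ (modeSpan_le _ hz₁) (vertexData.grading.NL_le _ _ hz₂))
    rwa [add_sub_cancel_right] at h

theorem H_mem_modeClosure (n : ℤ) : H n ∈ modeClosure (-n) :=
  modeSpan_le_modeClosure _ (Submodule.subset_span ⟨[n], by simp, by simp⟩)

/-- As `T 1 = 0`, `nabla` sends `1 ⊗ t^(n+1)` to `(n+1) (1 ⊗ t^n)`, which kills the mode for `n ≠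
-1`. The case `n = -1` is the vacuum relation. -/
theorem mode_one (n : ℤ) : vertexData.mode 1 n = if n = -1 then 1 else 0 := by
  split_ifs with h
  · rw [h]
    exact vertexData.mode_vacuum
  · have hn : ((n : ℂ) + 1) ≠ 0 := by
      exact_mod_cast fun h' : n + 1 = 0 => h (by omega)
    have h0 : vertexData.ancMode (1 : Fock) n = 0 := by
      refine (Submodule.Quotient.mk_eq_zero _).2
        ⟨((n : ℂ) + 1)⁻¹ • Finsupp.single (n + 1) 1, ?_⟩
      have ht : vertexData.T (1 : Fock) = 0 := by
        change transl 1 = 0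
        simp [transl]
      rw [map_smul, GradedVertexData.nabla, Finsupp.lsum_single, LinearMap.add_apply,
        LinearMap.comp_apply, ht, map_zero, zero_add, LinearMap.smul_apply, smul_smul,
        Finsupp.lsingle_apply, add_sub_cancel_right]
      push_cast
      rw [inv_mul_cancel₀ hn, one_smul]
    rw [← ofEnv_envMode, envMode, h0, map_zero, map_zero]

/-- The terms of the series expressing the modes of `b_{-j-1} a` by those of `b` and `a`. -/
def normalOrdTerm (j : ℕ) (a : Fock) (n : ℤ) (i : ℕ) : vertexData.Env :=
  ((-1 : ℂ) ^ i * ((Ring.choose (-j - 1 : ℤ) i : ℤ) : ℂ)) •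
    (vertexData.envMode b (0 + (-j - 1) - i) * vertexData.envMode a (n + i)
      - (-1 : ℂ) ^ (-j - 1 : ℤ) •
        (vertexData.envMode a (n + (-j - 1) - i) * vertexData.envMode b (0 + i)))

theorem b_mem : b ∈ vertexData.grade 1 := by
  have hb : b ∈ vertexData.grade (wt 0) := isWeightedHomogeneous_X ℂ wt 0
  rwa [show wt 0 = 1 by simp [wt]] at hb

/-- The right-hand factors `a_[n+i]` and `b_[i]` have degrees `p - n - i - 1` and `-i`, which tend
to `-∞`. -/
theorem normalOrdTerm_mem (j : ℕ) {p : ℤ} {a : Fock} (ha : a ∈ vertexData.grade p) (n N : ℤ)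
    {i : ℕ} (hi : N ≤ i) (hi' : N + p - n - 1 ≤ i) :
    normalOrdTerm j a n i ∈ vertexData.envNL N (wt j + p - n - 1) :=
  Submodule.smul_mem _ _ (Submodule.sub_mem _
    (vertexData.mul_mem_envNL (by omega) (by rw [wt]; ring) (vertexData.envMode_mem b_mem _)
      (vertexData.envMode_mem ha _))
    (Submodule.smul_mem _ _ (vertexData.mul_mem_envNL (by omega) (by rw [wt]; ring)
      (vertexData.envMode_mem ha _) (vertexData.envMode_mem b_mem _))))

theorem nth_b (n : ℤ) (a : Fock) : nth n b a = osc n a := by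
  rw [nth_eq_stateProd, stateProd, vertexOp_b]

/-- The Jacobi relation for `b` and `a` with `ℓ = -j - 1` and `m = 0`. On its right-hand side `(0
choose i)` leaves only `i = 0`, and `b_(-j-1) a = X j * a`. -/
theorem mode_X_mul (j : ℕ) {p : ℤ} {a : Fock} (ha : a ∈ vertexData.grade p) (n : ℤ) :
    ∃ S : vertexData.GrCompl,
      HasSum (fun i => vertexData.toCompl (normalOrdTerm j a n i)) (S : vertexData.Compl) ∧
      vertexData.toVEnv S = vertexData.mode (X j * a) n := by
  set d := wt j + p - n - 1
  have hs : Summable fun i => vertexData.toCompl (normalOrdTerm j a n i) :=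
    vertexData.summable_toCompl (d := d) fun N =>
      ⟨(max N (N + p - n - 1)).toNat, fun i hi => normalOrdTerm_mem j ha n N (by omega) (by omega)⟩
  obtain ⟨S, hS⟩ := hs
  have hS' : S ∈ vertexData.complDeg d := by
    refine IsClosed.mem_of_tendsto (Submodule.isClosed_topologicalClosure _) hS
      (Filter.Eventually.of_forall fun s => Submodule.sum_mem _ fun i _ => ?_)
    exact vertexData.toCompl_mem_complDeg (vertexData.envNL_le _ _
      -- Here only the degree of the term matters, so `N` is the largest order that both bounds
      -- allow for the given `i`.
      (normalOrdTerm_mem j ha n (min i (i - p + n + 1)) (by omega) (by omega)))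
  have hX : X j * a ∈ vertexData.grade (wt j + p) :=
    IsWeightedHomogeneous.mul (isWeightedHomogeneous_X ℂ wt j) ha
  have hd : S - vertexData.complMode (X j * a) n ∈ vertexData.complDeg d :=
    Submodule.sub_mem _ hS' (vertexData.complMode_mem hX n)
  refine ⟨⟨S, vertexData.complDeg_le_grCompl d hS'⟩, hS, ?_⟩
  have h := vertexData.toVEnv_eq_zero
    (ξ := ⟨_, vertexData.complDeg_le_grCompl d hd⟩)
    (TwoSidedIdeal.subset_span (Or.inl ⟨b, a, -j - 1, 0, n, ?_⟩)) hd
  · refine sub_eq_zero.1 (Eq.trans ?_ h)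
    rw [mode, ← map_sub]
    rfl
  · convert hS using 1
    · funext i
      rw [normalOrdTerm, map_smul, map_sub, map_smul, map_mul, map_mul]
      rfl
    · rw [finsum_eq_single _ 0]
      · have e : vertexData.nth (-j - 1) b a = X j * a := by
          refine (nth_b _ a).trans (osc_neg j _ rfl a)
        simp [e]
      · intro i hi
        rw [Ring.choose_zero_pos ℤ (Nat.pos_of_ne_zero hi)]
        simp

/-- The series of `mode_X_mul` is cut at an index beyond which all terms are in `N_L^N`. The partial
sum is a polynomial in the `H_n` and the modes of `a`, and the tail stays in the closed
neighbourhood. -/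
theorem mode_X_mul_mem (j : ℕ) {p : ℤ} {a : Fock} (ha : a ∈ vertexData.grade p)
    (h : ∀ n, vertexData.mode a n ∈ modeClosure (p - n - 1)) (n : ℤ) :
    vertexData.mode (X j * a) n ∈ modeClosure (wt j + p - n - 1) := by
  obtain ⟨S, hS, hS'⟩ := mode_X_mul j ha n
  rw [← hS']
  refine (Submodule.mem_iInf _).2 fun N => ?_
  set k := (max N (N + p - n - 1)).toNat
  have h1 := vertexData.sub_sum_mem_closureIn (k := k) (N := N) (d := wt j + p - n - 1)
    (fun i hi => normalOrdTerm_mem j ha n N (by omega) (by omega)) hS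
  have h2 : vertexData.ofEnv (∑ i ∈ Finset.range k, normalOrdTerm j a n i) ∈
      modeClosure (wt j + p - n - 1) := by
    rw [map_sum]
    refine Submodule.sum_mem _ fun i _ => ?_
    rw [normalOrdTerm, map_smul, map_sub, map_smul, map_mul, map_mul, ofEnv_envMode, ofEnv_envMode,
      ofEnv_envMode, ofEnv_envMode]
    change _ • (H _ * _ - _ • (_ * H _)) ∈ _
    refine Submodule.smul_mem _ _ (Submodule.sub_mem _ ?_ (Submodule.smul_mem _ _ ?_))
    · convert modeClosure_mul (H_mem_modeClosure (0 + (-j - 1) - i)) (h (n + i)) using 2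
      rw [wt]; ring
    · convert modeClosure_mul (h (n + (-j - 1) - i)) (H_mem_modeClosure (0 + i)) using 2
      rw [wt]; ring
  have h3 : vertexData.toVEnv S - vertexData.ofEnv (∑ i ∈ Finset.range k, normalOrdTerm j a n i) ∈
      vertexData.grading.NL N (wt j + p - n - 1) :=
    ⟨S - ⟨_, vertexData.toCompl_mem_grCompl _⟩, h1, map_sub vertexData.toVEnv _ _⟩
  have h4 := Submodule.add_mem _ ((Submodule.mem_iInf _).1 h2 N) (Submodule.mem_sup_right h3)
  rwa [add_sub_cancel] at h4

theorem mode_mem_modeClosure {p : ℤ} {a : Fock} (ha : a ∈ vertexData.grade p) (n : ℤ) :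
    vertexData.mode a n ∈ modeClosure (p - n - 1) := by
  have hl : ∀ l : List ℕ, ∀ n, (l.map X).prod ∈ vertexData.grade (l.map wt).sum ∧
      vertexData.mode (l.map X).prod n ∈ modeClosure ((l.map wt).sum - n - 1) := by
    intro l
    induction l with
    | nil =>
      intro n
      refine ⟨isWeightedHomogeneous_one ℂ wt, ?_⟩
      rw [List.map_nil, List.map_nil, List.prod_nil, mode_one]
      split_ifs with h
      · exact modeSpan_le_modeClosure _ (Submodule.subset_span ⟨[], by simp [h], by simp⟩)
      · exact Submodule.zero_mem _
    | cons j l ih =>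
      intro n
      rw [List.map_cons, List.map_cons, List.prod_cons, List.sum_cons]
      exact ⟨IsWeightedHomogeneous.mul (isWeightedHomogeneous_X ℂ wt j) (ih n).1,
        mode_X_mul_mem j (ih n).1 (fun n => (ih n).2) n⟩
  set f : Fock →ₗ[ℂ] vertexData.VEnv := vertexData.ofEnv.toLinearMap ∘ₗ vertexData.envOf ∘ₗ
    Submodule.mkQ _ ∘ₗ (Finsupp.lsingle n : Fock →ₗ[ℂ] (ℤ →₀ Fock)) with hf
  change f a ∈ _
  rw [a.as_sum, map_sum]
  refine Submodule.sum_mem _ fun s hs => ?_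
  have e : (monomial s (coeff s a) : Fock) = coeff s a • monomial s 1 := by
    rw [smul_monomial, smul_eq_mul, mul_one]
  rw [e, map_smul]
  refine Submodule.smul_mem _ _ ?_
  have h := (hl (Finsupp.toMultiset s).sort n).2
  rw [← Multiset.prod_coe, ← Multiset.map_coe, ← Multiset.sum_coe, ← Multiset.map_coe,
    Multiset.sort_eq, ← monomial_eq_prod, ← weight_eq_sum, ha (mem_support_iff.1 hs)] at h
  exact h

theorem ofEnv_mem_modeClosure {d : ℤ} {u : vertexData.Env} (hu : u ∈ vertexData.envDeg d) :
    vertexData.ofEnv u ∈ modeClosure d := by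
  induction hu using Submodule.span_induction with
  | mem u hu =>
    induction hu with
    | one =>
      rw [map_one]
      exact modeSpan_le_modeClosure _ (Submodule.subset_span ⟨[], by simp, by simp⟩)
    | @cons p d a u ha n hu ih =>
      rw [map_mul]
      exact modeClosure_mul (mode_mem_modeClosure ha n) ih
  | zero => simp
  | add u u' _ _ h h' =>
    rw [map_add]
    exact Submodule.add_mem _ h h'
  | smul c u _ h =>
    rw [map_smul]
    exact Submodule.smul_mem _ _ h

/-- Polynomials in the `H_n` are dense in `𝒰(π)_d`. -/
theorem deg_le_sup (n d : ℤ) :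
    vertexData.grading.deg d ≤ modeSpan d ⊔ vertexData.grading.NL n d := by
  intro y hy
  obtain ⟨u, hu, h⟩ := vertexData.exists_sub_ofEnv_mem iSupIndep_envDeg n d hy
  have h' := Submodule.add_mem _ ((Submodule.mem_iInf _).1 (ofEnv_mem_modeClosure hu) n)
    (Submodule.mem_sup_right h)
  rwa [add_sub_cancel] at h'

end Heisenberg

/-! ### Normal ordering in `𝒰(π)` -/

namespace GradedVertexData

variable {V : Type*} [AddCommGroup V] [Module ℂ V] (D : GradedVertexData V)

/-- Since `1 ∈ U_0`, the piece `U_p` is contained in the summand `U_0 U_p` of `N_L^n U_p`. -/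
theorem mem_NL_of_mem_deg {n p : ℤ} (h : p ≤ -n) {y : D.VEnv} (hy : y ∈ D.grading.deg p) :
    y ∈ D.grading.NL n p := by
  refine D.vImage_mono (fun u hu => ?_) hy
  rw [← one_mul u]
  exact D.mul_mem_envNL h (zero_add p) D.one_mem_envDeg hu

end GradedVertexData

namespace Heisenberg

open MvPolynomial GradedVertexData

/-- Among the products `b_(k) b` with `k ≥ 0` only `b_(1) b = |0⟩` is nonzero. The commutator is
thus `m` times the vacuum mode of index `m + n - 1`, which `mode_one` evaluates. -/
theorem H_mul_H (m n : ℤ) :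
    H m * H n = H n * H m + if m + n = 0 then algebraMap ℂ _ (m : ℂ) else 0 := by
  have h := congrArg vertexData.ofEnv (vertexData.envMode_mul_envMode b b m n)
  have e : vertexData.ofEnv (vertexData.envOf (∑ᶠ k : ℕ, ((Ring.choose m k : ℤ) : ℂ) •
      vertexData.ancMode (vertexData.nth k b b) (m + n - k))) =
      if m + n = 0 then algebraMap ℂ vertexData.VEnv (m : ℂ) else 0 := by
    have hb : ∀ k : ℕ, vertexData.nth k b b = if k = 1 then 1 else 0 := fun k => by
      have h1 : vertexData.nth k b b = osc k b := nth_b k b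
      rw [h1, b, ← mul_one (X 0), osc_nat_X_mul, osc_nat_one]
      simp
    rw [finsum_eq_single _ 1]
    · rw [hb, if_pos rfl, Ring.choose_one_right, map_smul, map_smul]
      change _ • vertexData.mode 1 _ = _
      rw [mode_one, Algebra.algebraMap_eq_smul_one]
      by_cases h : m + n = 0
      · rw [if_pos (by omega), if_pos h]
      · rw [if_neg (by omega), if_neg h, smul_zero]
    · intro k hk
      rw [hb, if_neg hk, ancMode_zero, smul_zero]
  rw [map_add, map_mul, map_mul, e] at h
  exact h

theorem commute_H {m n : ℤ} (h : m + n ≠ 0) : Commute (H m) (H n) := by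
  rw [Commute, SemiconjBy, H_mul_H, if_neg h, add_zero]

/-- The product of creation operators with the given indices. -/
def lower (l : List ℕ) : vertexData.VEnv := (l.map fun i => H (-wt i)).prod

/-- The product of annihilation operators with the given indices. -/
def raise (l : List ℕ) : vertexData.VEnv := (l.map fun i => H (wt i)).prod

theorem lower_mem (l : List ℕ) : lower l ∈ vertexData.grading.deg (l.map wt).sum := by
  have h := list_prod_mem (l.map fun i => -wt i)
  have e : -(l.map fun i => -wt i).sum = (l.map wt).sum := by
    clear h
    induction l with
    | nil => simp
    | cons j l ih => simp [← ih, add_comm]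
  rwa [List.map_map, e] at h

theorem raise_mem (l : List ℕ) : raise l ∈ vertexData.grading.deg (-(l.map wt).sum) := by
  have h := list_prod_mem (l.map wt)
  rwa [List.map_map] at h

/-- The span of the normally ordered monomials of degree `d`. -/
def normalSpan (d : ℤ) : Submodule ℂ vertexData.VEnv :=
  Submodule.span ℂ {y | ∃ (l : List ℕ) (k : ℕ) (l' : List ℕ),
    (l.map wt).sum - (l'.map wt).sum = d ∧ lower l * H 0 ^ k * raise l' = y}

theorem lower_mul_mem (i : ℕ) {d : ℤ} {y : vertexData.VEnv} (hy : y ∈ normalSpan d) :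
    H (-wt i) * y ∈ normalSpan (d + wt i) := by
  induction hy using Submodule.span_induction with
  | mem y hy =>
    obtain ⟨l, k, l', rfl, rfl⟩ := hy
    refine Submodule.subset_span ⟨i :: l, k, l', ?_, ?_⟩
    · rw [List.map_cons, List.sum_cons]; ring
    · rw [lower, List.map_cons, List.prod_cons, lower, mul_assoc, mul_assoc, mul_assoc]
  | zero => simp
  | add y z _ _ hy hz => rw [mul_add]; exact Submodule.add_mem _ hy hz
  | smul c y _ hy => rw [mul_smul_comm]; exact Submodule.smul_mem _ _ hy

theorem commute_H_zero (n : ℤ) : Commute (H 0) (H n) := by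
  by_cases h : n = 0
  · rw [h]
  · exact commute_H (by omega)

/-- The annihilation operator is moved past the creation operators one at a time. Each step leaves a
scalar multiple of a shorter normally ordered monomial. -/
theorem raise_mul_mem (i : ℕ) (l : List ℕ) (k : ℕ) (l' : List ℕ) :
    H (wt i) * (lower l * H 0 ^ k * raise l') ∈
      normalSpan ((l.map wt).sum - (l'.map wt).sum - wt i) := by
  induction l with
  | nil =>
    refine Submodule.subset_span ⟨[], k, i :: l', ?_, ?_⟩
    · rw [List.map_cons, List.sum_cons]; ring
    · rw [raise, List.map_cons, List.prod_cons, raise, lower, List.map_nil, List.prod_nil, one_mul,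
        ← mul_assoc, ← mul_assoc, ((commute_H_zero _).pow_left k).eq]
  | cons j l ih =>
    have e : lower (j :: l) * H 0 ^ k * raise l' =
        H (-wt j) * (lower l * H 0 ^ k * raise l') := by
      rw [lower, List.map_cons, List.prod_cons, lower, mul_assoc, mul_assoc, mul_assoc]
    rw [e, ← mul_assoc, H_mul_H, add_mul, mul_assoc]
    refine Submodule.add_mem _ ?_ ?_
    · convert lower_mul_mem j ih using 2
      rw [List.map_cons, List.sum_cons]; ring
    · split_ifs with h
      · rw [← Algebra.smul_def]
        refine Submodule.smul_mem _ _ (Submodule.subset_span ⟨l, k, l', ?_, rfl⟩)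
        rw [List.map_cons, List.sum_cons]; linarith
      · rw [zero_mul]; exact Submodule.zero_mem _

theorem H_mul_mem (n : ℤ) {d : ℤ} {y : vertexData.VEnv} (hy : y ∈ normalSpan d) :
    H n * y ∈ normalSpan (d - n) := by
  rcases lt_trichotomy n 0 with hn | rfl | hn
  · obtain ⟨i, rfl⟩ : ∃ i : ℕ, n = -wt i := ⟨(-n - 1).toNat, by rw [wt]; omega⟩
    rw [sub_neg_eq_add]
    exact lower_mul_mem i hy
  · rw [sub_zero]
    induction hy using Submodule.span_induction with
    | mem y hy =>
      obtain ⟨l, k, l', rfl, rfl⟩ := hy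
      refine Submodule.subset_span ⟨l, k + 1, l', rfl, ?_⟩
      have hc : Commute (H 0) (lower l) := Commute.list_prod_right _ _ fun x hx => by
        obtain ⟨i, -, rfl⟩ := List.mem_map.1 hx
        exact commute_H_zero _
      rw [pow_succ', ← mul_assoc, ← mul_assoc, ← mul_assoc, hc.eq]
    | zero => simp
    | add y z _ _ hy hz => rw [mul_add]; exact Submodule.add_mem _ hy hz
    | smul c y _ hy => rw [mul_smul_comm]; exact Submodule.smul_mem _ _ hy
  · obtain ⟨i, rfl⟩ : ∃ i : ℕ, n = wt i := ⟨(n - 1).toNat, by rw [wt]; omega⟩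
    induction hy using Submodule.span_induction with
    | mem y hy =>
      obtain ⟨l, k, l', rfl, rfl⟩ := hy
      exact raise_mul_mem i l k l'
    | zero => simp
    | add y z _ _ hy hz => rw [mul_add]; exact Submodule.add_mem _ hy hz
    | smul c y _ hy => rw [mul_smul_comm]; exact Submodule.smul_mem _ _ hy

/-- The spanning half of a Poincaré–Birkhoff–Witt theorem: normally ordered monomials contain `1`,
and their span is stable under left multiplication by every `H n`. -/
theorem modeSpan_le_normalSpan (d : ℤ) : modeSpan d ≤ normalSpan d := by
  refine Submodule.span_le.2 ?_
  rintro _ ⟨l, rfl, rfl⟩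
  induction l with
  | nil => exact Submodule.subset_span ⟨[], 0, [], by simp, by simp [lower, raise]⟩
  | cons n l ih =>
    rw [List.map_cons, List.prod_cons, List.sum_cons, neg_add, neg_add_eq_sub]
    exact H_mul_mem n ih

theorem sum_wt_nonneg (l : List ℕ) : 0 ≤ (l.map wt).sum :=
  List.sum_nonneg fun x hx => by
    obtain ⟨i, -, rfl⟩ := List.mem_map.1 hx
    rw [wt]; positivity

theorem one_le_sum_wt {l : List ℕ} (h : l ≠ []) : 1 ≤ (l.map wt).sum := by
  obtain ⟨i, l, rfl⟩ := List.exists_cons_of_ne_nil h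
  rw [List.map_cons, List.sum_cons, wt]
  have := sum_wt_nonneg l
  omega

theorem H_zero_pow_mul_raise_mem (k : ℕ) (l : List ℕ) :
    H 0 ^ k * raise l ∈ vertexData.grading.deg (-(l.map wt).sum) := by
  simpa using vertexData.grading.mul_mem (H_zero_pow_mem k) (raise_mem l)

/-- A nonempty product of annihilation operators has degree at most `-1`, so a normally ordered
monomial containing one lies in `N_L^1`. -/
theorem deg_le_lower (d : ℤ) :
    vertexData.grading.deg d ≤
      Submodule.span ℂ {y | ∃ (l : List ℕ) (k : ℕ), (l.map wt).sum = d ∧ lower l * H 0 ^ k = y} ⊔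
        vertexData.grading.NL 1 d := by
  refine (deg_le_sup 1 d).trans (sup_le ((modeSpan_le_normalSpan d).trans ?_) le_sup_right)
  refine Submodule.span_le.2 ?_
  rintro _ ⟨l, k, l', rfl, rfl⟩
  by_cases h : l' = []
  · subst h
    refine Submodule.mem_sup_left (Submodule.subset_span ⟨l, k, by simp, by simp [raise]⟩)
  · refine Submodule.mem_sup_right ?_
    have h1 := one_le_sum_wt h
    rw [mul_assoc]
    exact vertexData.grading.mul_NL (lower_mem l)
      (vertexData.mem_NL_of_mem_deg (by omega) (H_zero_pow_mul_raise_mem k l'))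

/-- In degree `-d` one has `N_R^1 = N_L^(1+d)`. If a creation operator occurs, the part of the
monomial to the right of the creation operators has degree at most `-d - 1`. -/
theorem deg_le_raise (d : ℤ) :
    vertexData.grading.deg (-d) ≤
      Submodule.span ℂ {y | ∃ (k : ℕ) (l : List ℕ), (l.map wt).sum = d ∧ H 0 ^ k * raise l = y} ⊔
        vertexData.grading.NR 1 (-d) := by
  rw [show (1 : ℤ) = 1 + d + -d by ring, vertexData.grading.NR_eq]
  refine (deg_le_sup (1 + d) (-d)).trans (sup_le ((modeSpan_le_normalSpan (-d)).trans ?_)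
    le_sup_right)
  refine Submodule.span_le.2 ?_
  rintro _ ⟨l, k, l', hd, rfl⟩
  by_cases h : l = []
  · subst h
    refine Submodule.mem_sup_left (Submodule.subset_span ⟨k, l', ?_, by simp [lower]⟩)
    simpa using hd
  · refine Submodule.mem_sup_right ?_
    have h1 := one_le_sum_wt h
    rw [mul_assoc, ← hd]
    exact vertexData.grading.mul_NL (lower_mem l)
      (vertexData.mem_NL_of_mem_deg (by omega) (H_zero_pow_mul_raise_mem k l'))

end Heisenberg

/-! ### Generators of the mode transition algebras -/

namespace GradedSeminorm

open scoped TensorProduct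

variable {R : Type*} [Ring R] [Algebra ℂ R] (G : GradedSeminorm R)

theorem tmul_mul_left {d : ℤ} {x u a y : R} (hx : x ∈ G.deg d) (hu : u ∈ G.deg 0)
    (ha : a ∈ G.deg 0) (hy : y ∈ G.deg (-d)) (hxu : x * u ∈ G.deg d) (hua : u * a ∈ G.deg 0) :
    G.tmul (x * u) a y hxu ha hy = G.tmul x (u * a) y hx hua hy :=
  (Submodule.Quotient.eq _).2 (Submodule.subset_span (Or.inl ⟨x, u, a, y, hx, hu, ha, hy, rfl⟩))

theorem tmul_mul_right {d : ℤ} {x u a y : R} (hx : x ∈ G.deg d) (hu : u ∈ G.deg 0)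
    (ha : a ∈ G.deg 0) (hy : y ∈ G.deg (-d)) (hau : a * u ∈ G.deg 0) (huy : u * y ∈ G.deg (-d)) :
    G.tmul x (a * u) y hx hau hy = G.tmul x a (u * y) hx ha huy :=
  (Submodule.Quotient.eq _).2 (Submodule.subset_span (Or.inr ⟨x, u, a, y, hx, hu, ha, hy, rfl⟩))

theorem quotient_induction {M : Type*} [AddCommGroup M] [Module ℂ M] {P N : Submodule ℂ R}
    {A : Set R} (hA : P ≤ Submodule.span ℂ A ⊔ N) (hAP : A ⊆ P) (hNP : N ≤ P)
    (f : (P ⧸ N.submoduleOf P) →ₗ[ℂ] M) {S : Submodule ℂ M}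
    (h : ∀ x (hx : x ∈ A), f (Submodule.Quotient.mk ⟨x, hAP hx⟩) ∈ S) (z : P ⧸ N.submoduleOf P) :
    f z ∈ S := by
  obtain ⟨⟨x, hx⟩, rfl⟩ := Submodule.Quotient.mk_surjective _ z
  have hle : P ≤ (S.comap (f ∘ₗ Submodule.mkQ _)).map P.subtype := by
    refine hA.trans (sup_le (Submodule.span_le.2 fun x hx => ?_) fun x hx => ?_)
    · exact ⟨⟨x, hAP hx⟩, h x hx, rfl⟩
    · refine ⟨⟨x, hNP hx⟩, ?_, rfl⟩
      have e : (Submodule.mkQ (N.submoduleOf P)) ⟨x, hNP hx⟩ = 0 :=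
        (Submodule.Quotient.mk_eq_zero _).2 hx
      rw [SetLike.mem_coe, Submodule.mem_comap, LinearMap.comp_apply, e, map_zero]
      exact S.zero_mem
  obtain ⟨x', hx', rfl⟩ := hle hx
  exact hx'

theorem modeTransition_induction {d : ℤ} {A B C : Set R} (S : Submodule ℂ (G.ModeTransition d))
    (hA : G.deg d ≤ Submodule.span ℂ A ⊔ G.NL 1 d) (hA' : A ⊆ G.deg d)
    (hB : G.deg 0 ≤ Submodule.span ℂ B ⊔ G.NL 1 0) (hB' : B ⊆ G.deg 0)
    (hC : G.deg (-d) ≤ Submodule.span ℂ C ⊔ G.NR 1 (-d)) (hC' : C ⊆ G.deg (-d))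
    (h : ∀ x (hx : x ∈ A) a (ha : a ∈ B) y (hy : y ∈ C),
      G.tmul x a y (hA' hx) (hB' ha) (hC' hy) ∈ S) (z : G.ModeTransition d) : z ∈ S := by
  have hNR : G.NR 1 (-d) ≤ G.deg (-d) := by
    rw [show (1 : ℤ) = 1 + d + -d by ring, G.NR_eq]
    exact G.NL_le _ _
  obtain ⟨z, rfl⟩ := Submodule.mkQ_surjective (G.balanced d) z
  induction z using TensorProduct.induction_on with
  | zero => exact S.zero_mem
  | add z w hz hw => rw [map_add]; exact S.add_mem hz hw
  | tmul x w =>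
    induction w using TensorProduct.induction_on with
    | zero => rw [TensorProduct.tmul_zero, map_zero]; exact S.zero_mem
    | add z w hz hw => rw [TensorProduct.tmul_add, map_add]; exact S.add_mem hz hw
    | tmul a y =>
      refine quotient_induction hA hA' (G.NL_le _ _) ((G.balanced d).mkQ ∘ₗ
        (TensorProduct.mk ℂ _ _).flip (a ⊗ₜ[ℂ] y)) (fun x hx => ?_) x
      refine quotient_induction hB hB' (G.NL_le _ _) ((G.balanced d).mkQ ∘ₗ
        TensorProduct.mk ℂ _ _ (Submodule.Quotient.mk ⟨x, hA' hx⟩) ∘ₗ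
        (TensorProduct.mk ℂ _ _).flip y) (fun a ha => ?_) a
      exact quotient_induction hC hC' hNR ((G.balanced d).mkQ ∘ₗ
        TensorProduct.mk ℂ _ _ (Submodule.Quotient.mk ⟨x, hA' hx⟩) ∘ₗ
        TensorProduct.mk ℂ _ _ (Submodule.Quotient.mk ⟨a, hB' ha⟩))
        (fun y hy => h x hx a ha y hy) y

end GradedSeminorm

namespace Heisenberg

open MvPolynomial GradedVertexData

/-- Partitions are encoded by lists of variable indices: the index `i` stands for the part `i + 1`,
its weight. -/
theorem exists_list_of_partition {d : ℕ} (r : Nat.Partition d) :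
    ∃ l : List ℕ, r.parts = (l.map (· + 1) : List ℕ) := by
  refine ⟨(r.parts.map Nat.pred).toList, ?_⟩
  rw [← Multiset.map_coe, Multiset.coe_toList, Multiset.map_map]
  refine (Multiset.map_id' _).symm.trans (Multiset.map_congr rfl fun k hk => ?_)
  exact (Nat.succ_pred_eq_of_pos (r.parts_pos hk)).symm

theorem sum_wt_eq (l : List ℕ) : (l.map wt).sum = ((l.map (· + 1)).sum : ℕ) := by
  induction l with
  | nil => rfl
  | cons j l ih => rw [List.map_cons, List.sum_cons, ih, List.map_cons, List.sum_cons, wt]; push_cast; ring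

theorem exists_partition_of_list {d : ℕ} {l : List ℕ} (h : (l.map wt).sum = d) :
    ∃ r : Nat.Partition d, r.parts = (l.map (· + 1) : List ℕ) := by
  rw [sum_wt_eq] at h
  refine ⟨⟨(l.map (· + 1) : List ℕ), fun {i} hi => ?_, by exact_mod_cast h⟩, rfl⟩
  obtain ⟨j, -, rfl⟩ := List.mem_map.1 (Multiset.mem_coe.1 hi)
  positivity

/-- Creation operators commute with each other, so the order in which the parts are listed is
irrelevant. -/
theorem creation_eq_lower {d : ℕ} {r : Nat.Partition d} {l : List ℕ}
    (h : r.parts = (l.map (· + 1) : List ℕ)) : creation r = lower l := by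
  have h1 : (l.map (· + 1)).Perm (r.parts.sort (· ≥ ·)) := by
    rw [← Multiset.coe_eq_coe, Multiset.sort_eq, h]
  have h2 := (h1.map fun k : ℕ => -(k : ℤ)).map H
  rw [List.map_map, List.map_map,
    show (H ∘ fun k : ℕ => -(k : ℤ)) ∘ (· + 1) = fun i => H (-wt i) by
      funext i; simp [wt]] at h2
  refine (h2.prod_eq' (List.pairwise_map.2 (List.pairwise_of_forall fun i j =>
    commute_H ?_))).symm
  rw [wt, wt]; omega

theorem annihilation_eq_raise {d : ℕ} {r : Nat.Partition d} {l : List ℕ}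
    (h : r.parts = (l.map (· + 1) : List ℕ)) : annihilation r = raise l := by
  have h1 : (l.map (· + 1)).Perm (r.parts.sort (· ≤ ·)) := by
    rw [← Multiset.coe_eq_coe, Multiset.sort_eq, h]
  have h2 := (h1.map fun k : ℕ => (k : ℤ)).map H
  rw [List.map_map, List.map_map,
    show (H ∘ fun k : ℕ => (k : ℤ)) ∘ (· + 1) = fun i => H (wt i) by
      funext i; simp [wt]] at h2
  refine (h2.prod_eq' (List.pairwise_map.2 (List.pairwise_of_forall fun i j =>
    commute_H ?_))).symm
  rw [wt, wt]; omega

/-- Modulo the neighbourhoods the outer factors are `lower l * H 0 ^ k` and `H 0 ^ k'' * raise l''`.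
A creation part of total weight zero is empty, so the middle factor is a power of `H 0`. The
relations over `𝒰_0` then collect all powers of `H 0` in the middle. -/
theorem span_generator (d : ℕ) :
    Submodule.span ℂ (Set.range fun t : (Nat.Partition d × Nat.Partition d) × ℕ =>
      generator t.1.1 t.1.2 t.2) = ⊤ := by
  rw [eq_top_iff]
  rintro z -
  have hA : {y | ∃ (l : List ℕ) (k : ℕ), (l.map wt).sum = (d : ℤ) ∧ lower l * H 0 ^ k = y} ⊆
      (vertexData.grading.deg d : Set vertexData.VEnv) := by
    rintro _ ⟨l, k, hl, rfl⟩
    have h := vertexData.grading.mul_mem (lower_mem l) (H_zero_pow_mem k)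
    rwa [hl, add_zero] at h
  have hB : {y | ∃ (l : List ℕ) (k : ℕ), (l.map wt).sum = 0 ∧ lower l * H 0 ^ k = y} ⊆
      (vertexData.grading.deg 0 : Set vertexData.VEnv) := by
    rintro _ ⟨l, k, hl, rfl⟩
    have h := vertexData.grading.mul_mem (lower_mem l) (H_zero_pow_mem k)
    rwa [hl, add_zero] at h
  have hC : {y | ∃ (k : ℕ) (l : List ℕ), (l.map wt).sum = (d : ℤ) ∧ H 0 ^ k * raise l = y} ⊆
      (vertexData.grading.deg (-d) : Set vertexData.VEnv) := by
    rintro _ ⟨k, l, hl, rfl⟩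
    have h := H_zero_pow_mul_raise_mem k l
    rwa [hl] at h
  refine vertexData.grading.modeTransition_induction _ (deg_le_lower d) hA (deg_le_lower 0) hB
    (deg_le_raise d) hC ?_ z
  rintro _ ⟨l, k, hl, rfl⟩ _ ⟨l', k', hl', rfl⟩ _ ⟨k'', l'', hl'', rfl⟩
  obtain ⟨r, hr⟩ := exists_partition_of_list hl
  obtain ⟨s, hs⟩ := exists_partition_of_list hl''
  obtain rfl : l' = [] := by
    by_contra h
    have := one_le_sum_wt h
    omega
  refine Submodule.subset_span ⟨((r, s), k + k' + k''), ?_⟩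
  have hr' : lower l ∈ vertexData.grading.deg d := hl ▸ lower_mem l
  have hs' : raise l'' ∈ vertexData.grading.deg (-d) := hl'' ▸ raise_mem l''
  have e : H 0 ^ k * (lower [] * H 0 ^ k') * H 0 ^ k'' = H 0 ^ (k + k' + k'') := by
    rw [lower, List.map_nil, List.prod_nil, one_mul, pow_add, pow_add]
  have h1 : H 0 ^ k * (lower [] * H 0 ^ k') ∈ vertexData.grading.deg 0 := by
    simpa using vertexData.grading.mul_mem (H_zero_pow_mem k) (hB ⟨[], k', hl', rfl⟩)
  rw [vertexData.grading.tmul_mul_left hr' (H_zero_pow_mem k) (hB ⟨[], k', hl', rfl⟩)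
      (hC ⟨k'', l'', hl'', rfl⟩) _ h1,
    ← vertexData.grading.tmul_mul_right hr' (H_zero_pow_mem k'') h1 hs' (e ▸ H_zero_pow_mem _)]
  simp only [generator, e, creation_eq_lower hr, annihilation_eq_raise hs]

end Heisenberg

/-! ### The rank-one action on vectors of weight `d` -/

namespace GradedSeminorm

open scoped TensorProduct

variable {R : Type*} [Ring R] [Algebra ℂ R] (G : GradedSeminorm R)

theorem modeTransition_induction_on {d : ℤ} {P : G.ModeTransition d → Prop}
    (z : G.ModeTransition d) (zero : P 0) (add : ∀ z w, P z → P w → P (z + w))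
    (tmul : ∀ (x a y : R) (hx : x ∈ G.deg d) (ha : a ∈ G.deg 0) (hy : y ∈ G.deg (-d)),
      P (G.tmul x a y hx ha hy)) : P z := by
  obtain ⟨z, rfl⟩ := Submodule.mkQ_surjective (G.balanced d) z
  induction z using G.pre_induction with
  | zero => exact zero
  | add z w hz hw => exact add _ _ hz hw
  | tmul x a y hx ha hy => exact tmul x a y hx ha hy

variable {M : Type*} [AddCommGroup M] [Module ℂ M]

/-- A linear map on the tensor product over `ℂ` which respects the relations descends to `𝔄_d`. -/
def liftModeTransition {d : ℤ} (f : G.PreModeTransition d →ₗ[ℂ] M)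
    (h : ∀ z ∈ G.balanced d, f z = 0) : G.ModeTransition d →ₗ[ℂ] M :=
  (G.balanced d).liftQ f h

end GradedSeminorm

namespace Heisenberg

open MvPolynomial GradedVertexData

theorem weight_eq_zero {s : ℕ →₀ ℕ} (h : Finsupp.weight wt s = 0) : s = 0 := by
  rw [weight_eq_sum, ← Multiset.coe_toList (Finsupp.toMultiset s), Multiset.map_coe,
    Multiset.sum_coe] at h
  have h1 : (Finsupp.toMultiset s).toList = [] := by
    by_contra h'
    have := one_le_sum_wt h'
    omega
  rw [Multiset.toList_eq_nil] at h1
  rw [← Multiset.toFinsupp.apply_symm_apply s]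
  exact (congrArg Multiset.toFinsupp h1).trans (map_zero _)

theorem eq_smul_one_of_mem_grade_zero {v : Fock} (hv : v ∈ grade 0) : v = coeff 0 v • 1 := by
  ext s
  rw [coeff_smul, coeff_one]
  by_cases hs : 0 = s
  · rw [if_pos hs, ← hs, smul_eq_mul, mul_one]
  · rw [if_neg hs, smul_zero]
    by_contra h
    exact hs (weight_eq_zero (hv h)).symm

theorem one_mem_grade : (1 : Fock) ∈ grade 0 := isWeightedHomogeneous_one ℂ wt

/-- The action of `x ∈ 𝒰_d` on the vacuum. -/
def vacuumAction (x : ℂ) (d : ℤ) : vertexData.grading.LQuot d →ₗ[ℂ] grade d :=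
  Submodule.liftQ _ (LinearMap.codRestrict (grade d)
    (LinearMap.applyₗ 1 ∘ₗ (vRep x).toLinearMap ∘ₗ (vertexData.grading.deg d).subtype) fun u => by
      have h := vRep_mem x u.2 one_mem_grade
      rwa [zero_add] at h) fun u hu =>
    LinearMap.mem_ker.2 (Subtype.ext (vRep_NL x zero_lt_one hu one_mem_grade))

/-- The character of the Zhu algebra on the vacuum. -/
def vacuumCharacter (x : ℂ) : vertexData.grading.Zhu →ₗ[ℂ] ℂ :=
  lcoeff ℂ 0 ∘ₗ (grade 0).subtype ∘ₗ vacuumAction x 0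

theorem vacuumCharacter_lcls (x : ℂ) {u : vertexData.VEnv} (hu : u ∈ vertexData.grading.deg 0) :
    vacuumCharacter x (vertexData.grading.lcls u hu) = coeff 0 (vRep x u 1) := rfl

/-- The weight zero space is the line of the vacuum, which `𝒰_0` preserves. -/
theorem vRep_of_mem_grade_zero (x : ℂ) {u : vertexData.VEnv} (hu : u ∈ vertexData.grading.deg 0)
    {v : Fock} (hv : v ∈ grade 0) :
    vRep x u v = vacuumCharacter x (vertexData.grading.lcls u hu) • v := by
  have h : vRep x u 1 ∈ grade 0 := by
    simpa using vRep_mem x hu one_mem_grade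
  rw [vacuumCharacter_lcls, eq_smul_one_of_mem_grade_zero hv, map_smul,
    eq_smul_one_of_mem_grade_zero h, smul_comm]
  simp

/-- The functional on vectors of weight `d` given by the vacuum component of the action of
`𝒰_{-d}`. -/
def covacuumAction (x : ℂ) (d : ℤ) :
    vertexData.grading.RQuot (-d) →ₗ[ℂ] Module.Dual ℂ (grade d) :=
  Submodule.liftQ _ ((LinearMap.llcomp ℂ (grade d) Fock ℂ (lcoeff ℂ 0)) ∘ₗ
    LinearMap.lcomp ℂ Fock (grade d).subtype ∘ₗ (vRep x).toLinearMap ∘ₗ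
      (vertexData.grading.deg (-d)).subtype) fun u hu => by
    refine LinearMap.mem_ker.2 (LinearMap.ext fun v => ?_)
    have h : (u : vertexData.VEnv) ∈ vertexData.grading.NL (1 + d) (-d) := by
      rw [← vertexData.grading.NR_eq, add_neg_cancel_right]
      exact hu
    change coeff 0 (vRep x u v) = 0
    rw [vRep_NL x (by omega) h v.2, coeff_zero]

theorem vRep_eq_covacuumAction (x : ℂ) {d : ℤ} {u : vertexData.VEnv}
    (hu : u ∈ vertexData.grading.deg (-d)) (v : grade d) :
    vRep x u v = covacuumAction x d (vertexData.grading.rcls u hu) v • 1 :=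
  eq_smul_one_of_mem_grade_zero (by simpa using vRep_mem x hu v.2)

open scoped TensorProduct

/-- `u ⊗ a ⊗ y` acts on vectors of weight `d` through the vacuum line. -/
def preRankOne (x : ℂ) (d : ℤ) :
    vertexData.grading.PreModeTransition d →ₗ[ℂ] Module.End ℂ (grade d) :=
  TensorProduct.lift ((LinearMap.smulRightₗ.flip ∘ₗ vacuumAction x d).compl₂
    (TensorProduct.lift ((LinearMap.lsmul ℂ (Module.Dual ℂ (grade d)) ∘ₗ
      vacuumCharacter x).compl₂ (covacuumAction x d))))

theorem preRankOne_tmul (x : ℂ) {d : ℤ} (u : vertexData.grading.LQuot d)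
    (a : vertexData.grading.Zhu) (y : vertexData.grading.RQuot (-d)) (v : grade d) :
    preRankOne x d (u ⊗ₜ[ℂ] (a ⊗ₜ[ℂ] y)) v =
      (vacuumCharacter x a * covacuumAction x d y v) • vacuumAction x d u := rfl

/-- Elements of `𝒰_0` act on the vacuum line by scalars that multiply, so it does not matter in
which tensor factor they stand. -/
theorem preRankOne_eq_zero (x : ℂ) (d : ℤ) (z : vertexData.grading.PreModeTransition d)
    (hz : z ∈ vertexData.grading.balanced d) : preRankOne x d z = 0 := by
  suffices h : vertexData.grading.balanced d ≤ LinearMap.ker (preRankOne x d) from h hz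
  refine Submodule.span_le.2 ?_
  rintro _ (⟨u, w, a, y, hu, hw, ha, hy, rfl⟩ | ⟨u, w, a, y, hu, hw, ha, hy, rfl⟩)
  · refine LinearMap.mem_ker.2 (LinearMap.ext fun v => Subtype.ext ?_)
    have h1 : vRep x (u * w) 1 = vacuumCharacter x (vertexData.grading.lcls w hw) • vRep x u 1 := by
      rw [map_mul, Module.End.mul_apply, vRep_of_mem_grade_zero x hw one_mem_grade, map_smul]
    have h2 : coeff 0 (vRep x (w * a) 1) = vacuumCharacter x (vertexData.grading.lcls w hw) *
        vacuumCharacter x (vertexData.grading.lcls a ha) := by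
      rw [map_mul, Module.End.mul_apply, vRep_of_mem_grade_zero x hw
        (by simpa using vRep_mem x ha one_mem_grade), coeff_smul, smul_eq_mul]
      rfl
    rw [map_sub, LinearMap.sub_apply, preRankOne_tmul, preRankOne_tmul]
    change _ • vRep x (u * w) 1 - (coeff 0 (vRep x (w * a) 1) * _) • vRep x u 1 = 0
    rw [h1, h2, smul_smul, ← sub_smul]
    convert zero_smul ℂ _
    ring
  · refine LinearMap.mem_ker.2 (LinearMap.ext fun v => Subtype.ext ?_)
    have h2 : coeff 0 (vRep x (a * w) 1) = vacuumCharacter x (vertexData.grading.lcls a ha) *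
        vacuumCharacter x (vertexData.grading.lcls w hw) := by
      rw [map_mul, Module.End.mul_apply, vRep_of_mem_grade_zero x ha
        (by simpa using vRep_mem x hw one_mem_grade), coeff_smul, smul_eq_mul]
      rfl
    have h3 : coeff 0 (vRep x (w * y) v) = vacuumCharacter x (vertexData.grading.lcls w hw) *
        coeff 0 (vRep x y v) := by
      rw [map_mul, Module.End.mul_apply, vRep_of_mem_grade_zero x hw
        (by simpa using vRep_mem x hy v.2), coeff_smul, smul_eq_mul]
    rw [map_sub, LinearMap.sub_apply, preRankOne_tmul, preRankOne_tmul]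
    change (coeff 0 (vRep x (a * w) 1) * coeff 0 (vRep x y v)) • vRep x u 1 -
      (_ * coeff 0 (vRep x (w * y) v)) • vRep x u 1 = 0
    rw [h2, h3, ← sub_smul]
    convert zero_smul ℂ _
    ring

/-- The action of the mode transition algebra on vectors of weight `d`. -/
def transitionRep (x : ℂ) (d : ℤ) :
    vertexData.grading.ModeTransition d →ₗ[ℂ] Module.End ℂ (grade d) :=
  vertexData.grading.liftModeTransition (M := grade d →ₗ[ℂ] grade d) (preRankOne x d)
    (preRankOne_eq_zero x d)

theorem transitionRep_tmul (x : ℂ) {d : ℤ} {u a y : vertexData.VEnv}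
    (hu : u ∈ vertexData.grading.deg d) (ha : a ∈ vertexData.grading.deg 0)
    (hy : y ∈ vertexData.grading.deg (-d)) (v : grade d) :
    (transitionRep x d (vertexData.grading.tmul u a y hu ha hy) v : Fock) =
      (coeff 0 (vRep x a 1) * coeff 0 (vRep x y v)) • vRep x u 1 := rfl

/-- In a composite of two such rank-one operators `y` meets `u'` applied to the vacuum. The result
is a multiple of the vacuum, and the scalar is the value of the character at `[y u']`, the middle
factor of `⋆`. -/
theorem transitionRep_mul (x : ℂ) {d : ℤ} (z w : vertexData.grading.ModeTransition d) :
    transitionRep x d (z * w) = transitionRep x d z * transitionRep x d w := by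
  induction z using vertexData.grading.modeTransition_induction_on with
  | zero => rw [zero_mul, map_zero, zero_mul]
  | add z z' hz hz' => rw [add_mul, map_add, map_add, add_mul, hz, hz']
  | tmul u a y hu ha hy =>
    induction w using vertexData.grading.modeTransition_induction_on with
    | zero => rw [mul_zero, map_zero, mul_zero]
    | add z z' hz hz' => rw [mul_add, map_add, map_add, mul_add, hz, hz']
    | tmul u' a' y' hu' ha' hy' =>
      refine LinearMap.ext fun v => Subtype.ext ?_
      have hu1 : vRep x u' 1 ∈ grade d := by simpa using vRep_mem x hu' one_mem_grade
      obtain ⟨c, hc⟩ : ∃ c : ℂ, vRep x a' 1 = c • 1 :=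
        ⟨_, vRep_of_mem_grade_zero x ha' one_mem_grade⟩
      obtain ⟨e, he⟩ : ∃ e : ℂ, vRep x y (vRep x u' 1) = e • 1 :=
        ⟨_, vRep_eq_covacuumAction x hy ⟨_, hu1⟩⟩
      rw [Module.End.mul_apply, vertexData.grading.tmul_mul_tmul, transitionRep_tmul,
        transitionRep_tmul, transitionRep_tmul, map_smul, coeff_smul]
      simp only [map_mul, Module.End.mul_apply, hc, he, map_smul, coeff_smul, coeff_one, smul_eq_mul,
        if_true, mul_one]
      congr 1
      ring

end Heisenberg

/-! ### The matrices of the generators and the isomorphism -/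

namespace Heisenberg

open MvPolynomial GradedVertexData

theorem vRep_lower (x : ℂ) (l : List ℕ) (v : Fock) :
    vRep x (lower l) v = monomial (Multiset.toFinsupp (l : Multiset ℕ)) 1 * v := by
  induction l with
  | nil =>
    rw [lower, List.map_nil, List.prod_nil, map_one, Module.End.one_apply]
    change v = monomial 0 1 * v
    rw [monomial_zero', C_1, one_mul]
  | cons j l ih =>
    have e : vRep x (lower (j :: l)) v = vRep x (H (-wt j)) (vRep x (lower l) v) := by
      rw [lower, List.map_cons, List.prod_cons, map_mul, Module.End.mul_apply, lower]
    rw [e, ih, vRep_H, oscAt_of_ne x (by rw [wt]; omega), osc_neg j _ (by rw [wt]; ring),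
      ← mul_assoc, ← Multiset.cons_coe, ← Multiset.singleton_add, Multiset.toFinsupp_add,
      Multiset.toFinsupp_singleton, X, monomial_mul, one_mul]

/-- `∏ tᵢ!`. -/
def factorialProd (t : ℕ →₀ ℕ) : ℕ := t.prod fun _ n => n.factorial

theorem factorialProd_add_single (t : ℕ →₀ ℕ) (j : ℕ) :
    factorialProd (t + Finsupp.single j 1) = (t j + 1) * factorialProd t := by
  have h1 := Finsupp.mul_prod_erase' t j (fun _ n => n.factorial) fun _ => rfl
  have h2 := Finsupp.mul_prod_erase' (t + Finsupp.single j 1) j (fun _ n => n.factorial) fun _ => rfl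
  have e : (t + Finsupp.single j 1).erase j = t.erase j := by
    rw [Finsupp.erase_add, Finsupp.erase_single, add_zero]
  rw [e, Finsupp.add_apply, Finsupp.single_eq_same, Nat.factorial_succ, mul_assoc, h1] at h2
  exact h2.symm

/-- The operator of index `j + 1` acts as `(j+1) ∂_j`. A constant term survives only if the
derivatives match the monomial exactly, and they then produce the factorials. The induction removes
the last operator of the list, since that one acts first. -/
theorem coeff_vRep_raise (x : ℂ) (l : List ℕ) (t : ℕ →₀ ℕ) :
    coeff 0 (vRep x (raise l) (monomial t 1)) =
      if t = Multiset.toFinsupp (l : Multiset ℕ) then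
        (((l.map (· + 1)).prod * factorialProd t : ℕ) : ℂ) else 0 := by
  induction l using List.reverseRecOn generalizing t with
  | nil =>
    rw [raise, List.map_nil, List.prod_nil, map_one, Module.End.one_apply, coeff_monomial]
    change _ = if t = 0 then _ else _
    split_ifs with h
    · subst h; simp [factorialProd]
    · rfl
  | append_singleton l j ih =>
    have e1 : vRep x (raise (l ++ [j])) (monomial t 1) =
        (((j : ℂ) + 1) * t j) • vRep x (raise l) (monomial (t - Finsupp.single j 1) 1) := by
      rw [raise, List.map_append, List.prod_append, map_mul, Module.End.mul_apply, List.map_singleton,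
        List.prod_singleton, vRep_H, oscAt_of_ne x (by rw [wt]; omega), raise,
        show wt j = ((j + 1 : ℕ) : ℤ) by rw [wt]; push_cast; rfl, osc_succ, pderiv_monomial, one_mul,
        show (monomial (t - Finsupp.single j 1) (t j : ℂ)) =
          (t j : ℂ) • monomial (t - Finsupp.single j 1) 1 by rw [smul_monomial, smul_eq_mul, mul_one],
        map_smul, map_smul, smul_smul]
    have e2 : Multiset.toFinsupp ((l ++ [j] : List ℕ) : Multiset ℕ) =
        Multiset.toFinsupp (l : Multiset ℕ) + Finsupp.single j 1 := by
      rw [← Multiset.coe_add, Multiset.toFinsupp_add, Multiset.coe_singleton,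
        Multiset.toFinsupp_singleton]
    rw [e1, coeff_smul, ih, e2, smul_eq_mul]
    by_cases h0 : t j = 0
    · rw [h0, Nat.cast_zero, mul_zero, zero_mul, if_neg]
      intro h
      rw [h] at h0
      simp at h0
    · obtain ⟨t', rfl⟩ : ∃ t', t = t' + Finsupp.single j 1 :=
        ⟨t - Finsupp.single j 1, (tsub_add_cancel_of_le
          (Finsupp.single_le_iff.2 (Nat.one_le_iff_ne_zero.2 h0))).symm⟩
      rw [add_tsub_cancel_right]
      by_cases ht : t' = Multiset.toFinsupp (l : Multiset ℕ)
      · rw [if_pos ht, if_pos (congrArg (· + _) ht), factorialProd_add_single, List.map_append, List.prod_append]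
        simp
        ring
      · rw [if_neg ht, if_neg fun h => ht (add_right_cancel h), mul_zero]

theorem vRep_H_zero_pow (x : ℂ) (k : ℕ) : vRep x (H 0 ^ k) 1 = x ^ k • 1 := by
  induction k with
  | zero => simp
  | succ k ih =>
    rw [pow_succ', map_mul, Module.End.mul_apply, ih, vRep_H, oscAt_zero_index,
      LinearMap.smul_apply, LinearMap.id_apply, smul_smul, pow_succ']

/-- The exponents of the monomial in the Fock space attached to a partition. -/
def exponent {d : ℕ} (r : Nat.Partition d) : ℕ →₀ ℕ := Multiset.toFinsupp (r.parts.map Nat.pred)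

theorem exponent_eq {d : ℕ} {r : Nat.Partition d} {l : List ℕ}
    (h : r.parts = (l.map (· + 1) : List ℕ)) :
    exponent r = Multiset.toFinsupp (l : Multiset ℕ) := by
  rw [exponent, h, Multiset.map_coe, List.map_map]
  congr 2
  exact List.map_id l

theorem exponent_injective {d : ℕ} : Function.Injective (exponent (d := d)) := by
  intro r s h
  obtain ⟨l, hl⟩ := exists_list_of_partition r
  obtain ⟨l', hl'⟩ := exists_list_of_partition s
  rw [exponent_eq hl, exponent_eq hl'] at h
  have h' := Multiset.toFinsupp.injective h
  refine Nat.Partition.ext ?_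
  rw [hl, hl', ← Multiset.map_coe, ← Multiset.map_coe, h']

theorem weight_exponent {d : ℕ} (r : Nat.Partition d) : Finsupp.weight wt (exponent r) = d := by
  obtain ⟨l, hl⟩ := exists_list_of_partition r
  rw [exponent_eq hl, weight_eq_sum, Multiset.toFinsupp_toMultiset, Multiset.map_coe,
    Multiset.sum_coe, sum_wt_eq, ← Multiset.sum_coe, ← hl, r.parts_sum]

theorem normPartition_eq {d : ℕ} {r : Nat.Partition d} {l : List ℕ}
    (h : r.parts = (l.map (· + 1) : List ℕ)) :
    normPartition r = (l.map (· + 1)).prod * factorialProd (exponent r) := by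
  rw [normPartition, exponent_eq h, h, Multiset.prod_coe, factorialProd, Finsupp.prod,
    Multiset.toFinsupp_support, ← Multiset.map_coe, Multiset.toFinset_map,
    Finset.prod_image fun _ _ _ _ h => Nat.succ_injective h]
  congr 1
  refine Finset.prod_congr rfl fun i _ => ?_
  rw [Multiset.count_map_eq_count' _ _ Nat.succ_injective, Multiset.toFinsupp_apply]

theorem normPartition_pos {d : ℕ} (r : Nat.Partition d) : 0 < normPartition r := by
  refine Nat.mul_pos (Nat.pos_of_ne_zero ?_) (Finset.prod_pos fun i _ => Nat.factorial_pos _)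
  rw [Ne, Multiset.prod_eq_zero_iff]
  exact fun h => (r.parts_pos h).ne' rfl

/-- The monomial in the Fock space attached to a partition of `d`. -/
def partitionState {d : ℕ} (r : Nat.Partition d) : grade d :=
  ⟨monomial (exponent r) 1, by
    have h := monomial_mem_grade (exponent r)
    rwa [weight_exponent] at h⟩

/-- The annihilation operators pair `s` with `t` diagonally with value `‖s‖`, the power of `H 0`
contributes `x^k`, and the creation operators rebuild the monomial of `r`. -/
theorem transitionRep_generator (x : ℂ) {d : ℕ} (r s t : Nat.Partition d) (k : ℕ) :
    transitionRep x d (generator r s k) (partitionState t) =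
      if t = s then (x ^ k * normPartition s) • partitionState r else 0 := by
  obtain ⟨l, hl⟩ := exists_list_of_partition r
  obtain ⟨l', hl'⟩ := exists_list_of_partition s
  refine Subtype.ext ?_
  rw [generator, transitionRep_tmul, vRep_H_zero_pow, creation_eq_lower hl,
    annihilation_eq_raise hl', vRep_lower, mul_one, ← exponent_eq hl, partitionState,
    coeff_vRep_raise, ← exponent_eq hl', coeff_smul, coeff_one, if_pos rfl, smul_eq_mul, mul_one]
  by_cases h : t = s
  · rw [if_pos (congrArg exponent h), if_pos h, normPartition_eq hl', h]
    rfl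
  · rw [if_neg fun h' => h (exponent_injective h'), if_neg h, mul_zero, zero_smul]
    rfl

/-- The square root of `‖r‖`. -/
def sqrtNorm {d : ℕ} (r : Nat.Partition d) : ℂ := (√(normPartition r : ℝ) : ℂ)

theorem sqrtNorm_mul_self {d : ℕ} (r : Nat.Partition d) :
    sqrtNorm r * sqrtNorm r = normPartition r := by
  rw [sqrtNorm, ← Complex.ofReal_mul, Real.mul_self_sqrt (Nat.cast_nonneg _), Complex.ofReal_natCast]

theorem sqrtNorm_ne_zero {d : ℕ} (r : Nat.Partition d) : sqrtNorm r ≠ 0 := by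
  intro h
  have h' := sqrtNorm_mul_self r
  rw [h, zero_mul] at h'
  exact (normPartition_pos r).ne' (by exact_mod_cast h'.symm)

/-- The matrix of the action of the mode transition algebra on vectors of weight `d`, in the
orthonormal basis of normalized monomials. -/
def transitionMatrix (x : ℂ) (d : ℕ) :
    ModeTransitionAlgebra d →ₗ[ℂ] Matrix (Nat.Partition d) (Nat.Partition d) ℂ where
  toFun z := Matrix.of fun r s => sqrtNorm r * (sqrtNorm s)⁻¹ *
    coeff (exponent r) (transitionRep x d z (partitionState s) : Fock)
  map_add' z w := by
    ext r s
    simp [mul_add]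
  map_smul' c z := by
    ext r s
    simp [mul_left_comm]

theorem transitionMatrix_generator (x : ℂ) {d : ℕ} (r s : Nat.Partition d) (k : ℕ) :
    transitionMatrix x d (generator r s k) =
      Matrix.single r s (sqrtNorm r * sqrtNorm s * x ^ k) := by
  ext r' s'
  change sqrtNorm r' * (sqrtNorm s')⁻¹ * coeff (exponent r')
    (transitionRep x d (generator r s k) (partitionState s') : Fock) = _
  rw [transitionRep_generator, Matrix.single_apply]
  by_cases hs : s' = s
  · subst hs
    rw [if_pos rfl, Submodule.coe_smul, coeff_smul, partitionState, coeff_monomial]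
    by_cases hr : r = r'
    · subst hr
      rw [if_pos rfl, if_pos ⟨rfl, rfl⟩, ← sqrtNorm_mul_self]
      have := sqrtNorm_ne_zero s'
      simp only [smul_eq_mul]
      field_simp
    · rw [if_neg fun h => hr (exponent_injective h), if_neg fun h => hr h.1, smul_zero, mul_zero]
  · rw [if_neg hs, if_neg fun h => hs h.2.symm, Submodule.coe_zero, coeff_zero, mul_zero]

/-- Checked on the spanning generators, where `transitionRep_mul` gives the product explicitly. In
this way it is not needed that the states `partitionState` form a basis of the weight space. -/
theorem transitionMatrix_mul (x : ℂ) {d : ℕ} (z w : ModeTransitionAlgebra d) :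
    transitionMatrix x d (z * w) = transitionMatrix x d z * transitionMatrix x d w := by
  have key : ∀ r s k r' s' k', transitionMatrix x d (generator r s k * generator r' s' k') =
      transitionMatrix x d (generator r s k) * transitionMatrix x d (generator r' s' k') := by
    intro r s k r' s' k'
    rw [transitionMatrix_generator, transitionMatrix_generator]
    ext p q
    change sqrtNorm p * (sqrtNorm q)⁻¹ * coeff (exponent p)
      (transitionRep x d (generator r s k * generator r' s' k') (partitionState q) : Fock) = _
    rw [transitionRep_mul, Module.End.mul_apply, transitionRep_generator]
    by_cases hq : q = s'
    · subst hq
      rw [if_pos rfl, map_smul, transitionRep_generator]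
      by_cases hs : r' = s
      · subst hs
        rw [if_pos rfl, Matrix.single_mul_single_same, Matrix.single_apply, Submodule.coe_smul,
          Submodule.coe_smul, coeff_smul, coeff_smul, partitionState, coeff_monomial]
        by_cases hr : r = p
        · subst hr
          rw [if_pos rfl, if_pos ⟨rfl, rfl⟩, ← sqrtNorm_mul_self, ← sqrtNorm_mul_self]
          have := sqrtNorm_ne_zero q
          simp only [smul_eq_mul]
          field_simp
        · rw [if_neg fun h => hr (exponent_injective h), if_neg fun h => hr h.1, smul_zero,
            smul_zero, mul_zero]
      · rw [if_neg hs, Matrix.single_mul_single_of_ne _ _ _ _ (Ne.symm hs)]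
        simp
    · rw [if_neg hq, map_zero]
      simp only [Submodule.coe_zero, coeff_zero, mul_zero]
      by_cases hs : s = r'
      · subst hs
        rw [Matrix.single_mul_single_same, Matrix.single_apply, if_neg fun h => hq h.2.symm]
      · rw [Matrix.single_mul_single_of_ne _ _ _ _ hs]
        simp
  have hz : z ∈ (⊤ : Submodule ℂ (ModeTransitionAlgebra d)) := trivial
  have hw : w ∈ (⊤ : Submodule ℂ (ModeTransitionAlgebra d)) := trivial
  rw [← span_generator] at hz hw
  induction hz, hw using Submodule.span_induction₂ with
  | mem_mem z w hz hw =>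
    obtain ⟨t, rfl⟩ := hz
    obtain ⟨t', rfl⟩ := hw
    exact key _ _ _ _ _ _
  | zero_left w _ => rw [zero_mul, map_zero, zero_mul]
  | zero_right z _ => rw [mul_zero, map_zero, mul_zero]
  | add_left z z' w _ _ _ h h' => rw [add_mul, map_add, map_add, add_mul, h, h']
  | add_right z w w' _ _ _ h h' => rw [mul_add, map_add, map_add, mul_add, h, h']
  | smul_left c z w _ _ h => rw [smul_mul_assoc, map_smul, map_smul, smul_mul_assoc, h]
  | smul_right c z w _ _ h => rw [mul_smul_comm, map_smul, map_smul, mul_smul_comm, h]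

/-- Each matrix entry is the value at `x` of a polynomial whose coefficients are those of `c` times
nonzero square roots. Vanishing at all complex `x` makes the polynomial zero. -/
theorem eq_zero_of_transitionMatrix (d : ℕ) (c : (Nat.Partition d × Nat.Partition d) × ℕ →₀ ℂ)
    (h : ∀ x, transitionMatrix x d (Finsupp.linearCombination ℂ
      (fun t : (Nat.Partition d × Nat.Partition d) × ℕ => generator t.1.1 t.1.2 t.2) c) = 0) :
    c = 0 := by
  set P : Matrix (Nat.Partition d) (Nat.Partition d) (Polynomial ℂ) :=
    c.sum fun t y => Matrix.single t.1.1 t.1.2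
      (Polynomial.monomial t.2 (y * (sqrtNorm t.1.1 * sqrtNorm t.1.2))) with hP
  have h1 : ∀ r s k, (P r s).coeff k = c ((r, s), k) * (sqrtNorm r * sqrtNorm s) := by
    intro r s k
    rw [hP, Finsupp.sum, Matrix.sum_apply, Polynomial.finsetSum_coeff,
      Finset.sum_eq_single ((r, s), k)]
    · rw [Matrix.single_apply, if_pos ⟨rfl, rfl⟩, Polynomial.coeff_monomial, if_pos rfl]
    · rintro ⟨⟨r', s'⟩, k'⟩ - hne
      rw [Matrix.single_apply]
      split_ifs with h
      · rw [Polynomial.coeff_monomial, if_neg]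
        rintro rfl
        exact hne (Prod.ext (Prod.ext h.1 h.2) rfl)
      · exact Polynomial.coeff_zero _
    · intro hc
      rw [Finsupp.notMem_support_iff.1 hc, zero_mul, map_zero, Matrix.single_zero]
      exact Polynomial.coeff_zero _
  have h2 : ∀ r s, P r s = 0 := by
    intro r s
    refine Polynomial.funext fun x => ?_
    have hx := congrFun (congrFun (h x) r) s
    rw [Finsupp.linearCombination_apply, Finsupp.sum, map_sum, Matrix.sum_apply] at hx
    rw [hP, Finsupp.sum, Matrix.sum_apply, Polynomial.eval_finsetSum, Polynomial.eval_zero]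
    refine Eq.trans (Finset.sum_congr rfl fun t _ => ?_) hx
    rw [map_smul, transitionMatrix_generator, Matrix.smul_apply, Matrix.single_apply,
      Matrix.single_apply]
    split_ifs
    · rw [Polynomial.eval_monomial, smul_eq_mul]; ring
    · rw [Polynomial.eval_zero, smul_zero]
  ext ⟨⟨r, s⟩, k⟩
  have h3 := h1 r s k
  rw [h2, Polynomial.coeff_zero] at h3
  exact (mul_eq_zero.1 h3.symm).resolve_right (mul_ne_zero (sqrtNorm_ne_zero r) (sqrtNorm_ne_zero s))

/-- The basis of the mode transition algebra by the normally ordered generators. -/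
def generatorBasis (d : ℕ) :
    Module.Basis ((Nat.Partition d × Nat.Partition d) × ℕ) ℂ (ModeTransitionAlgebra d) :=
  Module.Basis.mk (v := fun t : (Nat.Partition d × Nat.Partition d) × ℕ =>
      generator t.1.1 t.1.2 t.2)
    (linearIndependent_iff.2 fun c hc =>
      eq_zero_of_transitionMatrix d c fun x => by rw [hc, map_zero]) (span_generator d).ge

theorem generatorBasis_apply (d : ℕ) (t : (Nat.Partition d × Nat.Partition d) × ℕ) :
    generatorBasis d t = generator t.1.1 t.1.2 t.2 := Module.Basis.mk_apply _ _ t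

/-- The linear isomorphism to matrices over the polynomial ring. -/
def matrixMap (d : ℕ) : ModeTransitionAlgebra d →ₗ[ℂ]
    Matrix (Nat.Partition d) (Nat.Partition d) (Polynomial ℂ) :=
  (generatorBasis d).constr ℂ fun t => Matrix.single t.1.1 t.1.2
    (Polynomial.C (sqrtNorm t.1.1 * sqrtNorm t.1.2) * Polynomial.X ^ t.2)

theorem matrixMap_generator {d : ℕ} (r s : Nat.Partition d) (k : ℕ) :
    matrixMap d (generator r s k) =
      Matrix.single r s (Polynomial.C (sqrtNorm r * sqrtNorm s) * Polynomial.X ^ k) := by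
  have h := (generatorBasis d).constr_basis ℂ (fun t => Matrix.single t.1.1 t.1.2
    (Polynomial.C (sqrtNorm t.1.1 * sqrtNorm t.1.2) * Polynomial.X ^ t.2)) ((r, s), k)
  rwa [generatorBasis_apply] at h

theorem eval_matrixMap (x : ℂ) {d : ℕ} (z : ModeTransitionAlgebra d) :
    (matrixMap d z).map (Polynomial.eval x) = transitionMatrix x d z := by
  have key : (Polynomial.leval x).mapMatrix ∘ₗ matrixMap d = transitionMatrix x d := by
    refine (generatorBasis d).ext fun t => ?_
    rw [LinearMap.comp_apply, generatorBasis_apply, matrixMap_generator, transitionMatrix_generator]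
    ext p q
    simp only [LinearMap.mapMatrix_apply, Matrix.map_apply, Matrix.single_apply]
    split_ifs
    · simp [Polynomial.leval]
    · simp
  exact LinearMap.congr_fun key z

/-- Polynomials over `ℂ` are determined by their values, and at each `x` the identity is
`transitionMatrix_mul`. -/
theorem matrixMap_mul {d : ℕ} (z w : ModeTransitionAlgebra d) :
    matrixMap d (z * w) = matrixMap d z * matrixMap d w := by
  ext1 p q
  refine Polynomial.funext fun x => ?_
  have h := congrFun (congrFun (transitionMatrix_mul x z w) p) q
  rw [← eval_matrixMap, ← eval_matrixMap, ← eval_matrixMap, Matrix.mul_apply] at h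
  rw [Matrix.mul_apply, Polynomial.eval_finsetSum]
  simpa using h

theorem matrixMap_injective (d : ℕ) : Function.Injective (matrixMap d) := by
  refine (injective_iff_map_eq_zero _).2 fun z hz => ?_
  have hc := eq_zero_of_transitionMatrix d ((generatorBasis d).repr z) fun x => by
    have e : Finsupp.linearCombination ℂ (fun t : (Nat.Partition d × Nat.Partition d) × ℕ =>
        generator t.1.1 t.1.2 t.2) ((generatorBasis d).repr z) = z := by
      have h := (generatorBasis d).linearCombination_repr z
      rwa [show ⇑(generatorBasis d) = _ from funext (generatorBasis_apply d)] at h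
    rw [e, ← eval_matrixMap, hz]
    ext
    simp
  exact (map_eq_zero_iff _ (generatorBasis d).repr.injective).1 hc

theorem matrixMap_surjective (d : ℕ) : Function.Surjective (matrixMap d) := by
  rw [← LinearMap.range_eq_top, eq_top_iff]
  rintro M -
  rw [Matrix.matrix_eq_sum_single M]
  refine Submodule.sum_mem _ fun r _ => Submodule.sum_mem _ fun s _ => ?_
  induction M r s using Polynomial.induction_on' with
  | add p q hp hq => rw [Matrix.single_add]; exact Submodule.add_mem _ hp hq
  | monomial k c =>
    refine ⟨(c * (sqrtNorm r * sqrtNorm s)⁻¹) • generator r s k, ?_⟩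
    rw [map_smul, matrixMap_generator, Matrix.smul_single, Polynomial.smul_eq_C_mul, ← mul_assoc,
      ← Polynomial.C_mul, inv_mul_cancel_right₀
        (mul_ne_zero (sqrtNorm_ne_zero r) (sqrtNorm_ne_zero s)), Polynomial.C_mul_X_pow_eq_monomial]

end Heisenberg

end

theorem proposition7p2p1 (d : ℕ) :
    (∃ φ : Heisenberg.ModeTransitionAlgebra d →ₙₐ[ℂ]
        Matrix (Nat.Partition d) (Nat.Partition d) (Polynomial ℂ),
      Function.Bijective φ ∧
      ∀ (r s : Nat.Partition d) (k : ℕ),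
        φ (Heisenberg.generator r s k) =
          Matrix.single r s
            (Polynomial.C ((√(Heisenberg.normPartition r : ℝ) : ℂ) *
              (√(Heisenberg.normPartition s : ℝ) : ℂ)) * Polynomial.X ^ k)) ∧
    ∃ e : Heisenberg.ModeTransitionAlgebra d, ∀ a, e * a = a ∧ a * e = a := by
  refine ⟨⟨{ Heisenberg.matrixMap d with
      map_zero' := (Heisenberg.matrixMap d).map_zero
      map_mul' := Heisenberg.matrixMap_mul },
    ⟨Heisenberg.matrixMap_injective d, Heisenberg.matrixMap_surjective d⟩,
    Heisenberg.matrixMap_generator⟩, ?_⟩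
  -- The identity element is the preimage of the identity matrix.
  obtain ⟨e, he⟩ := Heisenberg.matrixMap_surjective d 1
  refine ⟨e, fun a => ⟨Heisenberg.matrixMap_injective d ?_, Heisenberg.matrixMap_injective d ?_⟩⟩
  · rw [Heisenberg.matrixMap_mul, he, one_mul]
  · rw [Heisenberg.matrixMap_mul, he, mul_one]
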